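/- Let $\ell>0$, let $\Lambda_\ell=(\mathbb R/\ell\mathbb Z)^3$ be the three-dimensional torus of side length $\ell$, let $\mathcal F=\bigoplus_{n\ge 0}\bigotimes^n_{\rm sym}L^2(\mathbb R^3)$ be the bosonic Fock space, and let $\mathscr H_\ell=L^2(\Lambda_\ell)\otimes\mathcal F$. Elements of $\mathscr H_\ell$ are written $\Psi=(\Psi^{(n)})_{n\ge 0}$ with $\Psi^{(n)}(x,y_1,\dots,y_n)$ square integrable on $\Lambda_\ell\times\mathbb R^{3n}$ and symmetric in $y_1,\dots,y_n$. For $\alpha>0$ let $$h_\ell=(-\mathrm i\nabla_x-P_f)^2+N+\sqrt\alpha\,\big(a(v)+a^*(v)\big),\qquad v(y)=\frac{1}{|y|^{2}},$$ where $P_f=\mathrm d\Gamma(-\mathrm i\nabla)$, $N=\mathrm d\Gamma(1)$ and $(a(v)\Psi)^{(n)}(x,y_1,\dots,y_n)=\sqrt{n+1}\int_{\mathbb R^3}v(y)\Psi^{(n+1)}(x,y_1,\dots,y_n,y)\,dy$. Since $v\notin L^2(\mathbb R^3)$, this is understood as the operator associated with the sesquilinear form $$q(\Phi,\Psi)=\langle(-\mathrm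 i\nabla_x-P_f)\Phi,(-\mathrm i\nabla_x-P_f)\Psi\rangle+\langle N^{1/2}\Phi,N^{1/2}\Psi\rangle+\sqrt\alpha\sum_{n\ge0}\Big(\big\langle\Phi^{(n)},(a(v)\Psi)^{(n)}\big\rangle+\big\langle (a(v)\Phi)^{(n)},\Psi^{(n)}\big\rangle\Big)$$ on the form domain $\mathcal Q$ of $(-\mathrm i\nabla_x-P_f)^2+N$; that is, $\Psi\in D(h_\ell)$ and $h_\ell\Psi=\eta$ if and only if $\Psi\in\mathcal Q$ and $q(\Phi,\Psi)=\langle\Phi,\eta\rangle$ for all $\Phi\in\mathcal Q$. Let $$\mathcal C=\big\{\Psi\in\mathscr H_\ell \,:\, (-1)^n\Psi^{(n)}(x,y_1,\dots,y_n)\ge 0\ \text{almost everywhere, for all } n\ge 0\big\}.$$ Then, for all $\alpha>0$ and $\ell>0$, the infimum $\inf\sigma(h_\ell)$ of the spectrum of $h_\ell$ is finite, and for every real $\lambda>-\inf\sigma(h_\ell)$ the resolvent $(h_\ell+\lambda)^{-1}$ is positivity improving with respect to $\mathcal C$, that is, $\langle(h_\ell+\lambda)^{-1}u,w\rangle>0$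 for all $u,w\in\mathcal C\setminus\{0\}$. -/

import Mathlib

open MeasureTheory
open scoped ComplexOrder ENNReal InnerProductSpace

noncomputable section

namespace Polaron

/-- Physical space `ℝ³` with the Euclidean norm and Lebesgue measure. -/
abbrev R3 : Type := EuclideanSpace ℝ (Fin 3)

/-- The cube `[0, ℓ]³` with periodic boundary conditions, i.e. the torus `(ℝ / ℓℤ)³`. -/
abbrev Torus (ℓ : ℝ) : Type := Fin 3 → AddCircle ℓ

/-- Configurations `(x, y₁, …, yₙ)` of one electron on the torus and `n` phonons in `ℝ³`. -/
abbrev Conf (ℓ : ℝ) (n : ℕ) : Type := Torus ℓ × (Fin n → R3)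

section

variable (ℓ : ℝ) [Fact (0 < ℓ)] (n : ℕ)

/-- Square integrable (not necessarily symmetric) functions of `(x, y₁, …, yₙ)`. -/
abbrev L2 : Type := Lp ℂ 2 (volume : Measure (Conf ℓ n))

/-- Relabelling of the phonons. -/
def permMap (σ : Equiv.Perm (Fin n)) (z : Conf ℓ n) : Conf ℓ n := (z.1, fun j => z.2 (σ j))

theorem permMap_preserving (σ : Equiv.Perm (Fin n)) :
    MeasurePreserving (permMap ℓ n σ) volume volume := by
  have h := volume_measurePreserving_piCongrLeft (fun _ : Fin n => R3) σ.symm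
  have h2 : MeasurePreserving (fun (y : Fin n → R3) (j : Fin n) => y (σ j)) volume volume := by
    convert h using 1
    funext y j
    have := Equiv.piCongrLeft_apply_apply (P := fun _ : Fin n => R3) σ.symm y (σ j)
    simpa [MeasurableEquiv.coe_piCongrLeft] using this.symm
  exact (MeasurePreserving.id volume).prod h2

/-- The displacement `(t eᵢ, -t eᵢ, …, -t eᵢ)`. -/
def displacement (i : Fin 3) (t : ℝ) : Conf ℓ n :=
  (Pi.single i (t : AddCircle ℓ), fun _ => -EuclideanSpace.single i t)

/-- The map `(x, y₁, …, yₙ) ↦ (x + t eᵢ, y₁ - t eᵢ, …, yₙ - t eᵢ)`. -/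
def shiftMap (i : Fin 3) (t : ℝ) (z : Conf ℓ n) : Conf ℓ n := z + displacement ℓ n i t

theorem shiftMap_preserving (i : Fin 3) (t : ℝ) :
    MeasurePreserving (shiftMap ℓ n i t) volume volume :=
  (volume_preserving_pi fun k =>
      measurePreserving_add_right (volume : Measure (AddCircle ℓ))
        ((displacement ℓ n i t).1 k)).prod
    (volume_preserving_pi fun j =>
      measurePreserving_add_right (volume : Measure R3) ((displacement ℓ n i t).2 j))

/-- `L²(Λ_ℓ) ⊗ F⁽ⁿ⁾`: the square integrable functions of `(x, y₁, …, yₙ)` that are symmetric in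
the phonon variables. -/
def nPhonon : Submodule ℂ (L2 ℓ n) :=
  ⨅ σ : Equiv.Perm (Fin n),
    LinearMap.eqLocus
      (Lp.compMeasurePreservingₗ ℂ (permMap ℓ n σ) (permMap_preserving ℓ n σ)) LinearMap.id

/-- The Hilbert space `L²(Λ_ℓ) ⊗ F`, with `F` the bosonic Fock space over `L²(ℝ³)`, as the Hilbert
sum of its `n`-phonon sectors. -/
abbrev Hilb : Type := lp (fun n : ℕ => nPhonon ℓ n) 2

variable {ℓ}

/-- The `n`-phonon component `Ψ⁽ⁿ⁾(x, y₁, …, yₙ)`. -/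
def comp (Ψ : Hilb ℓ) (n : ℕ) : L2 ℓ n := (Ψ n : nPhonon ℓ n)

variable {n}

/-- The unitary group `t ↦ f(x + t eᵢ, y₁ - t eᵢ, …, yₙ - t eᵢ)` generated by the `i`-th component
of `-i∇ₓ - P_f`, where `P_f = dΓ(-i∇)`. -/
def shift (i : Fin 3) (f : L2 ℓ n) (t : ℝ) : L2 ℓ n :=
  Lp.compMeasurePreserving (shiftMap ℓ n i t) (shiftMap_preserving ℓ n i t) f

/-- `f` lies in the domain of the `i`-th component of `∇ₓ - ∑ⱼ ∇_{yⱼ} = i(-i∇ₓ - P_f)`. -/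
def InGradDomain (i : Fin 3) (f : L2 ℓ n) : Prop := DifferentiableAt ℝ (shift i f) 0

/-- The `i`-th component of `(∇ₓ - ∑ⱼ ∇_{yⱼ}) f`, as a derivative in `L²` along translations. -/
def grad (i : Fin 3) (f : L2 ℓ n) : L2 ℓ n := deriv (shift i f) 0

/-- The form domain of the non-interacting operator `(-i∇ₓ - P_f)² + N`. -/
def FormDomain (ℓ : ℝ) [Fact (0 < ℓ)] : Set (Hilb ℓ) :=
  {Ψ | (∀ n i, InGradDomain i (comp Ψ n)) ∧
    Summable fun n : ℕ => (∑ i, ‖grad i (comp Ψ n)‖ ^ 2) + n * ‖comp Ψ n‖ ^ 2}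

/-- The form factor `v(y) = |y|⁻²`. -/
def v (y : R3) : ℝ := 1 / ‖y‖ ^ 2

/-- The annihilation operator:
`(a(v)Ψ)⁽ⁿ⁾(x, y₁, …, yₙ) = √(n+1) ∫ v(y) Ψ⁽ⁿ⁺¹⁾(x, y₁, …, yₙ, y) dy`. -/
def annihilate (Ψ : Hilb ℓ) (n : ℕ) (z : Conf ℓ n) : ℂ :=
  (Real.sqrt (n + 1) : ℂ) *
    ∫ y : R3, (v y : ℂ) * comp Ψ (n + 1) (z.1, Fin.snoc (α := fun _ => R3) z.2 y)

/-- The sesquilinear form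
`⟨Φ, ((-i∇ₓ - P_f)² + N) Ψ⟩ + √α (⟨Φ, a(v)Ψ⟩ + ⟨a(v)Φ, Ψ⟩)` of `h_ℓ`, sector by sector. -/
def form (α : ℝ) (Φ Ψ : Hilb ℓ) : ℂ :=
  ∑' n : ℕ,
    ((∑ i, ⟪grad i (comp Φ n), grad i (comp Ψ n)⟫_ℂ) + n * ⟪comp Φ n, comp Ψ n⟫_ℂ
      + (Real.sqrt α : ℂ) *
        ((∫ z, starRingEnd ℂ (comp Φ n z) * annihilate Ψ n z)
          + ∫ z, starRingEnd ℂ (annihilate Φ n z) * comp Ψ n z))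

/-- The graph of `h_ℓ = (-i∇ₓ - P_f)² + N + √α φ(v)`, the operator associated with `form α`:
`Ψ` is in its domain and `h_ℓ Ψ = η` iff `Ψ` is in the form domain and `form α Φ Ψ = ⟨Φ, η⟩` for
all `Φ` in the form domain. -/
def hGraph (α ℓ : ℝ) [Fact (0 < ℓ)] : Set (Hilb ℓ × Hilb ℓ) :=
  {p | p.1 ∈ FormDomain ℓ ∧ ∀ Φ ∈ FormDomain ℓ, form α Φ p.1 = ⟪Φ, p.2⟫_ℂ}

/-- The cone of all `Ψ` with `(-1)ⁿ Ψ⁽ⁿ⁾(x, y₁, …, yₙ) ≥ 0` (real and non-negative) almost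
everywhere, for every `n`. -/
def cone (ℓ : ℝ) [Fact (0 < ℓ)] : Set (Hilb ℓ) :=
  {Ψ | ∀ n : ℕ, ∀ᵐ z, (0 : ℂ) ≤ (-1) ^ n * comp Ψ n z}

end

section

variable {H : Type*} [NormedAddCommGroup H] [InnerProductSpace ℂ H]

/-- `R` is the bounded, everywhere defined inverse of `A - w`, where `A` is given by its graph `G`:
`R f = Ψ` iff `Ψ ∈ D(A)` and `AΨ = wΨ + f`. -/
def IsResolvent (G : Set (H × H)) (w : ℂ) (R : H →L[ℂ] H) : Prop :=
  ∀ f Ψ : H, R f = Ψ ↔ (Ψ, w • Ψ + f) ∈ G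

/-- The spectrum of the operator with graph `G`. -/
def spec (G : Set (H × H)) : Set ℂ := {w | ¬ ∃ R : H →L[ℂ] H, IsResolvent G w R}

/-- `K` is positivity improving with respect to `C`: `⟨Ku, w⟩ > 0` for nonzero `u`, `w` in `C`. -/
def PositivityImproving (C : Set H) (K : H →L[ℂ] H) : Prop :=
  ∀ u ∈ C, ∀ w ∈ C, u ≠ 0 → w ≠ 0 → (0 : ℂ) < ⟪K u, w⟫_ℂ

end

end Polaron

end

/-! Semiboundedness. The operator `-i∇ₓ - P_f` generates the simultaneous translations of `x` by `t`
and of every `yⱼ` by `-t`. Hardy's inequality can therefore be proved along these translations, and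
it bounds `1/|yⱼ|²` by four times `(-i∇ₓ - P_f)²` (`hardy`). Near the origin `v` is written as
`(1/|y|)(1/|y|)`: one factor is square integrable there with small norm, the other is absorbed by
Hardy; away from the origin `v` is square integrable. So the interaction has arbitrarily small
relative form bound (`intForm_bound`), and `h_ℓ + lam` is coercive for large `lam`
(`exists_coercive`).

Preserving the cone. The solution of `(h_ℓ + lam) p = f` is the only minimizer of a quadratic
energy. Let `p` be replaced by its signed modulus `(-1)ⁿ|p⁽ⁿ⁾|`. Translations commute with the
modulus, so the kinetic term does not grow; the interaction couples neighbouring sectors, whose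
signs differ, so it does not grow either; and for `f` in the cone the linear term does not get
worse. Hence the minimizer lies in the cone (`solution_mem_cone`).

Improving. The free resolvent alone is not enough: with phonons present it only connects
configurations along simultaneous translations. Let `p` solve `(h_ℓ + lam) p = u` with `u` a nonzero
element of the cone, let `g` in the cone be orthogonal to `p`, and let `q` be the free resolvent at
`-lam'` applied to `g`. Then `0 = ⟨g, p⟩` is a sum of nonnegative terms: `⟨q, u⟩`, `(lam' - lam)⟨q,
p⟩` and the interaction between `q` and `p`. All of them vanish (`vanishing_of_inner_formOp_zero`).
In the vacuum sector the term `⟨q, p⟩` is iterated: by the mean ergodic theorem the projection of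
`g` onto the constants is orthogonal to `p`, whose vacuum component is nonzero (`fn_zero_ne_zero`),
so `g⁽⁰⁾ = 0`. In sector `n + 1` the interaction term together with `p⁽ⁿ⁾ ≠ 0` and `v > 0` gives
`q⁽ⁿ⁺¹⁾ = 0`, hence `g⁽ⁿ⁺¹⁾ = 0`. So `p` vanishes almost nowhere in any sector
(`solution_ae_ne_zero`).

All `lam`. If `R` is the resolvent at one large `lam₀`, the bottom of the spectrum is `‖R‖⁻¹ -
lam₀`. Between it and `-lam₀` the resolvent is a Neumann series in `R` with nonnegative
coefficients, which inherits positivity. -/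

set_option linter.unusedSectionVars false

noncomputable section

/-! ### Strongly continuous one-parameter groups of isometries -/

section IsometryGroup

open Filter Topology

variable {H : Type*} [NormedAddCommGroup H] [InnerProductSpace ℂ H]

/-- A bounded family in a Hilbert space has a weak limit along every ultrafilter. -/
theorem exists_weak_limit [CompleteSpace H] {ι : Type*} (𝒰 : Ultrafilter ι) (x : ι → H) (C : ℝ)
    (hx : ∀ᶠ i in 𝒰, ‖x i‖ ≤ C) :
    ∃ y : H, ∀ z : H, Tendsto (fun i => ⟪x i, z⟫_ℂ) 𝒰 (𝓝 ⟪y, z⟫_ℂ) := by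
  have hc := WeakDual.isCompact_closedBall (𝕜 := ℂ) (E := H) 0 C
  let F : ι → WeakDual ℂ H := fun i =>
    StrongDual.toWeakDual (InnerProductSpace.toDual ℂ H (x i))
  obtain ⟨w, -, hw⟩ := hc.ultrafilter_le_nhds (𝒰.map F) (by
    rw [le_principal_iff]
    change ∀ᶠ i in (𝒰 : Filter ι), _
    filter_upwards [hx] with i hi
    simpa [F] using hi)
  refine ⟨(InnerProductSpace.toDual ℂ H).symm (WeakDual.toStrongDual w), fun z => ?_⟩
  have h1 : Tendsto F 𝒰 (𝓝 w) := hw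
  have h2 := ((WeakDual.eval_continuous z).tendsto w).comp h1
  simpa [F, Function.comp_def] using h2

variable (U : ℝ → H →ₗᵢ[ℂ] H)

/-- The average of the group over `[0, δ]`. -/
def groupAverage [CompleteSpace H] (hc : ∀ x, Continuous fun t => U t x) (δ : ℝ) (hδ : 0 < δ) :
    H →L[ℂ] H :=
  LinearMap.mkContinuous
    { toFun := fun x => (δ⁻¹ : ℂ) • ∫ s in (0 : ℝ)..δ, U s x
      map_add' := fun x y => by
        simp only [map_add]
        rw [intervalIntegral.integral_add ((hc x).intervalIntegrable _ _)
          ((hc y).intervalIntegrable _ _), smul_add]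
      map_smul' := fun c x => by
        simp only [map_smul, RingHom.id_apply]
        rw [intervalIntegral.integral_smul, smul_comm] } 1
    (fun x => by
      have h : ‖∫ s in (0 : ℝ)..δ, U s x‖ ≤ ‖x‖ * |δ - 0| :=
        intervalIntegral.norm_integral_le_of_norm_le_const fun s _ => by simp
      simp only [LinearMap.coe_mk, AddHom.coe_mk, norm_smul, norm_inv, Complex.norm_real,
        Real.norm_eq_abs, sub_zero, abs_of_pos hδ, one_mul] at h ⊢
      rw [inv_mul_le_iff₀ hδ]
      linarith)

variable {U}

theorem hasDerivAt_group (hadd : ∀ s t x, U (s + t) x = U s (U t x))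
    {f g : H} (h : HasDerivAt (fun t => U t f) g 0) (t : ℝ) :
    HasDerivAt (fun t => U t f) (U t g) t := by
  have h1 : HasDerivAt (fun r => U t (U (r - t) f)) (U t g) t := by
    have h2 : HasDerivAt (fun r => U (r - t) f) g t := by
      have := HasDerivAt.comp_sub_const (f := fun t => U t f) (f' := g) t t (by simpa using h)
      simpa using this
    have h3 := ((U t).toContinuousLinearMap.restrictScalars ℝ).hasFDerivAt.comp_hasDerivAt t h2
    simpa [Function.comp_def] using h3
  refine h1.congr_of_eventuallyEq (Eventually.of_forall fun r => ?_)
  change U r f = U t (U (r - t) f)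
  rw [← hadd]
  congr 2
  ring

/-- The integrated equation involves no limit in `t`, so it survives limits in `f` and `g`;
closedness of the generator and the converse construction of derivatives both rest on it. -/
theorem hasDerivAt_group_iff [CompleteSpace H] (h0 : ∀ x, U 0 x = x)
    (hadd : ∀ s t x, U (s + t) x = U s (U t x)) (hc : ∀ x, Continuous fun t => U t x) {f g : H} :
    HasDerivAt (fun t => U t f) g 0 ↔ ∀ t, U t f - f = ∫ s in (0 : ℝ)..t, U s g := by
  constructor
  · intro h t
    rw [intervalIntegral.integral_eq_sub_of_hasDerivAt (fun s _ => hasDerivAt_group hadd h s)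
      ((hc g).intervalIntegrable _ _), h0]
  · intro h
    have h1 : HasDerivAt (fun t => ∫ s in (0 : ℝ)..t, U s g) (U 0 g) 0 :=
      intervalIntegral.integral_hasDerivAt_right ((hc g).intervalIntegrable _ _)
        ((hc g).stronglyMeasurableAtFilter _ _) (hc g).continuousAt
    rw [h0] at h1
    refine (h1.add_const f).congr_of_eventuallyEq (Eventually.of_forall fun t => ?_)
    simp [← h t]

theorem norm_group_sub_le (h0 : ∀ x, U 0 x = x)
    (hadd : ∀ s t x, U (s + t) x = U s (U t x)) {f g : H}
    (h : HasDerivAt (fun t => U t f) g 0) (t : ℝ) : ‖U t f - f‖ ≤ ‖g‖ * |t| := by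
  have := convex_univ.norm_image_sub_le_of_norm_hasDerivWithin_le (f := fun t => U t f)
    (f' := fun t => U t g) (C := ‖g‖) (fun s _ => (hasDerivAt_group hadd h s).hasDerivWithinAt)
    (fun s _ => by simp) (Set.mem_univ (0 : ℝ)) (Set.mem_univ t)
  simpa [h0] using this

/-- A vector whose orbit is Lipschitz at the origin lies in the domain of the generator. -/
theorem exists_hasDerivAt_of_lipschitz [CompleteSpace H] (h0 : ∀ x, U 0 x = x)
    (hadd : ∀ s t x, U (s + t) x = U s (U t x)) (hc : ∀ x, Continuous fun t => U t x)
    {f : H} {C : ℝ} (hf : ∀ᶠ t in 𝓝[>] (0 : ℝ), ‖U t f - f‖ ≤ C * t) :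
    ∃ g : H, HasDerivAt (fun t => U t f) g 0 ∧ ‖g‖ ≤ C := by
  let 𝒰 : Ultrafilter ℝ := Ultrafilter.of (𝓝[>] (0 : ℝ))
  have h𝒰 : (𝒰 : Filter ℝ) ≤ 𝓝[>] (0 : ℝ) := Ultrafilter.of_le _
  let q : ℝ → H := fun t => ((t : ℂ)⁻¹) • (U t f - f)
  have hq : ∀ᶠ t in 𝓝[>] (0 : ℝ), ‖q t‖ ≤ C := by
    filter_upwards [hf, self_mem_nhdsWithin] with t ht ht0
    have ht0 : 0 < t := ht0
    simp only [q, norm_smul, norm_inv, Complex.norm_real, Real.norm_eq_abs, abs_of_pos ht0]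
    rw [inv_mul_le_iff₀ ht0]
    linarith
  obtain ⟨g, hg⟩ := exists_weak_limit 𝒰 q C (h𝒰 hq)
  -- Both sides are `(δε)⁻¹` times the integral of the orbit over `[0, δ + ε]` minus those over `[0,
  -- δ]` and `[0, ε]`, an expression symmetric in `δ` and `ε`.
  have hcomm : ∀ (δ ε : ℝ) (hδ : 0 < δ) (hε : 0 < ε),
      groupAverage U hc δ hδ (q ε) = groupAverage U hc ε hε (q δ) := by
    intro δ ε hδ hε
    have key : ∀ a b : ℝ, ∫ s in (0 : ℝ)..a, U s (U b f - f)
        = (∫ s in (0 : ℝ)..(a + b), U s f) - (∫ s in (0 : ℝ)..b, U s f)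
          - ∫ s in (0 : ℝ)..a, U s f := by
      intro a b
      simp only [map_sub, ← hadd]
      have h1 : Continuous fun s => U (s + b) f := (hc f).comp (continuous_add_const b)
      rw [intervalIntegral.integral_sub (h1.intervalIntegrable _ _)
        ((hc f).intervalIntegrable _ _),
        intervalIntegral.integral_comp_add_right (fun s => U s f) b, zero_add,
        intervalIntegral.integral_interval_sub_left ((hc f).intervalIntegrable _ _)
          ((hc f).intervalIntegrable _ _)]
    simp only [groupAverage, LinearMap.mkContinuous_apply, LinearMap.coe_mk, AddHom.coe_mk, q,
      map_smul]
    rw [key δ ε, key ε δ, smul_comm, add_comm δ ε]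
    congr 2
    abel
  have hlim : ∀ x : H, Tendsto (fun ε : ℝ => (ε⁻¹ : ℂ) • ∫ s in (0 : ℝ)..ε, U s x)
      (𝓝[>] (0 : ℝ)) (𝓝 x) := by
    intro x
    have h1 : HasDerivAt (fun t => ∫ s in (0 : ℝ)..t, U s x) (U 0 x) 0 :=
      intervalIntegral.integral_hasDerivAt_right ((hc x).intervalIntegrable _ _)
        ((hc x).stronglyMeasurableAtFilter _ _) (hc x).continuousAt
    rw [h0] at h1
    have h2 := (hasDerivAt_iff_tendsto_slope.1 h1).mono_left
      (nhdsWithin_mono 0 fun t (ht : 0 < t) => ht.ne')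
    refine h2.congr fun t => ?_
    simp only [slope, sub_zero, intervalIntegral.integral_same, vsub_eq_sub]
    rw [← Complex.ofReal_inv, Complex.coe_smul]
  -- The weak limit in `ε` passes through the bounded averaging operator; after the exchange, the
  -- averages over `[0, ε]` converge strongly to `q δ`.
  have hgq : ∀ (δ : ℝ) (hδ : 0 < δ), groupAverage U hc δ hδ g = q δ := by
    intro δ hδ
    refine ext_inner_right ℂ fun z => ?_
    have h1 : Tendsto (fun ε => ⟪groupAverage U hc δ hδ (q ε), z⟫_ℂ) 𝒰
        (𝓝 ⟪groupAverage U hc δ hδ g, z⟫_ℂ) := by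
      simp only [← ContinuousLinearMap.adjoint_inner_right]
      exact hg _
    have h2 : Tendsto (fun ε => ⟪groupAverage U hc δ hδ (q ε), z⟫_ℂ) 𝒰 (𝓝 ⟪q δ, z⟫_ℂ) := by
      refine (((hlim (q δ)).mono_left h𝒰).inner tendsto_const_nhds).congr' ?_
      filter_upwards [h𝒰 self_mem_nhdsWithin] with ε hε
      rw [hcomm δ ε hδ hε]
      simp [groupAverage, mul_comm]
    exact tendsto_nhds_unique h1 h2
  have hpos : ∀ t, 0 < t → U t f - f = ∫ s in (0 : ℝ)..t, U s g := by
    intro t ht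
    have h1 := hgq t ht
    simp only [groupAverage, LinearMap.mkContinuous_apply, LinearMap.coe_mk, AddHom.coe_mk, q]
      at h1
    exact (smul_right_injective H (by simpa using ht.ne' : ((t : ℂ)⁻¹) ≠ 0) h1).symm
  refine ⟨g, (hasDerivAt_group_iff h0 hadd hc).2 fun t => ?_, ?_⟩
  · rcases lt_trichotomy t 0 with ht | rfl | ht
    · have h1 := hpos (-t) (by linarith)
      -- Negative times are reduced to positive ones by applying the isometry at time `-t`.
      apply (U (-t)).injective
      rw [map_sub, ← hadd, neg_add_cancel, h0, ← neg_sub, h1]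
      have h2 := ((U (-t)).toContinuousLinearMap).intervalIntegral_comp_comm
        ((hc g).intervalIntegrable (μ := volume) 0 t)
      simp only [LinearIsometry.coe_toContinuousLinearMap, ← hadd] at h2
      rw [← h2, intervalIntegral.integral_comp_add_left (fun s => U s g),
        intervalIntegral.integral_symm]
      simp
    · simp [h0]
    · exact hpos t ht
  · refine le_of_tendsto (hlim g).norm ?_
    filter_upwards [hq, self_mem_nhdsWithin] with t ht ht0
    have := hgq t ht0
    simp only [groupAverage, LinearMap.mkContinuous_apply, LinearMap.coe_mk, AddHom.coe_mk]
      at this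
    rwa [this]

end IsometryGroup

end

/-! ### Simultaneous translations, the pointwise modulus and symmetric functions in `L²`. -/

noncomputable section

namespace Polaron

open Filter Topology

section Shift

variable {ℓ : ℝ} [Fact (0 < ℓ)] {n : ℕ}

/-- The translation group `shift` as a family of linear isometries. -/
def shiftIsom (i : Fin 3) (t : ℝ) : L2 ℓ n →ₗᵢ[ℂ] L2 ℓ n :=
  Lp.compMeasurePreservingₗᵢ ℂ (shiftMap ℓ n i t) (shiftMap_preserving ℓ n i t)

theorem displacement_zero (i : Fin 3) : displacement ℓ n i 0 = 0 := by
  ext j <;> simp [displacement]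

theorem displacement_add (i : Fin 3) (s t : ℝ) :
    displacement ℓ n i (s + t) = displacement ℓ n i s + displacement ℓ n i t := by
  refine Prod.ext ?_ ?_
  · simp [displacement, Pi.single_add]
  · funext j
    ext k
    simp only [displacement, Prod.snd_add, Pi.add_apply, PiLp.add_apply, PiLp.neg_apply,
      PiLp.single_apply]
    split_ifs <;> ring

theorem shiftIsom_zero (i : Fin 3) (f : L2 ℓ n) : shiftIsom i 0 f = f := by
  refine Lp.ext ?_
  filter_upwards [Lp.coeFn_compMeasurePreserving f (shiftMap_preserving ℓ n i 0)] with z hz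
  refine hz.trans ?_
  simp [shiftMap, displacement_zero]

theorem shiftIsom_add (i : Fin 3) (s t : ℝ) (f : L2 ℓ n) :
    shiftIsom i (s + t) f = shiftIsom i s (shiftIsom i t f) := by
  refine Lp.ext ?_
  filter_upwards [Lp.coeFn_compMeasurePreserving f (shiftMap_preserving ℓ n i (s + t)),
    Lp.coeFn_compMeasurePreserving (shiftIsom i t f) (shiftMap_preserving ℓ n i s),
    (shiftMap_preserving ℓ n i s).quasiMeasurePreserving.ae_eq_comp
      (Lp.coeFn_compMeasurePreserving f (shiftMap_preserving ℓ n i t))] with z h1 h2 h3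
  refine h1.trans (Eq.trans ?_ h2.symm)
  refine Eq.trans ?_ h3.symm
  simp [shiftMap, displacement_add, add_assoc]

theorem continuous_displacement (i : Fin 3) : Continuous (displacement ℓ n i) := by
  refine Continuous.prodMk ?_ ?_
  · exact (continuous_single i).comp (AddCircle.continuous_mk' ℓ)
  · refine continuous_pi fun _ => Continuous.neg ?_
    refine (PiLp.continuous_toLp 2 _).comp
      (continuous_single (A := fun _ : Fin 3 => ℝ) i)

instance : Measure.Regular (volume : Measure (Conf ℓ n)) :=
  Measure.Regular.of_sigmaCompactSpace_of_isLocallyFiniteMeasure _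

theorem continuous_shiftIsom (i : Fin 3) (f : L2 ℓ n) : Continuous fun t => shiftIsom i t f := by
  let g : C(ℝ × Conf ℓ n, Conf ℓ n) := ⟨fun p => p.2 + displacement ℓ n i p.1,
    continuous_snd.add ((continuous_displacement i).comp continuous_fst)⟩
  exact Continuous.compMeasurePreservingLp (μ := (volume : Measure (Conf ℓ n)))
    (ν := (volume : Measure (Conf ℓ n))) (g := g.curry) continuous_const g.curry.continuous
    (fun t => shiftMap_preserving ℓ n i t) (by norm_num)

theorem InGradDomain.hasDerivAt {i : Fin 3} {f : L2 ℓ n} (h : InGradDomain i f) :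
    HasDerivAt (fun t => shiftIsom i t f) (grad i f) 0 :=
  DifferentiableAt.hasDerivAt h

theorem hasDerivAt_shift_iff {i : Fin 3} {f g : L2 ℓ n} :
    HasDerivAt (shift i f) g 0 ↔ ∀ t, shiftIsom i t f - f = ∫ s in (0 : ℝ)..t, shiftIsom i s g :=
  hasDerivAt_group_iff (U := shiftIsom i) (shiftIsom_zero i) (shiftIsom_add i)
    (continuous_shiftIsom i)

theorem norm_shift_sub_le {i : Fin 3} {f g : L2 ℓ n} (h : HasDerivAt (shift i f) g 0) (t : ℝ) :
    ‖shift i f t - f‖ ≤ ‖g‖ * |t| :=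
  norm_group_sub_le (U := shiftIsom i) (shiftIsom_zero i) (shiftIsom_add i) h t

theorem exists_hasDerivAt_shift {i : Fin 3} {f : L2 ℓ n} {C : ℝ}
    (hf : ∀ᶠ t in 𝓝[>] (0 : ℝ), ‖shift i f t - f‖ ≤ C * t) :
    ∃ g, HasDerivAt (shift i f) g 0 ∧ ‖g‖ ≤ C :=
  exists_hasDerivAt_of_lipschitz (U := shiftIsom i) (shiftIsom_zero i) (shiftIsom_add i)
    (continuous_shiftIsom i) hf

/-- In integrated form the condition is, for each `t`, an equality of two continuous functions of
the pair. -/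
theorem isClosed_hasDerivAt_shift (i : Fin 3) :
    IsClosed {p : L2 ℓ n × L2 ℓ n | HasDerivAt (shift i p.1) p.2 0} := by
  simp only [hasDerivAt_shift_iff, Set.ofPred_forall]
  refine isClosed_iInter fun t => ?_
  refine isClosed_eq ?_ ?_
  · exact ((shiftIsom i t).continuous.comp continuous_fst).sub continuous_fst
  · rcases eq_or_ne t 0 with rfl | ht
    · simpa using continuous_const
    · refine LipschitzWith.continuous (K := ⟨|t|, abs_nonneg t⟩) ?_
      refine LipschitzWith.of_dist_le_mul fun p q => ?_
      rw [dist_eq_norm, ← intervalIntegral.integral_sub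
        ((continuous_shiftIsom i p.2).intervalIntegrable _ _)
        ((continuous_shiftIsom i q.2).intervalIntegrable _ _)]
      have h : ‖∫ s in (0 : ℝ)..t, (shiftIsom i s p.2 - shiftIsom i s q.2)‖
          ≤ dist p q * |t - 0| := by
        refine intervalIntegral.norm_integral_le_of_norm_le_const fun s _ => ?_
        rw [← map_sub, LinearIsometry.norm_map, ← dist_eq_norm]
        exact le_max_right _ _
      rw [sub_zero, mul_comm] at h
      exact h

theorem lipschitzWith_complex_abs : LipschitzWith 1 fun w : ℂ => ((‖w‖ : ℝ) : ℂ) := by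
  refine LipschitzWith.of_dist_le_mul fun a b => ?_
  rw [dist_eq_norm, ← Complex.ofReal_sub, Complex.norm_real, NNReal.coe_one, one_mul,
    dist_eq_norm]
  exact abs_norm_sub_norm_le a b

/-- The pointwise absolute value of a square integrable function. -/
def absL2 (f : L2 ℓ n) : L2 ℓ n :=
  lipschitzWith_complex_abs.compLp (by simp) f

theorem coeFn_absL2 (f : L2 ℓ n) : absL2 f =ᵐ[volume] fun z => ((‖f z‖ : ℝ) : ℂ) :=
  LipschitzWith.coeFn_compLp _ _ f

theorem norm_absL2 (f : L2 ℓ n) : ‖absL2 f‖ = ‖f‖ := by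
  refine le_antisymm (Lp.norm_le_norm_of_ae_le ?_) (Lp.norm_le_norm_of_ae_le ?_) <;>
  · filter_upwards [coeFn_absL2 f] with z hz
    simp [hz]

theorem norm_absL2_sub_le (f g : L2 ℓ n) : ‖absL2 f - absL2 g‖ ≤ ‖f - g‖ := by
  have h := lipschitzWith_complex_abs.norm_compLp_sub_le (by simp) f g
  rwa [NNReal.coe_one, one_mul] at h

theorem absL2_compMeasurePreserving (f : L2 ℓ n) {τ : Conf ℓ n → Conf ℓ n}
    (hτ : MeasurePreserving τ volume volume) :
    absL2 (Lp.compMeasurePreserving τ hτ f) = Lp.compMeasurePreserving τ hτ (absL2 f) := by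
  refine Lp.ext ?_
  filter_upwards [coeFn_absL2 (Lp.compMeasurePreserving τ hτ f),
    Lp.coeFn_compMeasurePreserving f hτ, Lp.coeFn_compMeasurePreserving (absL2 f) hτ,
    hτ.quasiMeasurePreserving.ae_eq_comp (coeFn_absL2 f)] with z h1 h2 h3 h4
  rw [h1, h2, h3, h4]
  rfl

/-- The modulus commutes with translations and contracts `L²` distances, so the Lipschitz bound of
the orbit of `f` passes to that of its modulus. No pointwise chain rule is needed. -/
theorem exists_hasDerivAt_shift_absL2 {i : Fin 3} {f g : L2 ℓ n}
    (h : HasDerivAt (shift i f) g 0) :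
    ∃ g', HasDerivAt (shift i (absL2 f)) g' 0 ∧ ‖g'‖ ≤ ‖g‖ := by
  refine exists_hasDerivAt_shift ?_
  filter_upwards [self_mem_nhdsWithin] with t ht
  have h1 : shift i (absL2 f) t = absL2 (shift i f t) :=
    (absL2_compMeasurePreserving f (shiftMap_preserving ℓ n i t)).symm
  rw [h1]
  refine (norm_absL2_sub_le _ _).trans ((norm_shift_sub_le h t).trans_eq ?_)
  rw [abs_of_pos ht]

theorem mem_nPhonon {f : L2 ℓ n} : f ∈ nPhonon ℓ n ↔
    ∀ σ, Lp.compMeasurePreserving (permMap ℓ n σ) (permMap_preserving ℓ n σ) f = f := by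
  simp only [nPhonon, Submodule.mem_iInf, LinearMap.mem_eqLocus]
  rfl

theorem mem_nPhonon_iff_ae {f : L2 ℓ n} : f ∈ nPhonon ℓ n ↔
    ∀ σ, ∀ᵐ z, f (permMap ℓ n σ z) = f z := by
  rw [mem_nPhonon]
  refine forall_congr' fun σ => ⟨fun h => ?_, fun h => Lp.ext ?_⟩
  · have h1 := Lp.coeFn_compMeasurePreserving f (permMap_preserving ℓ n σ)
    rw [h] at h1
    filter_upwards [h1] with z hz using hz.symm
  · filter_upwards [h, Lp.coeFn_compMeasurePreserving f (permMap_preserving ℓ n σ)] with z h1 h2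
    rw [h2]
    exact h1

theorem isClosed_nPhonon : IsClosed (nPhonon ℓ n : Set (L2 ℓ n)) := by
  have : (nPhonon ℓ n : Set (L2 ℓ n)) = ⋂ σ, {f : L2 ℓ n |
      Lp.compMeasurePreservingₗᵢ ℂ (permMap ℓ n σ) (permMap_preserving ℓ n σ) f = f} := by
    ext f
    simp only [SetLike.mem_coe, mem_nPhonon, Set.mem_iInter, Set.mem_ofPred_eq]
    rfl
  rw [this]
  exact isClosed_iInter fun σ => isClosed_eq (LinearIsometry.continuous _) continuous_id

instance : CompleteSpace (nPhonon ℓ n) := isClosed_nPhonon.completeSpace_coe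

theorem absL2_mem_nPhonon {f : L2 ℓ n} (hf : f ∈ nPhonon ℓ n) : absL2 f ∈ nPhonon ℓ n := by
  rw [mem_nPhonon] at hf ⊢
  intro σ
  rw [← absL2_compMeasurePreserving, hf σ]

end Shift

end Polaron

end

/-! ### Hardy's inequality along simultaneous translations. -/

noncomputable section

namespace Polaron

open Filter Topology

section Hardy

variable {ℓ : ℝ} [Fact (0 < ℓ)] {n : ℕ}

theorem L2_integrable_sq (f : L2 ℓ n) : Integrable (fun z => ‖f z‖ ^ 2) volume :=
  (memLp_two_iff_integrable_sq_norm (Lp.aestronglyMeasurable f)).1 (Lp.memLp f)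

theorem L2_norm_sq (f : L2 ℓ n) : ‖f‖ ^ 2 = ∫ z, ‖f z‖ ^ 2 := by
  rw [← real_inner_self_eq_norm_sq, L2.inner_def]
  simp

/-- Multiplication by a bounded continuous real function, as an operator on `L²`. -/
def mulL2 (w : Conf ℓ n → ℝ) (hw : Continuous w) (C : ℝ) (hC : ∀ z, |w z| ≤ C) :
    L2 ℓ n →L[ℂ] L2 ℓ n :=
  (ContinuousLinearMap.mul ℂ ℂ).holderL volume ∞ 2 2
    (MemLp.toLp (p := ∞) (fun z => (w z : ℂ))
      (memLp_top_of_bound (Complex.continuous_ofReal.comp hw).aestronglyMeasurable C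
        (Eventually.of_forall fun z => by simpa using hC z)))

theorem coeFn_mulL2 (w : Conf ℓ n → ℝ) (hw : Continuous w) (C : ℝ) (hC : ∀ z, |w z| ≤ C)
    (f : L2 ℓ n) : mulL2 w hw C hC f =ᵐ[volume] fun z => (w z : ℂ) * f z := by
  have h : MemLp (fun z => (w z : ℂ)) ∞ (volume : Measure (Conf ℓ n)) :=
    memLp_top_of_bound (Complex.continuous_ofReal.comp hw).aestronglyMeasurable C
        (Eventually.of_forall fun z => by simpa using hC z)
  have h1 := (ContinuousLinearMap.mul ℂ ℂ).coeFn_holder (r := 2) (h.toLp _) f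
  filter_upwards [h1, h.coeFn_toLp] with z h1 h2
  refine h1.trans ?_
  simp [h2]

theorem mulL2_symm (w : Conf ℓ n → ℝ) (hw : Continuous w) (C : ℝ) (hC : ∀ z, |w z| ≤ C)
    (f g : L2 ℓ n) : ⟪f, mulL2 w hw C hC g⟫_ℂ = ⟪mulL2 w hw C hC f, g⟫_ℂ := by
  rw [L2.inner_def, L2.inner_def]
  refine integral_congr_ae ?_
  filter_upwards [coeFn_mulL2 w hw C hC f, coeFn_mulL2 w hw C hC g] with z h1 h2
  simp only [h1, h2, RCLike.inner_apply, map_mul, Complex.conj_ofReal]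
  ring

theorem inner_mulL2_self (w : Conf ℓ n → ℝ) (hw : Continuous w) (C : ℝ) (hC : ∀ z, |w z| ≤ C)
    (f : L2 ℓ n) : ⟪f, mulL2 w hw C hC f⟫_ℂ = ((∫ z, w z * ‖f z‖ ^ 2 : ℝ) : ℂ) := by
  rw [L2.inner_def, ← integral_complex_ofReal]
  refine integral_congr_ae ?_
  filter_upwards [coeFn_mulL2 w hw C hC f] with z h1
  simp only [h1, RCLike.inner_apply]
  rw [mul_assoc, Complex.mul_conj, Complex.normSq_eq_norm_sq]
  push_cast
  ring

theorem norm_sq_mulL2 (w : Conf ℓ n → ℝ) (hw : Continuous w) (C : ℝ) (hC : ∀ z, |w z| ≤ C)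
    (f : L2 ℓ n) : ‖mulL2 w hw C hC f‖ ^ 2 = ∫ z, w z ^ 2 * ‖f z‖ ^ 2 := by
  rw [L2_norm_sq]
  refine integral_congr_ae ?_
  filter_upwards [coeFn_mulL2 w hw C hC f] with z h1
  simp [h1, mul_pow]

theorem norm_sq_add_single (y : R3) (i : Fin 3) (t : ℝ) :
    ‖y + EuclideanSpace.single i t‖ ^ 2 = ‖y‖ ^ 2 + 2 * t * y i + t ^ 2 := by
  rw [@norm_add_sq_real]
  simp [EuclideanSpace.inner_single_right]
  ring

theorem coord_sq_le_norm_sq (y : R3) (i : Fin 3) : y i ^ 2 ≤ ‖y‖ ^ 2 := by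
  rw [EuclideanSpace.norm_sq_eq, ← sq_abs, ← Real.norm_eq_abs]
  exact Finset.single_le_sum (f := fun k => ‖y k‖ ^ 2) (fun k _ => by positivity)
    (Finset.mem_univ i)

/-- The regularized field `y / (|y|² + ε)`. -/
def hardyField (ε : ℝ) (i : Fin 3) (y : R3) : ℝ := y i / (‖y‖ ^ 2 + ε)

/-- The `i`-th partial derivative of the `i`-th component of `hardyField`. -/
def hardyFieldDeriv (ε : ℝ) (i : Fin 3) (y : R3) : ℝ :=
  (‖y‖ ^ 2 + ε - 2 * y i ^ 2) / (‖y‖ ^ 2 + ε) ^ 2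

/-- Together with `le_sum_hardyFieldDeriv` this puts one weight `w = 1/(|y|² + ε)` between the
squared length of the field and its divergence, so that Hardy's estimate closes. -/
theorem hardyField_sq_le {ε : ℝ} (hε : 0 < ε) (y : R3) :
    ∑ i, hardyField ε i y ^ 2 ≤ 1 / (‖y‖ ^ 2 + ε) := by
  have hD : 0 < ‖y‖ ^ 2 + ε := by positivity
  have h : ∑ i, hardyField ε i y ^ 2 = ‖y‖ ^ 2 / (‖y‖ ^ 2 + ε) ^ 2 := by
    simp only [hardyField, div_pow, ← Finset.sum_div, EuclideanSpace.norm_sq_eq, Real.norm_eq_abs,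
      sq_abs]
  rw [h, div_le_div_iff₀ (by positivity) hD]
  nlinarith [sq_nonneg ‖y‖]

theorem hardyField_abs_le {ε : ℝ} (hε : 0 < ε) (i : Fin 3) (y : R3) :
    |hardyField ε i y| ≤ 1 + 1 / ε := by
  have h1 : hardyField ε i y ^ 2 ≤ 1 / ε := by
    refine (Finset.single_le_sum (f := fun i => hardyField ε i y ^ 2)
      (fun k _ => by positivity) (Finset.mem_univ i)).trans ((hardyField_sq_le hε y).trans ?_)
    exact one_div_le_one_div_of_le hε (by nlinarith [sq_nonneg ‖y‖])
  have h2 : 0 < 1 / ε := by positivity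
  rw [← sq_abs] at h1
  nlinarith [abs_nonneg (hardyField ε i y)]

/-- Dimension three enters: the divergence is `(|y|² + 3ε)/(|y|² + ε)²`. -/
theorem le_sum_hardyFieldDeriv {ε : ℝ} (hε : 0 < ε) (y : R3) :
    1 / (‖y‖ ^ 2 + ε) ≤ ∑ i, hardyFieldDeriv ε i y := by
  have hD : 0 < ‖y‖ ^ 2 + ε := by positivity
  have h : ∑ i, hardyFieldDeriv ε i y
      = (3 * (‖y‖ ^ 2 + ε) - 2 * ‖y‖ ^ 2) / (‖y‖ ^ 2 + ε) ^ 2 := by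
    have h3 : ‖y‖ ^ 2 = y 0 ^ 2 + y 1 ^ 2 + y 2 ^ 2 := by
      rw [EuclideanSpace.norm_sq_eq, Fin.sum_univ_three]
      simp
    simp only [hardyFieldDeriv, ← Finset.sum_div, Fin.sum_univ_three]
    rw [h3]
    ring
  rw [h, div_le_div_iff₀ hD (by positivity)]
  nlinarith [sq_nonneg ‖y‖]

theorem hardyFieldDeriv_abs_le {ε : ℝ} (hε : 0 < ε) (i : Fin 3) (y : R3) :
    |hardyFieldDeriv ε i y| ≤ 3 / ε := by
  have hD : 0 < ‖y‖ ^ 2 + ε := by positivity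
  have h1 := coord_sq_le_norm_sq y i
  rw [hardyFieldDeriv, abs_div, abs_of_pos (pow_pos hD 2), div_le_div_iff₀ (by positivity) hε]
  have h2 : |‖y‖ ^ 2 + ε - 2 * y i ^ 2| ≤ 3 * (‖y‖ ^ 2 + ε) := by
    rw [abs_le]
    constructor <;> nlinarith [sq_nonneg (y i)]
  have h3 : (‖y‖ ^ 2 + ε) * ε ≤ (‖y‖ ^ 2 + ε) ^ 2 := by nlinarith [sq_nonneg ‖y‖]
  nlinarith

theorem continuous_hardyField {ε : ℝ} (hε : 0 < ε) (i : Fin 3) : Continuous (hardyField ε i) := by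
  unfold hardyField
  refine Continuous.div (by fun_prop) (by fun_prop) fun y => ?_
  positivity

theorem continuous_hardyFieldDeriv {ε : ℝ} (hε : 0 < ε) (i : Fin 3) :
    Continuous (hardyFieldDeriv ε i) := by
  unfold hardyFieldDeriv
  refine Continuous.div (by fun_prop) (by fun_prop) fun y => ?_
  positivity

theorem hasDerivAt_hardyField {ε : ℝ} (hε : 0 < ε) (i : Fin 3) (y : R3) (t : ℝ) :
    HasDerivAt (fun t => hardyField ε i (y + EuclideanSpace.single i t))
      (hardyFieldDeriv ε i (y + EuclideanSpace.single i t)) t := by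
  have hD : ‖y + EuclideanSpace.single i t‖ ^ 2 + ε ≠ 0 := by positivity
  have h1 : HasDerivAt (fun t : ℝ => y i + t) 1 t := (hasDerivAt_id t).const_add _
  have h2 : HasDerivAt (fun t : ℝ => ‖y‖ ^ 2 + 2 * t * y i + t ^ 2 + ε) (2 * y i + 2 * t) t := by
    have ha : HasDerivAt (fun t : ℝ => 2 * t * y i) (2 * 1 * y i) t :=
      ((hasDerivAt_id t).const_mul 2).mul_const _
    have hb : HasDerivAt (fun t : ℝ => t ^ 2) (2 * t) t := by simpa using hasDerivAt_pow 2 t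
    have := ((ha.const_add (‖y‖ ^ 2)).add hb).add_const ε
    simpa using this
  rw [norm_sq_add_single] at hD
  have h3 := h1.div h2 hD
  refine (h3.congr_deriv ?_).congr_of_eventuallyEq (Eventually.of_forall fun s => ?_)
  · simp only [hardyFieldDeriv, norm_sq_add_single]
    congr 1
    simp
    ring
  · simp [hardyField, norm_sq_add_single]

theorem integrable_bounded_mul_sq {w : Conf ℓ n → ℝ} (hw : Continuous w) {C : ℝ}
    (hC : ∀ z, |w z| ≤ C) (f : L2 ℓ n) : Integrable (fun z => w z * ‖f z‖ ^ 2) volume :=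
  (L2_integrable_sq f).bdd_mul (c := C) hw.aestronglyMeasurable
    (Eventually.of_forall fun z => by simpa using hC z)

/-- Integration by parts, done by differentiating `⟨U_t f, F U_t f⟩` at `t = 0` in two ways, where
`F` is the field component. Differentiating the vectors gives `2 Re⟨F f, g⟩`; after a change of
variables the derivative falls on `F`. The bound then uses `2ab ≤ a²/2 + 2b²`. -/
theorem hardy_identity {ε : ℝ} (hε : 0 < ε) (j : Fin n) (i : Fin 3) {f g : L2 ℓ n}
    (h : HasDerivAt (shift i f) g 0) :
    ∫ z, hardyFieldDeriv ε i (z.2 j) * ‖f z‖ ^ 2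
      ≤ (1 / 2) * (∫ z, hardyField ε i (z.2 j) ^ 2 * ‖f z‖ ^ 2) + 2 * ‖g‖ ^ 2 := by
  have hcj : Continuous fun z : Conf ℓ n => z.2 j := (continuous_apply j).comp continuous_snd
  set w : Conf ℓ n → ℝ := fun z => hardyField ε i (z.2 j) with hw_def
  have hw : Continuous w := (continuous_hardyField hε i).comp hcj
  have hC : ∀ z, |w z| ≤ 1 + 1 / ε := fun z => hardyField_abs_le hε i _
  set W := mulL2 w hw _ hC
  -- the derivative computed on the functions
  have hd1 : HasDerivAt (fun t => ⟪shift i f t, W (shift i f t)⟫_ℂ)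
      (⟪shift i f 0, W g⟫_ℂ + ⟪g, W (shift i f 0)⟫_ℂ) 0 :=
    h.inner ℂ ((W.restrictScalars ℝ).hasFDerivAt.comp_hasDerivAt 0 h)
  -- the derivative computed on the field
  have heq : ∀ t, ⟪shift i f t, W (shift i f t)⟫_ℂ
      = ((∫ z, hardyField ε i (z.2 j + EuclideanSpace.single i t) * ‖f z‖ ^ 2 : ℝ) : ℂ) := by
    intro t
    rw [inner_mulL2_self]
    congr 1
    have hmp := shiftMap_preserving ℓ n i t
    have h1 : ∫ z, w z * ‖shift i f t z‖ ^ 2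
        = ∫ z, hardyField ε i ((shiftMap ℓ n i t z).2 j + EuclideanSpace.single i t)
          * ‖f (shiftMap ℓ n i t z)‖ ^ 2 := by
      refine integral_congr_ae ?_
      filter_upwards [Lp.coeFn_compMeasurePreserving f hmp] with z hz
      have hz : shift i f t z = f (shiftMap ℓ n i t z) := hz
      rw [hz]
      simp [shiftMap, displacement, hw_def]
    rw [h1]
    refine hmp.integral_comp ?_ (fun z => hardyField ε i (z.2 j + EuclideanSpace.single i t)
      * ‖f z‖ ^ 2)
    exact (Homeomorph.addRight (displacement ℓ n i t)).measurableEmbedding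
  have hd2 : HasDerivAt
      (fun t => ∫ z, hardyField ε i (z.2 j + EuclideanSpace.single i t) * ‖f z‖ ^ 2)
      (∫ z, hardyFieldDeriv ε i (z.2 j + EuclideanSpace.single i 0) * ‖f z‖ ^ 2) 0 := by
    refine (hasDerivAt_integral_of_dominated_loc_of_deriv_le (𝕜 := ℝ) (μ := volume)
      (F := fun t (z : Conf ℓ n) =>
        hardyField ε i (z.2 j + EuclideanSpace.single i t) * ‖f z‖ ^ 2)
      (F' := fun t z => hardyFieldDeriv ε i (z.2 j + EuclideanSpace.single i t) * ‖f z‖ ^ 2)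
      (s := Set.univ) (bound := fun z => 3 / ε * ‖f z‖ ^ 2) (x₀ := 0) univ_mem ?_ ?_ ?_ ?_ ?_ ?_).2
    · refine Eventually.of_forall fun t => ?_
      exact (integrable_bounded_mul_sq ((continuous_hardyField hε i).comp
        (hcj.add continuous_const)) (fun z => hardyField_abs_le hε i _) f).1
    · exact integrable_bounded_mul_sq ((continuous_hardyField hε i).comp
        (hcj.add continuous_const)) (fun z => hardyField_abs_le hε i _) f
    · exact (integrable_bounded_mul_sq ((continuous_hardyFieldDeriv hε i).comp
        (hcj.add continuous_const)) (fun z => hardyFieldDeriv_abs_le hε i _) f).1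
    · refine Eventually.of_forall fun z t _ => ?_
      rw [norm_mul, Real.norm_eq_abs, norm_pow, norm_norm]
      exact mul_le_mul_of_nonneg_right (hardyFieldDeriv_abs_le hε i _) (by positivity)
    · exact (L2_integrable_sq f).const_mul _
    · refine Eventually.of_forall fun z t _ => ?_
      exact (hasDerivAt_hardyField hε i _ t).mul_const _
  have hd3 := hd2.ofReal_comp
  have hd4 := hd1.congr_of_eventuallyEq (Eventually.of_forall fun t => (heq t).symm)
  have h5 := hd3.unique hd4
  have h0 : shift i f 0 = f := shiftIsom_zero i f
  rw [h0, mulL2_symm] at h5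
  have h6 : (EuclideanSpace.single i (0 : ℝ) : R3) = 0 := by simp
  simp only [h6, add_zero] at h5
  have h7 := congrArg norm h5
  have h8 : ‖⟪W f, g⟫_ℂ + ⟪g, W f⟫_ℂ‖ ≤ ‖W f‖ * ‖g‖ + ‖g‖ * ‖W f‖ :=
    (norm_add_le _ _).trans (add_le_add (norm_inner_le_norm _ _) (norm_inner_le_norm _ _))
  have h9 := norm_sq_mulL2 w hw _ hC f
  rw [Complex.norm_real] at h7
  refine (le_abs_self _).trans ?_
  rw [← Real.norm_eq_abs, h7, ← h9]
  refine h8.trans ?_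
  nlinarith [sq_nonneg (‖W f‖ - 2 * ‖g‖)]

/-- Summing over directions gives `I ≤ I/2 + 2∑‖gᵢ‖²` for the left side `I`, which is finite because
`ε > 0`; absorbing `I/2` yields the constant 4. -/
theorem hardy_regularized {ε : ℝ} (hε : 0 < ε) (j : Fin n) {f : L2 ℓ n} {g : Fin 3 → L2 ℓ n}
    (h : ∀ i, HasDerivAt (shift i f) (g i) 0) :
    ∫ z, 1 / (‖z.2 j‖ ^ 2 + ε) * ‖f z‖ ^ 2 ≤ 4 * ∑ i, ‖g i‖ ^ 2 := by
  have hcj : Continuous fun z : Conf ℓ n => z.2 j := (continuous_apply j).comp continuous_snd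
  have hw : Continuous fun z : Conf ℓ n => 1 / (‖z.2 j‖ ^ 2 + ε) :=
    Continuous.div continuous_const (by fun_prop) fun z => by positivity
  have hint := integrable_bounded_mul_sq (C := 1 / ε) hw (fun z => by
    rw [abs_of_pos (by positivity)]
    exact one_div_le_one_div_of_le hε (by nlinarith [sq_nonneg ‖z.2 j‖])) f
  have hint1 : ∀ i : Fin 3, Integrable (fun z => hardyFieldDeriv ε i (z.2 j) * ‖f z‖ ^ 2) volume :=
    fun i => integrable_bounded_mul_sq ((continuous_hardyFieldDeriv hε i).comp hcj)
      (fun z => hardyFieldDeriv_abs_le hε i _) f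
  have hint2 : ∀ i : Fin 3, Integrable (fun z => hardyField ε i (z.2 j) ^ 2 * ‖f z‖ ^ 2) volume :=
    fun i => integrable_bounded_mul_sq (C := (1 + 1 / ε) ^ 2)
      (w := fun z => hardyField ε i (z.2 j) ^ 2)
      (((continuous_hardyField hε i).comp hcj).pow 2) (fun z => by
        rw [abs_pow]
        exact pow_le_pow_left₀ (abs_nonneg _) (hardyField_abs_le hε i _) 2) f
  have h1 : ∫ z, 1 / (‖z.2 j‖ ^ 2 + ε) * ‖f z‖ ^ 2
      ≤ ∑ i, ∫ z, hardyFieldDeriv ε i (z.2 j) * ‖f z‖ ^ 2 := by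
    rw [← integral_finsetSum _ fun i _ => hint1 i]
    refine integral_mono hint (integrable_finsetSum _ fun i _ => hint1 i) fun z => ?_
    simp only [← Finset.sum_mul]
    exact mul_le_mul_of_nonneg_right (le_sum_hardyFieldDeriv hε _) (by positivity)
  have h2 : ∑ i, ∫ z, hardyField ε i (z.2 j) ^ 2 * ‖f z‖ ^ 2
      ≤ ∫ z, 1 / (‖z.2 j‖ ^ 2 + ε) * ‖f z‖ ^ 2 := by
    rw [← integral_finsetSum _ fun i _ => hint2 i]
    refine integral_mono (integrable_finsetSum _ fun i _ => hint2 i) hint fun z => ?_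
    simp only [← Finset.sum_mul]
    exact mul_le_mul_of_nonneg_right (hardyField_sq_le hε _) (by positivity)
  have h3 := Finset.sum_le_sum fun i (_ : i ∈ Finset.univ) => hardy_identity hε j i (h i)
  rw [Finset.sum_add_distrib, ← Finset.mul_sum, ← Finset.mul_sum] at h3
  linarith

/-- **Hardy's inequality** along the simultaneous translations of all variables. -/
theorem hardy (j : Fin n) {f : L2 ℓ n} {g : Fin 3 → L2 ℓ n}
    (h : ∀ i, HasDerivAt (shift i f) (g i) 0) :
    Integrable (fun z => (‖f z‖ / ‖z.2 j‖) ^ 2) volume ∧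
      ∫ z, (‖f z‖ / ‖z.2 j‖) ^ 2 ≤ 4 * ∑ i, ‖g i‖ ^ 2 := by
  have hcj : Continuous fun z : Conf ℓ n => z.2 j := (continuous_apply j).comp continuous_snd
  have hmeas : AEStronglyMeasurable (fun z => (‖f z‖ / ‖z.2 j‖) ^ 2) volume :=
    (((Lp.aestronglyMeasurable f).norm.aemeasurable.div
      hcj.norm.measurable.aemeasurable).pow_const 2).aestronglyMeasurable
  set C := 4 * ∑ i, ‖g i‖ ^ 2
  have hC : 0 ≤ C := by positivity
  let e : ℕ → ℝ := fun k => 1 / ((k : ℝ) + 1)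
  have he : ∀ k, 0 < e k := fun k => by positivity
  have hbound : ∫⁻ z, ENNReal.ofReal ((‖f z‖ / ‖z.2 j‖) ^ 2) ≤ ENNReal.ofReal C := by
    have h1 : ∀ z : Conf ℓ n, ENNReal.ofReal ((‖f z‖ / ‖z.2 j‖) ^ 2)
        ≤ liminf (fun k => ENNReal.ofReal (1 / (‖z.2 j‖ ^ 2 + e k) * ‖f z‖ ^ 2)) atTop := by
      intro z
      -- At `yⱼ = 0` division by zero makes the left side `0`, so Fatou's lemma applies without
      -- removing a null set.
      rcases eq_or_ne (z.2 j) 0 with h0 | h0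
      · simp [h0]
      · refine le_of_eq (Tendsto.liminf_eq ?_).symm
        refine (ENNReal.continuous_ofReal.tendsto _).comp ?_
        have h2 : Tendsto (fun k => 1 / (‖z.2 j‖ ^ 2 + e k) * ‖f z‖ ^ 2) atTop
            (𝓝 (1 / (‖z.2 j‖ ^ 2 + 0) * ‖f z‖ ^ 2)) := by
          refine Tendsto.mul_const _ (Tendsto.div tendsto_const_nhds
            (tendsto_const_nhds.add tendsto_one_div_add_atTop_nhds_zero_nat) ?_)
          simpa using h0
        convert h2 using 2
        rw [div_pow, add_zero]
        ring
    refine (lintegral_mono h1).trans ?_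
    refine (lintegral_liminf_le' fun k => ?_).trans ?_
    · refine AEMeasurable.ennreal_ofReal ?_
      refine AEMeasurable.mul ?_ ((Lp.aestronglyMeasurable f).norm.aemeasurable.pow_const 2)
      exact (measurable_const.div ((hcj.norm.measurable.pow_const 2).add_const _)).aemeasurable
    · refine liminf_le_of_le ?_ ?_
      · isBoundedDefault
      · intro b hb
        obtain ⟨k, hk⟩ := hb.exists
        refine hk.trans ?_
        rw [← ofReal_integral_eq_lintegral_ofReal]
        · exact ENNReal.ofReal_le_ofReal (hardy_regularized (he k) j h)
        · refine integrable_bounded_mul_sq (C := 1 / e k) ?_ ?_ f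
          · exact Continuous.div continuous_const (by fun_prop)
              fun z => by have := he k; positivity
          · intro z
            have := he k
            rw [abs_of_pos (by positivity)]
            exact one_div_le_one_div_of_le this (by nlinarith [sq_nonneg ‖z.2 j‖])
        · exact Eventually.of_forall fun z => by have := he k; positivity
  have hnn : 0 ≤ᵐ[volume] fun z => (‖f z‖ / ‖z.2 j‖) ^ 2 :=
    Eventually.of_forall fun z => by positivity
  refine ⟨⟨hmeas, ?_⟩, ?_⟩
  · rw [hasFiniteIntegral_iff_ofReal hnn]
    exact hbound.trans_lt ENNReal.ofReal_lt_top
  · rw [integral_eq_lintegral_of_nonneg_ae hnn hmeas]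
    exact ENNReal.toReal_le_of_le_ofReal hC hbound

end Hardy

end Polaron

end

/-! ### Splitting `v` near the origin and bounding the annihilation pairing. -/

noncomputable section

namespace Polaron

open Filter Topology

/-- The **Cauchy–Schwarz inequality** for real functions with integrable squares. -/
theorem integral_mul_le_sqrt {X : Type*} [MeasurableSpace X] {μ : Measure X} {F G : X → ℝ}
    (hF : 0 ≤ F) (hG : 0 ≤ G) (hFm : AEStronglyMeasurable F μ) (hGm : AEStronglyMeasurable G μ)
    (hF2 : Integrable (fun x => F x ^ 2) μ) (hG2 : Integrable (fun x => G x ^ 2) μ) :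
    Integrable (fun x => F x * G x) μ ∧
      ∫ x, F x * G x ∂μ ≤ √(∫ x, F x ^ 2 ∂μ) * √(∫ x, G x ^ 2 ∂μ) := by
  have hFL : MemLp F 2 μ := (memLp_two_iff_integrable_sq hFm).2 hF2
  have hGL : MemLp G 2 μ := (memLp_two_iff_integrable_sq hGm).2 hG2
  refine ⟨hFL.integrable_mul hGL, ?_⟩
  have h := integral_mul_le_Lp_mul_Lq_of_nonneg (μ := μ) (p := 2) (q := 2)
    (by constructor <;> norm_num)
    (Eventually.of_forall hF) (Eventually.of_forall hG) (by simpa using hFL) (by simpa using hGL)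
  simpa [Real.sqrt_eq_rpow] using h

section Radial

/-- The part of `1 / |y|` inside the ball of radius `r`. -/
def nearPart (r : ℝ) (y : R3) : ℝ := if ‖y‖ < r then 1 / ‖y‖ else 0

/-- The part of `v` outside the ball of radius `r`. -/
def farPart (r : ℝ) (y : R3) : ℝ := if ‖y‖ < r then 0 else v y

/-- Near the origin one factor `1/|y|` goes with `φ`, where its `L²` norm is small with `r`, and the
other goes with `ψ`, where Hardy controls it. -/
theorem v_eq_near_add_far (r : ℝ) (y : R3) : v y = nearPart r y * (1 / ‖y‖) + farPart r y := by
  unfold v nearPart farPart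
  split_ifs
  · rw [add_zero, div_mul_div_comm, one_mul, sq]
  · rw [zero_mul, zero_add]
    rfl

theorem nearPart_nonneg (r : ℝ) : 0 ≤ nearPart r := fun y => by
  unfold nearPart
  split_ifs <;> simp

theorem v_nonneg (y : R3) : 0 ≤ v y := by
  unfold v
  positivity

theorem v_pos {y : R3} (hy : y ≠ 0) : 0 < v y := by
  unfold v
  have := norm_pos_iff.2 hy
  positivity

theorem farPart_nonneg (r : ℝ) : 0 ≤ farPart r := fun y => by
  unfold farPart
  split_ifs
  · simp
  · exact v_nonneg y

theorem measurable_v : Measurable v := by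
  unfold v
  fun_prop

theorem measurable_nearPart (r : ℝ) : Measurable (nearPart r) :=
  Measurable.ite (measurableSet_lt measurable_norm measurable_const) (by fun_prop)
    measurable_const

theorem measurable_farPart (r : ℝ) : Measurable (farPart r) :=
  Measurable.ite (measurableSet_lt measurable_norm measurable_const) measurable_const measurable_v

/-- In polar coordinates the Jacobian `s²` cancels `s⁻²`, so the squared norm of `nearPart r` is
linear in `r`. -/
theorem radial_near (r : ℝ) :
    Set.EqOn (fun s : ℝ => s ^ (Module.finrank ℝ R3 - 1) • (if s < r then (1 / s) ^ 2 else 0))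
      (Set.indicator (Set.Iio r) fun _ => (1 : ℝ)) (Set.Ioi 0) := by
  intro s hs
  have hs : s ≠ 0 := ne_of_gt hs
  by_cases h : s < r
  · simp [h, hs]
  · simp [h]

theorem integrable_nearPart_sq (r : ℝ) : Integrable (fun y => nearPart r y ^ 2) volume := by
  have h := (integrable_fun_norm_addHaar (volume : Measure R3)
    (f := fun s : ℝ => if s < r then (1 / s) ^ 2 else 0)).2 ?_
  · refine h.congr (Eventually.of_forall fun y => ?_)
    simp only [nearPart]
    split_ifs <;> simp
  · refine IntegrableOn.congr_fun ?_ (radial_near r).symm measurableSet_Ioi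
    rw [integrableOn_indicator_iff measurableSet_Iio]
    refine integrableOn_const ?_
    rw [Set.inter_comm, Set.Ioi_inter_Iio]
    simp

theorem integral_nearPart_sq {r : ℝ} (hr : 0 ≤ r) :
    ∫ y, nearPart r y ^ 2 = 3 * volume.real (Metric.ball (0 : R3) 1) * r := by
  have h := integral_fun_norm_addHaar (volume : Measure R3)
    (fun s : ℝ => if s < r then (1 / s) ^ 2 else 0)
  have h1 : ∫ y, nearPart r y ^ 2 = ∫ y : R3, (fun s : ℝ => if s < r then (1 / s) ^ 2 else 0) ‖y‖ := by
    refine integral_congr_ae (Eventually.of_forall fun y => ?_)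
    simp only [nearPart]
    split_ifs <;> simp
  rw [h1, h, setIntegral_congr_fun measurableSet_Ioi (radial_near r),
    setIntegral_indicator measurableSet_Iio, Set.Ioi_inter_Iio]
  simp [hr]
  ring

theorem exists_nearPart_small {δ : ℝ} (hδ : 0 < δ) : ∃ r > 0, √(∫ y, nearPart r y ^ 2) ≤ δ := by
  set K := 3 * volume.real (Metric.ball (0 : R3) 1)
  have hK : 0 ≤ K := by positivity
  have hr : 0 < δ ^ 2 / (K + 1) := by positivity
  refine ⟨δ ^ 2 / (K + 1), hr, ?_⟩
  rw [integral_nearPart_sq hr.le]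
  refine Real.sqrt_le_iff.2 ⟨hδ.le, ?_⟩
  rw [← mul_div_assoc, div_le_iff₀ (by positivity)]
  nlinarith [sq_nonneg δ]

theorem integrable_farPart_sq {r : ℝ} (hr : 0 < r) :
    Integrable (fun y => farPart r y ^ 2) volume := by
  have h : Integrable (fun y : R3 => (1 + 1 / r) ^ 4 * (1 + ‖y‖) ^ (-(4 : ℝ))) volume :=
    (integrable_one_add_norm (by simp; norm_num)).const_mul _
  refine h.mono' ((measurable_farPart r).pow_const 2).aestronglyMeasurable
    (Eventually.of_forall fun y => ?_)
  unfold farPart v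
  split_ifs with hy
  · simp only [ne_eq, OfNat.ofNat_ne_zero, not_false_eq_true, zero_pow, norm_zero]
    positivity
  · push Not at hy
    have hy0 : 0 < ‖y‖ := hr.trans_le hy
    rw [Real.norm_of_nonneg (by positivity), Real.rpow_neg (by positivity)]
    have h1 : 1 + ‖y‖ ≤ (1 + 1 / r) * ‖y‖ := by
      have : 1 ≤ 1 / r * ‖y‖ := by
        rw [div_mul_eq_mul_div, one_mul, le_div_iff₀ hr]
        linarith
      linarith
    have h2 : (1 + ‖y‖) ^ (4 : ℝ) ≤ (1 + 1 / r) ^ 4 * ‖y‖ ^ 4 := by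
      rw [← mul_pow, ← Real.rpow_natCast]
      norm_num
      exact pow_le_pow_left₀ (by positivity) (by simpa using h1) 4
    have h3 : (1 / ‖y‖ ^ 2) ^ 2 = 1 / ‖y‖ ^ 4 := by
      rw [div_pow, one_pow, ← pow_mul]
    rw [h3, ← div_eq_mul_inv, div_le_div_iff₀ (by positivity) (by positivity), one_mul]
    exact h2

end Radial

section Pairing

variable {ℓ : ℝ} [Fact (0 < ℓ)] {n : ℕ}

/-- Adding a phonon at the last place of a configuration. -/
def snocMap (p : Conf ℓ n × R3) : Conf ℓ (n + 1) :=
  (p.1.1, Fin.snoc (α := fun _ => R3) p.1.2 p.2)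

/-- `snocMap` as a measurable equivalence. -/
def snocEquiv (ℓ : ℝ) (n : ℕ) : Conf ℓ n × R3 ≃ᵐ Conf ℓ (n + 1) :=
  MeasurableEquiv.prodAssoc.trans <| MeasurableEquiv.prodCongr (MeasurableEquiv.refl _) <|
    MeasurableEquiv.prodComm.trans (MeasurableEquiv.piFinSuccAbove (fun _ => R3) (Fin.last n)).symm

theorem coe_snocEquiv : ⇑(snocEquiv ℓ n) = snocMap := by
  funext p
  refine Prod.ext rfl ?_
  exact Fin.insertNth_last' p.2 p.1.2

theorem snocMap_preserving : MeasurePreserving (snocMap (ℓ := ℓ) (n := n)) volume volume := by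
  rw [← coe_snocEquiv]
  have h1 : MeasurePreserving
      (MeasurableEquiv.prodAssoc : (Torus ℓ × (Fin n → R3)) × R3 ≃ᵐ _) volume volume :=
    measurePreserving_prodAssoc volume volume volume
  have h2 : MeasurePreserving (MeasurableEquiv.prodComm : (Fin n → R3) × R3 ≃ᵐ _)
      volume volume := Measure.measurePreserving_swap
  have h3 : MeasurePreserving
      (MeasurableEquiv.piFinSuccAbove (fun _ : Fin (n + 1) => R3) (Fin.last n)).symm
      volume volume :=
    (volume_preserving_piFinSuccAbove (fun _ : Fin (n + 1) => R3) (Fin.last n)).symm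
  exact (((MeasurePreserving.id (volume : Measure (Torus ℓ))).prod (h3.comp h2))).comp h1

theorem measurableEmbedding_snocMap : MeasurableEmbedding (snocMap (ℓ := ℓ) (n := n)) := by
  rw [← coe_snocEquiv]
  exact (snocEquiv ℓ n).measurableEmbedding

theorem snocMap_last (p : Conf ℓ n × R3) : (snocMap p).2 (Fin.last n) = p.2 := by
  simp [snocMap]

/-- The integrand of the pairing `⟨φ, a(v) ψ⟩`. -/
def pairKernel (φ : L2 ℓ n) (ψ : L2 ℓ (n + 1)) (p : Conf ℓ n × R3) : ℂ :=
  starRingEnd ℂ (φ p.1) * ((v p.2 : ℂ) * ψ (snocMap p))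

/-- The pairing `∫ conj φ(x, y₁, …, yₙ) v(y) ψ(x, y₁, …, yₙ, y)`. -/
def pair (φ : L2 ℓ n) (ψ : L2 ℓ (n + 1)) : ℂ := ∫ p, pairKernel φ ψ p

theorem aestronglyMeasurable_comp_fst (φ : L2 ℓ n) :
    AEStronglyMeasurable (fun p : Conf ℓ n × R3 => φ p.1) volume :=
  (Lp.aestronglyMeasurable φ).comp_quasiMeasurePreserving Measure.quasiMeasurePreserving_fst

theorem aestronglyMeasurable_comp_snocMap (ψ : L2 ℓ (n + 1)) :
    AEStronglyMeasurable (fun p : Conf ℓ n × R3 => ψ (snocMap p)) volume :=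
  (Lp.aestronglyMeasurable ψ).comp_quasiMeasurePreserving
    snocMap_preserving.quasiMeasurePreserving

theorem ae_comp_fst {P : Conf ℓ n → Prop} (h : ∀ᵐ z, P z) : ∀ᵐ p : Conf ℓ n × R3, P p.1 :=
  Measure.quasiMeasurePreserving_fst.ae h

theorem ae_comp_snocMap {P : Conf ℓ (n + 1) → Prop} (h : ∀ᵐ z, P z) :
    ∀ᵐ p : Conf ℓ n × R3, P (snocMap p) :=
  snocMap_preserving.quasiMeasurePreserving.ae h

theorem ae_ne_zero_snd : ∀ᵐ p : Conf ℓ n × R3, p.2 ≠ 0 := by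
  refine (Measure.quasiMeasurePreserving_snd (μ := (volume : Measure (Conf ℓ n)))).ae
    (p := fun y : R3 => y ≠ 0) ?_
  exact compl_mem_ae_iff.2 (measure_singleton (0 : R3))

/-- The relative bound of `a(v)`: the contribution of the singularity of `v` is controlled by an
arbitrarily small multiple of the gradient. -/
theorem pairKernel_bound {δ : ℝ} (hδ : 0 < δ) : ∃ b : ℝ, 0 ≤ b ∧
    ∀ (ℓ : ℝ) [Fact (0 < ℓ)] (n : ℕ) (φ : L2 ℓ n) (ψ : L2 ℓ (n + 1)) (g : Fin 3 → L2 ℓ (n + 1)),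
      (∀ i, HasDerivAt (shift i ψ) (g i) 0) →
      Integrable (pairKernel φ ψ) volume ∧
        ∫ p, ‖pairKernel φ ψ p‖ ≤ ‖φ‖ * (δ * √(∑ i, ‖g i‖ ^ 2) + b * ‖ψ‖) := by
  -- The half compensates the factor `2 = √4` from Hardy's inequality.
  obtain ⟨r, hr, hnear⟩ := exists_nearPart_small (half_pos hδ)
  refine ⟨√(∫ y, farPart r y ^ 2), by positivity, fun ℓ _ n φ ψ g hg => ?_⟩
  obtain ⟨hH1, hH2⟩ := hardy (Fin.last n) hg
  have hpm := snocMap_preserving (ℓ := ℓ) (n := n)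
  have hme := measurableEmbedding_snocMap (ℓ := ℓ) (n := n)
  have hφm := (aestronglyMeasurable_comp_fst φ).norm
  have hψm := (aestronglyMeasurable_comp_snocMap ψ).norm
  have hsm : ∀ {k : R3 → ℝ}, Measurable k →
      AEStronglyMeasurable (fun p : Conf ℓ n × R3 => k p.2) volume :=
    fun hk => (hk.comp measurable_snd).aestronglyMeasurable
  -- products of a function of `z` and a function of `y`
  have hprod : ∀ k : R3 → ℝ, Integrable (fun y => k y ^ 2) volume →
      Integrable (fun p : Conf ℓ n × R3 => (‖φ p.1‖ * k p.2) ^ 2) volume ∧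
        √(∫ p : Conf ℓ n × R3, (‖φ p.1‖ * k p.2) ^ 2) = ‖φ‖ * √(∫ y, k y ^ 2) := by
    intro k hk
    simp only [mul_pow]
    refine ⟨(L2_integrable_sq φ).mul_prod hk, ?_⟩
    have h := integral_prod_mul (μ := (volume : Measure (Conf ℓ n))) (ν := (volume : Measure R3))
      (fun z => ‖φ z‖ ^ 2) (fun y => k y ^ 2)
    rw [Measure.volume_eq_prod, h, ← L2_norm_sq, Real.sqrt_mul (by positivity),
      Real.sqrt_sq (norm_nonneg _)]
  obtain ⟨hn1, hn2⟩ := hprod (nearPart r) (integrable_nearPart_sq r)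
  obtain ⟨hf1, hf2⟩ := hprod (farPart r) (integrable_farPart_sq hr)
  -- the two factors built from `ψ`
  have hG1 : Integrable (fun p : Conf ℓ n × R3 => (‖ψ (snocMap p)‖ / ‖p.2‖) ^ 2) volume := by
    have := (hpm.integrable_comp_emb hme).2 hH1
    simpa only [Function.comp_def, snocMap_last] using this
  have hG1' : ∫ p : Conf ℓ n × R3, (‖ψ (snocMap p)‖ / ‖p.2‖) ^ 2 ≤ 4 * ∑ i, ‖g i‖ ^ 2 := by
    have := hpm.integral_comp hme (fun z => (‖ψ z‖ / ‖z.2 (Fin.last n)‖) ^ 2)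
    simp only [snocMap_last] at this
    rw [this]
    exact hH2
  have hG2 : Integrable (fun p : Conf ℓ n × R3 => ‖ψ (snocMap p)‖ ^ 2) volume :=
    (hpm.integrable_comp_emb hme).2 (L2_integrable_sq ψ)
  have hG2' : √(∫ p : Conf ℓ n × R3, ‖ψ (snocMap p)‖ ^ 2) = ‖ψ‖ := by
    rw [hpm.integral_comp hme (fun z => ‖ψ z‖ ^ 2), ← L2_norm_sq, Real.sqrt_sq (norm_nonneg _)]
  obtain ⟨hA1, hA2⟩ := integral_mul_le_sqrt (μ := (volume : Measure (Conf ℓ n × R3)))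
    (F := fun p => ‖φ p.1‖ * nearPart r p.2) (G := fun p => ‖ψ (snocMap p)‖ / ‖p.2‖)
    (fun p => mul_nonneg (norm_nonneg _) (nearPart_nonneg r _)) (fun p => by positivity)
    (hφm.mul (hsm (measurable_nearPart r)))
    ((hψm.aemeasurable.div (hsm measurable_norm).aemeasurable).aestronglyMeasurable) hn1 hG1
  obtain ⟨hB1, hB2⟩ := integral_mul_le_sqrt (μ := (volume : Measure (Conf ℓ n × R3)))
    (F := fun p => ‖φ p.1‖ * farPart r p.2) (G := fun p => ‖ψ (snocMap p)‖)
    (fun p => mul_nonneg (norm_nonneg _) (farPart_nonneg r _)) (fun p => by positivity)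
    (hφm.mul (hsm (measurable_farPart r))) hψm hf1 hG2
  have hnorm : ∀ p, ‖pairKernel φ ψ p‖ = ‖φ p.1‖ * nearPart r p.2 * (‖ψ (snocMap p)‖ / ‖p.2‖)
      + ‖φ p.1‖ * farPart r p.2 * ‖ψ (snocMap p)‖ := by
    intro p
    simp only [pairKernel, norm_mul, RCLike.norm_conj, Complex.norm_real, Real.norm_eq_abs,
      abs_of_nonneg (v_nonneg _)]
    rw [v_eq_near_add_far r]
    ring
  have hmeas : AEStronglyMeasurable (pairKernel φ ψ) volume := by
    refine AEStronglyMeasurable.mul ?_ (AEStronglyMeasurable.mul ?_ ?_)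
    · exact Complex.continuous_conj.comp_aestronglyMeasurable (aestronglyMeasurable_comp_fst φ)
    · exact Complex.continuous_ofReal.comp_aestronglyMeasurable (hsm measurable_v)
    · exact aestronglyMeasurable_comp_snocMap ψ
  constructor
  · rw [← integrable_norm_iff hmeas]
    simp only [hnorm]
    exact hA1.add hB1
  · simp only [hnorm]
    rw [integral_add hA1 hB1]
    refine (add_le_add hA2 hB2).trans ?_
    rw [hn2, hf2, hG2']
    have h1 : √(∫ p : Conf ℓ n × R3, (‖ψ (snocMap p)‖ / ‖p.2‖) ^ 2)
        ≤ 2 * √(∑ i, ‖g i‖ ^ 2) := by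
      refine (Real.sqrt_le_sqrt hG1').trans_eq ?_
      rw [Real.sqrt_mul (by norm_num), show (4 : ℝ) = 2 ^ 2 by norm_num,
        Real.sqrt_sq (by norm_num)]
    have h2 := mul_le_mul hnear h1 (Real.sqrt_nonneg _) (half_pos hδ).le
    have h3 := mul_le_mul_of_nonneg_left h2 (norm_nonneg φ)
    nlinarith

end Pairing

end Polaron

end

/-! ### The form domain as a Hilbert space, built from graphs in each sector. -/

noncomputable section

namespace Polaron

open Filter Topology

theorem lp_two_hasSum_norm_sq {ι : Type*} {G : ι → Type*} [∀ i, NormedAddCommGroup (G i)]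
    (f : lp G 2) : HasSum (fun i => ‖f i‖ ^ 2) (‖f‖ ^ 2) := by
  have h := lp.hasSum_norm (p := 2) (by norm_num) f
  simpa using h

theorem memℓp_two_of_summable {ι : Type*} {G : ι → Type*} [∀ i, NormedAddCommGroup (G i)]
    {f : ∀ i, G i} (h : Summable fun i => ‖f i‖ ^ 2) : Memℓp f 2 :=
  memℓp_gen (by simpa using h)

section SectorGraph

variable {ℓ : ℝ} [Fact (0 < ℓ)] {n : ℕ}

/-- The index of the `i`-th gradient component in the graph of a sector. -/
def gradIdx (i : Fin 3) : Fin 5 := Fin.castSucc i.succ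

theorem sum_fin_five {M : Type*} [AddCommMonoid M] (F : Fin 5 → M) :
    ∑ k, F k = F 0 + (∑ i, F (gradIdx i)) + F 4 := by
  rw [Fin.sum_univ_castSucc, Fin.sum_univ_succ]
  rfl

theorem hasDerivAt_shift_add {i : Fin 3} {f f' g g' : L2 ℓ n} (h : HasDerivAt (shift i f) g 0)
    (h' : HasDerivAt (shift i f') g' 0) : HasDerivAt (shift i (f + f')) (g + g') 0 := by
  have : shift i (f + f') = fun t => shift i f t + shift i f' t := by
    funext t
    exact map_add (shiftIsom i t) f f'
  rw [this]
  exact h.add h'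

theorem hasDerivAt_shift_smul {i : Fin 3} {f g : L2 ℓ n} (c : ℂ)
    (h : HasDerivAt (shift i f) g 0) : HasDerivAt (shift i (c • f)) (c • g) 0 := by
  have : shift i (c • f) = fun t => c • shift i f t := by
    funext t
    exact map_smul (shiftIsom i t) c f
  rw [this]
  exact h.const_smul c

theorem hasDerivAt_shift_zero (i : Fin 3) : HasDerivAt (shift i (0 : L2 ℓ n)) 0 0 := by
  have : shift i (0 : L2 ℓ n) = fun _ => 0 := by
    funext t
    exact map_zero (shiftIsom i t)
  rw [this]
  exact hasDerivAt_const _ _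

variable (ℓ n) in
/-- The graph `(f, ∂₁ f, ∂₂ f, ∂₃ f, √n f)` of the square root of `(-i∇ₓ - P_f)² + N + 1` on the
`n`-phonon sector. -/
def sect : Submodule ℂ (PiLp 2 fun _ : Fin 5 => L2 ℓ n) where
  carrier := {p | p 0 ∈ nPhonon ℓ n ∧ (∀ i, HasDerivAt (shift i (p 0)) (p (gradIdx i)) 0) ∧
    p 4 = (√(n : ℝ) : ℂ) • p 0}
  add_mem' := fun {p q} hp hq => ⟨add_mem hp.1 hq.1,
    fun i => hasDerivAt_shift_add (hp.2.1 i) (hq.2.1 i), by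
      rw [PiLp.add_apply, PiLp.add_apply, hp.2.2, hq.2.2, smul_add]⟩
  zero_mem' := ⟨zero_mem _, fun i => hasDerivAt_shift_zero i, by simp⟩
  smul_mem' := fun c p hp => ⟨Submodule.smul_mem _ c hp.1,
    fun i => hasDerivAt_shift_smul c (hp.2.1 i), by
      rw [PiLp.smul_apply, PiLp.smul_apply, hp.2.2, smul_comm]⟩

/-- Completeness of the form norm comes from this: the derivative along translations is a closed
operator. -/
theorem isClosed_sect : IsClosed (sect ℓ n : Set (PiLp 2 fun _ : Fin 5 => L2 ℓ n)) := by
  have hc : ∀ k : Fin 5, Continuous fun p : PiLp 2 fun _ : Fin 5 => L2 ℓ n => p k :=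
    fun k => PiLp.continuous_apply 2 _ k
  refine (isClosed_nPhonon.preimage (hc 0)).inter (IsClosed.inter ?_ ?_)
  · have : {p : PiLp 2 fun _ : Fin 5 => L2 ℓ n |
        ∀ i, HasDerivAt (shift i (p 0)) (p (gradIdx i)) 0}
        = ⋂ i, (fun p => (p 0, p (gradIdx i))) ⁻¹'
          {q : L2 ℓ n × L2 ℓ n | HasDerivAt (shift i q.1) q.2 0} := by
      ext p
      simp
    have h : IsClosed {p : PiLp 2 fun _ : Fin 5 => L2 ℓ n |
        ∀ i, HasDerivAt (shift i (p 0)) (p (gradIdx i)) 0} := by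
      rw [this]
      exact isClosed_iInter fun i =>
        (isClosed_hasDerivAt_shift i).preimage ((hc 0).prodMk (hc (gradIdx i)))
    exact h
  · have h0 : Continuous fun p : PiLp 2 fun _ : Fin 5 => L2 ℓ n => (√(n : ℝ) : ℂ) • p 0 :=
      (continuous_const_smul (√(n : ℝ) : ℂ)).comp (hc 0)
    exact isClosed_eq (hc 4) h0

variable (ℓ n) in
/-- The graph `sect` as a Hilbert space. -/
def Sect : Type := sect ℓ n

instance : NormedAddCommGroup (Sect ℓ n) := inferInstanceAs (NormedAddCommGroup (sect ℓ n))

instance : InnerProductSpace ℂ (Sect ℓ n) := inferInstanceAs (InnerProductSpace ℂ (sect ℓ n))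

instance : CompleteSpace (Sect ℓ n) := isClosed_sect.completeSpace_coe

/-- The components of an element of the sector graph. -/
def Sect.val (p : Sect ℓ n) : PiLp 2 fun _ : Fin 5 => L2 ℓ n := Subtype.val p

theorem Sect.property (p : Sect ℓ n) : p.val ∈ sect ℓ n := Subtype.property p

/-- The function underlying an element of the sector graph. -/
def fn (p : Sect ℓ n) : L2 ℓ n := p.val 0

/-- The `i`-th gradient component of an element of the sector graph. -/
def gr (p : Sect ℓ n) (i : Fin 3) : L2 ℓ n := p.val (gradIdx i)

theorem fn_mem (p : Sect ℓ n) : fn p ∈ nPhonon ℓ n := p.property.1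

theorem hasDerivAt_fn (p : Sect ℓ n) (i : Fin 3) : HasDerivAt (shift i (fn p)) (gr p i) 0 :=
  p.property.2.1 i

theorem gr_eq_grad (p : Sect ℓ n) (i : Fin 3) : gr p i = grad i (fn p) :=
  (hasDerivAt_fn p i).deriv.symm

theorem fn_add (p q : Sect ℓ n) : fn (p + q) = fn p + fn q := rfl

theorem fn_smul (c : ℂ) (p : Sect ℓ n) : fn (c • p) = c • fn p := rfl

theorem fn_zero : fn (0 : Sect ℓ n) = 0 := rfl

theorem inner_sect (p q : Sect ℓ n) : ⟪p, q⟫_ℂ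
    = ⟪fn p, fn q⟫_ℂ + ((∑ i, ⟪gr p i, gr q i⟫_ℂ) + n * ⟪fn p, fn q⟫_ℂ) := by
  have h : ⟪p, q⟫_ℂ = ∑ k, ⟪p.val k, q.val k⟫_ℂ := by
    exact (Submodule.coe_inner (sect ℓ n) p q).trans (PiLp.inner_apply p.val q.val)
  rw [h, sum_fin_five, p.property.2.2, q.property.2.2, inner_smul_left, inner_smul_right, ← mul_assoc,
    Complex.conj_ofReal, ← Complex.ofReal_mul, Real.mul_self_sqrt (Nat.cast_nonneg n), add_assoc]
  simp [fn, gr]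

theorem norm_sq_sect (p : Sect ℓ n) :
    ‖p‖ ^ 2 = ‖fn p‖ ^ 2 + ((∑ i, ‖gr p i‖ ^ 2) + n * ‖fn p‖ ^ 2) := by
  have h : ‖p‖ ^ 2 = RCLike.re ⟪p, p⟫_ℂ := norm_sq_eq_re_inner p
  rw [h, inner_sect]
  have h1 : ∀ f : L2 ℓ n, ⟪f, f⟫_ℂ = ((‖f‖ ^ 2 : ℝ) : ℂ) := fun f => by
    rw [inner_self_eq_norm_sq_to_K]
    simp
  have h2 : (n : ℂ) = ((n : ℝ) : ℂ) := by simp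
  simp only [h1, h2, ← Complex.ofReal_mul, ← Complex.ofReal_sum, ← Complex.ofReal_add]
  exact Complex.ofReal_re _

/-- The element of the sector graph with a given function and gradient. -/
def mkSect (f : L2 ℓ n) (hf : f ∈ nPhonon ℓ n) (g : Fin 3 → L2 ℓ n)
    (hg : ∀ i, HasDerivAt (shift i f) (g i) 0) : Sect ℓ n :=
  ⟨WithLp.toLp 2 ![f, g 0, g 1, g 2, (√(n : ℝ) : ℂ) • f], hf, fun i => by
    fin_cases i
    · exact hg 0
    · exact hg 1
    · exact hg 2, rfl⟩

theorem fn_mkSect (f : L2 ℓ n) (hf : f ∈ nPhonon ℓ n) (g : Fin 3 → L2 ℓ n)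
    (hg : ∀ i, HasDerivAt (shift i f) (g i) 0) : fn (mkSect f hf g hg) = f := rfl

theorem gr_mkSect (f : L2 ℓ n) (hf : f ∈ nPhonon ℓ n) (g : Fin 3 → L2 ℓ n)
    (hg : ∀ i, HasDerivAt (shift i f) (g i) 0) (i : Fin 3) : gr (mkSect f hf g hg) i = g i := by
  fin_cases i <;> rfl

theorem fn_injective : Function.Injective (fn : Sect ℓ n → L2 ℓ n) := by
  intro p q h
  have h1 : ∀ i, gr p i = gr q i := fun i => by rw [gr_eq_grad, gr_eq_grad, h]
  refine Subtype.ext (PiLp.ext fun k => ?_)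
  have h4 : p.val 4 = q.val 4 := by
    rw [p.property.2.2, q.property.2.2]
    exact congrArg _ h
  fin_cases k
  · exact h
  · exact h1 0
  · exact h1 1
  · exact h1 2
  · exact h4

end SectorGraph

section FormSpace

variable {ℓ : ℝ} [Fact (0 < ℓ)]

variable (ℓ) in
/-- The form domain with its form norm, as a Hilbert space. -/
abbrev FormSpace : Type := lp (fun n : ℕ => Sect ℓ n) 2

theorem norm_fn_le {n : ℕ} (p : Sect ℓ n) : ‖fn p‖ ≤ ‖p‖ := by
  refine le_of_sq_le_sq ?_ (norm_nonneg _)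
  rw [norm_sq_sect]
  have : 0 ≤ (∑ i, ‖gr p i‖ ^ 2) + n * ‖fn p‖ ^ 2 := by positivity
  linarith

variable (ℓ) in
/-- The embedding of the form space into the Hilbert space. -/
def embed : FormSpace ℓ →L[ℂ] Hilb ℓ :=
  LinearMap.mkContinuous
    { toFun := fun p => ⟨fun n => ⟨fn (p n), fn_mem (p n)⟩, memℓp_two_of_summable <|
        Summable.of_nonneg_of_le (fun n => by positivity)
          (fun n => pow_le_pow_left₀ (norm_nonneg _) (norm_fn_le (p n)) 2)
          (lp_two_hasSum_norm_sq p).summable⟩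
      map_add' := fun p q => rfl
      map_smul' := fun c p => rfl } 1
    (fun p => by
      rw [one_mul]
      refine le_of_sq_le_sq ?_ (norm_nonneg _)
      refine hasSum_le (fun n => ?_) (lp_two_hasSum_norm_sq _) (lp_two_hasSum_norm_sq p)
      exact pow_le_pow_left₀ (norm_nonneg _) (norm_fn_le (p n)) 2)

theorem comp_embed (p : FormSpace ℓ) (n : ℕ) : comp (embed ℓ p) n = fn (p n) := rfl

theorem norm_embed_le (p : FormSpace ℓ) : ‖embed ℓ p‖ ≤ ‖p‖ := by
  refine le_of_sq_le_sq ?_ (norm_nonneg _)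
  refine hasSum_le (fun n => ?_) (lp_two_hasSum_norm_sq _) (lp_two_hasSum_norm_sq p)
  exact pow_le_pow_left₀ (norm_nonneg _) (norm_fn_le (p n)) 2

theorem Hilb_ext {Φ Ψ : Hilb ℓ} (h : ∀ n, comp Φ n = comp Ψ n) : Φ = Ψ :=
  lp.ext (funext fun n => Subtype.ext (h n))

theorem Hilb_hasSum_norm_sq (Ψ : Hilb ℓ) : HasSum (fun n => ‖comp Ψ n‖ ^ 2) (‖Ψ‖ ^ 2) :=
  lp_two_hasSum_norm_sq Ψ

theorem Hilb_hasSum_inner (Φ Ψ : Hilb ℓ) :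
    HasSum (fun n => ⟪comp Φ n, comp Ψ n⟫_ℂ) ⟪Φ, Ψ⟫_ℂ :=
  lp.hasSum_inner Φ Ψ

theorem mem_FormDomain_iff (Ψ : Hilb ℓ) : Ψ ∈ FormDomain ℓ ↔ ∃ p, embed ℓ p = Ψ := by
  constructor
  · rintro ⟨h1, h2⟩
    let q : ∀ n, Sect ℓ n := fun n => mkSect (comp Ψ n) (Ψ n).2 (fun i => grad i (comp Ψ n))
      (fun i => (h1 n i).hasDerivAt)
    have hq : Memℓp q 2 := by
      refine memℓp_two_of_summable (((Hilb_hasSum_norm_sq Ψ).summable.add h2).congr fun n => ?_)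
      have hgr : ∀ i, gr (q n) i = grad i (comp Ψ n) := fun i => gr_mkSect _ _ _ _ i
      rw [norm_sq_sect]
      simp only [hgr]
      rfl
    exact ⟨⟨q, hq⟩, Hilb_ext fun n => rfl⟩
  · rintro ⟨p, rfl⟩
    refine ⟨fun n i => (hasDerivAt_fn (p n) i).differentiableAt, ?_⟩
    refine Summable.of_nonneg_of_le (fun n => by positivity) (fun n => ?_)
      (lp_two_hasSum_norm_sq p).summable
    rw [norm_sq_sect]
    simp only [comp_embed, gr_eq_grad]
    nlinarith [sq_nonneg ‖fn (p n)‖]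

end FormSpace

end Polaron

end

/-! ### The interaction form, its relative bound and coercivity. -/

noncomputable section

namespace Polaron

open Filter Topology

theorem tsum_mul_le_of_sq {a c : ℕ → ℝ} {A C : ℝ} (ha : ∀ n, 0 ≤ a n) (hc : ∀ n, 0 ≤ c n)
    (hA : 0 ≤ A) (hC : 0 ≤ C) (hsa : Summable fun n => a n ^ 2) (hsc : Summable fun n => c n ^ 2)
    (hAa : ∑' n, a n ^ 2 ≤ A ^ 2) (hCc : ∑' n, c n ^ 2 ≤ C ^ 2) :
    Summable (fun n => a n * c n) ∧ ∑' n, a n * c n ≤ A * C := by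
  have h := Real.summable_and_inner_le_Lp_mul_Lq_tsum_of_nonneg (p := 2) (q := 2)
    (by constructor <;> norm_num) ha hc (by simpa using hsa) (by simpa using hsc)
  refine ⟨h.1, h.2.trans ?_⟩
  simp only [Real.rpow_two, ← Real.sqrt_eq_rpow]
  exact mul_le_mul (Real.sqrt_le_iff.2 ⟨hA, hAa⟩) (Real.sqrt_le_iff.2 ⟨hC, hCc⟩)
    (Real.sqrt_nonneg _) hA

section Interaction

variable {ℓ : ℝ} [Fact (0 < ℓ)] {n : ℕ}

theorem integrable_pairKernel (φ : L2 ℓ n) (q : Sect ℓ (n + 1)) :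
    Integrable (pairKernel φ (fn q)) volume := by
  obtain ⟨b, -, hb⟩ := pairKernel_bound one_pos
  exact (hb ℓ n φ (fn q) (gr q) (hasDerivAt_fn q)).1

theorem pair_add_left (φ φ' : L2 ℓ n) (q : Sect ℓ (n + 1)) :
    pair (φ + φ') (fn q) = pair φ (fn q) + pair φ' (fn q) := by
  unfold pair
  rw [← integral_add (integrable_pairKernel φ q) (integrable_pairKernel φ' q)]
  refine integral_congr_ae ?_
  filter_upwards [ae_comp_fst (Lp.coeFn_add φ φ')] with p hp
  simp only [pairKernel, hp, Pi.add_apply, map_add]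
  ring

theorem pair_smul_left (c : ℂ) (φ : L2 ℓ n) (ψ : L2 ℓ (n + 1)) :
    pair (c • φ) ψ = starRingEnd ℂ c * pair φ ψ := by
  unfold pair
  rw [← integral_const_mul]
  refine integral_congr_ae ?_
  filter_upwards [ae_comp_fst (Lp.coeFn_smul c φ)] with p hp
  simp only [pairKernel, hp, Pi.smul_apply, smul_eq_mul, map_mul]
  ring

theorem pair_add_right (φ : L2 ℓ n) (q q' : Sect ℓ (n + 1)) :
    pair φ (fn (q + q')) = pair φ (fn q) + pair φ (fn q') := by
  unfold pair
  rw [← integral_add (integrable_pairKernel φ q) (integrable_pairKernel φ q')]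
  refine integral_congr_ae ?_
  filter_upwards [ae_comp_snocMap (Lp.coeFn_add (fn q) (fn q'))] with p hp
  simp only [pairKernel, fn_add, hp, Pi.add_apply]
  ring

theorem pair_smul_right (c : ℂ) (φ : L2 ℓ n) (ψ : L2 ℓ (n + 1)) :
    pair φ (c • ψ) = c * pair φ ψ := by
  unfold pair
  rw [← integral_const_mul]
  refine integral_congr_ae ?_
  filter_upwards [ae_comp_snocMap (Lp.coeFn_smul c ψ)] with p hp
  simp only [pairKernel, hp, Pi.smul_apply, smul_eq_mul]
  ring

/-- The pairing `⟨p, a(v) q⟩` between the sectors with `n` and `n + 1` phonons. -/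
def sectPair (p : Sect ℓ n) (q : Sect ℓ (n + 1)) : ℂ :=
  (√((n : ℝ) + 1) : ℂ) * pair (fn p) (fn q)

theorem sqrt_mul_norm_fn_le (p : Sect ℓ n) : √((n : ℝ) + 1) * ‖fn p‖ ≤ ‖p‖ := by
  refine le_of_sq_le_sq ?_ (norm_nonneg _)
  rw [norm_sq_sect, mul_pow, Real.sq_sqrt (by positivity)]
  have : 0 ≤ ∑ i, ‖gr p i‖ ^ 2 := by positivity
  linarith

/-- The factor `√(n+1)` is given to `p` in the gradient term and to `q` in the remaining term; in
both cases the number operator in the form norm absorbs it. The constant `b` is uniform in `n`, and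
the term carrying it only sees the `L²` norm of `p`. -/
theorem sectPair_bound {δ : ℝ} (hδ : 0 < δ) : ∃ b : ℝ, 0 ≤ b ∧
    ∀ (ℓ : ℝ) [Fact (0 < ℓ)] (n : ℕ) (p : Sect ℓ n) (q : Sect ℓ (n + 1)),
      ‖sectPair p q‖ ≤ δ * (‖p‖ * ‖q‖) + b * (‖fn p‖ * ‖q‖) := by
  obtain ⟨b, hb0, hb⟩ := pairKernel_bound hδ
  refine ⟨b, hb0, fun ℓ _ n p q => ?_⟩
  have h1 : ‖pair (fn p) (fn q)‖ ≤ ‖fn p‖ * (δ * √(∑ i, ‖gr q i‖ ^ 2) + b * ‖fn q‖) :=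
    (norm_integral_le_integral_norm _).trans (hb ℓ n (fn p) (fn q) (gr q) (hasDerivAt_fn q)).2
  have h2 : √(∑ i, ‖gr q i‖ ^ 2) ≤ ‖q‖ := by
    refine Real.sqrt_le_iff.2 ⟨norm_nonneg _, ?_⟩
    rw [norm_sq_sect]
    have : 0 ≤ ((n + 1 : ℕ) : ℝ) * ‖fn q‖ ^ 2 := by positivity
    nlinarith [sq_nonneg ‖fn q‖]
  have h3 := sqrt_mul_norm_fn_le p
  have h4 : √((n : ℝ) + 1) * ‖fn q‖ ≤ ‖q‖ := by
    refine le_trans ?_ (sqrt_mul_norm_fn_le q)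
    refine mul_le_mul_of_nonneg_right (Real.sqrt_le_sqrt ?_) (norm_nonneg _)
    push_cast
    linarith
  rw [sectPair, norm_mul, Complex.norm_real, Real.norm_of_nonneg (Real.sqrt_nonneg _)]
  calc √((n : ℝ) + 1) * ‖pair (fn p) (fn q)‖
      ≤ √((n : ℝ) + 1) * (‖fn p‖ * (δ * √(∑ i, ‖gr q i‖ ^ 2) + b * ‖fn q‖)) :=
        mul_le_mul_of_nonneg_left h1 (Real.sqrt_nonneg _)
    _ = δ * ((√((n : ℝ) + 1) * ‖fn p‖) * √(∑ i, ‖gr q i‖ ^ 2))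
        + b * (‖fn p‖ * (√((n : ℝ) + 1) * ‖fn q‖)) := by ring
    _ ≤ δ * (‖p‖ * ‖q‖) + b * (‖fn p‖ * ‖q‖) := by gcongr

theorem summable_succ_norm_sq (q : FormSpace ℓ) :
    Summable (fun n => ‖q (n + 1)‖ ^ 2) ∧ ∑' n, ‖q (n + 1)‖ ^ 2 ≤ ‖q‖ ^ 2 := by
  have h := lp_two_hasSum_norm_sq q
  refine ⟨(summable_nat_add_iff 1).2 h.summable, ?_⟩
  have h1 := h.summable.tsum_eq_zero_add
  rw [h.tsum_eq] at h1
  nlinarith [sq_nonneg ‖q 0‖]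

/-- The interaction form `⟨p, a(v) q⟩`. -/
def intForm (p q : FormSpace ℓ) : ℂ := ∑' n, sectPair (p n) (q (n + 1))

theorem intForm_bound {δ : ℝ} (hδ : 0 < δ) : ∃ b : ℝ, 0 ≤ b ∧
    ∀ (ℓ : ℝ) [Fact (0 < ℓ)] (p q : FormSpace ℓ),
      Summable (fun n => sectPair (p n) (q (n + 1))) ∧
      ‖intForm p q‖ ≤ δ * (‖p‖ * ‖q‖) + b * (‖embed ℓ p‖ * ‖q‖) := by
  obtain ⟨b, hb0, hb⟩ := sectPair_bound hδ
  refine ⟨b, hb0, fun ℓ _ p q => ?_⟩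
  obtain ⟨hq1, hq2⟩ := summable_succ_norm_sq q
  have hp := lp_two_hasSum_norm_sq p
  have hJ := Hilb_hasSum_norm_sq (embed ℓ p)
  obtain ⟨h1, h1'⟩ := tsum_mul_le_of_sq (fun n => norm_nonneg (p n))
    (fun n => norm_nonneg (q (n + 1))) (norm_nonneg p) (norm_nonneg q) hp.summable hq1
    hp.tsum_eq.le hq2
  obtain ⟨h2, h2'⟩ := tsum_mul_le_of_sq (fun n => norm_nonneg (comp (embed ℓ p) n))
    (fun n => norm_nonneg (q (n + 1))) (norm_nonneg _) (norm_nonneg q) hJ.summable hq1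
    hJ.tsum_eq.le hq2
  have h3 := (h1.mul_left δ).add (h2.mul_left b)
  have h4 : Summable fun n => ‖sectPair (p n) (q (n + 1))‖ :=
    Summable.of_nonneg_of_le (fun n => norm_nonneg _) (fun n => hb ℓ n (p n) (q (n + 1))) h3
  refine ⟨h4.of_norm, (norm_tsum_le_tsum_norm h4).trans ?_⟩
  refine (h4.tsum_le_tsum (fun n => hb ℓ n (p n) (q (n + 1))) h3).trans ?_
  have h5 := (h1.mul_left δ).tsum_add (h2.mul_left b)
  simp only [comp_embed] at h2' h5
  rw [h5, tsum_mul_left, tsum_mul_left]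
  gcongr

theorem summable_sectPair (p q : FormSpace ℓ) :
    Summable (fun n => sectPair (p n) (q (n + 1))) := by
  obtain ⟨b, -, hb⟩ := intForm_bound one_pos
  exact (hb ℓ p q).1

theorem intForm_add_left (p p' q : FormSpace ℓ) :
    intForm (p + p') q = intForm p q + intForm p' q := by
  have h : ∀ n, sectPair ((p + p') n) (q (n + 1))
      = sectPair (p n) (q (n + 1)) + sectPair (p' n) (q (n + 1)) := fun n => by
    rw [lp.coeFn_add, Pi.add_apply, sectPair, fn_add, pair_add_left, mul_add, sectPair, sectPair]
  unfold intForm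
  rw [← (summable_sectPair p q).tsum_add (summable_sectPair p' q)]
  exact tsum_congr h

theorem intForm_smul_left (c : ℂ) (p q : FormSpace ℓ) :
    intForm (c • p) q = starRingEnd ℂ c * intForm p q := by
  have h : ∀ n, sectPair ((c • p) n) (q (n + 1))
      = starRingEnd ℂ c * sectPair (p n) (q (n + 1)) := fun n => by
    rw [lp.coeFn_smul, Pi.smul_apply, sectPair, fn_smul, pair_smul_left, sectPair, mul_left_comm]
  unfold intForm
  rw [← tsum_mul_left]
  exact tsum_congr h

theorem intForm_add_right (p q q' : FormSpace ℓ) :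
    intForm p (q + q') = intForm p q + intForm p q' := by
  have h : ∀ n, sectPair (p n) ((q + q') (n + 1))
      = sectPair (p n) (q (n + 1)) + sectPair (p n) (q' (n + 1)) := fun n => by
    rw [lp.coeFn_add, Pi.add_apply, sectPair, pair_add_right, mul_add, sectPair, sectPair]
  unfold intForm
  rw [← (summable_sectPair p q).tsum_add (summable_sectPair p q')]
  exact tsum_congr h

theorem intForm_smul_right (c : ℂ) (p q : FormSpace ℓ) :
    intForm p (c • q) = c * intForm p q := by
  have h : ∀ n, sectPair (p n) ((c • q) (n + 1)) = c * sectPair (p n) (q (n + 1)) := fun n => by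
    rw [lp.coeFn_smul, Pi.smul_apply, sectPair, fn_smul, pair_smul_right, sectPair, mul_left_comm]
  unfold intForm
  rw [← tsum_mul_left]
  exact tsum_congr h

theorem exists_norm_intForm_le : ∃ C : ℝ, ∀ (ℓ : ℝ) [Fact (0 < ℓ)] (p q : FormSpace ℓ),
    ‖intForm p q‖ ≤ C * ‖p‖ * ‖q‖ := by
  obtain ⟨b, hb0, hb⟩ := intForm_bound one_pos
  refine ⟨1 + b, fun ℓ _ p q => (hb ℓ p q).2.trans ?_⟩
  have h1 := mul_le_mul_of_nonneg_left
    (mul_le_mul_of_nonneg_right (norm_embed_le p) (norm_nonneg q)) hb0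
  linarith

variable (ℓ) in
/-- The interaction form as a sesquilinear map. -/
def intSesq : FormSpace ℓ →ₗ⋆[ℂ] FormSpace ℓ →ₗ[ℂ] ℂ :=
  LinearMap.mk₂'ₛₗ (starRingEnd ℂ) (RingHom.id ℂ) intForm intForm_add_left intForm_smul_left
    intForm_add_right intForm_smul_right

variable (ℓ) in
/-- The interaction form as a bounded sesquilinear form. -/
def intBilin : FormSpace ℓ →L⋆[ℂ] FormSpace ℓ →L[ℂ] ℂ :=
  LinearMap.mkContinuous₂ (intSesq ℓ) exists_norm_intForm_le.choose
    (exists_norm_intForm_le.choose_spec ℓ)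

variable (ℓ) in
/-- The bounded operator on the form space that represents the interaction form. -/
def intOp : FormSpace ℓ →L[ℂ] FormSpace ℓ :=
  InnerProductSpace.continuousLinearMapOfBilin (intBilin ℓ)

theorem inner_intOp_left (p q : FormSpace ℓ) : ⟪intOp ℓ p, q⟫_ℂ = intForm p q :=
  InnerProductSpace.continuousLinearMapOfBilin_apply (intBilin ℓ) p q

theorem inner_intOp_right (p q : FormSpace ℓ) :
    ⟪p, intOp ℓ q⟫_ℂ = starRingEnd ℂ (intForm q p) := by
  rw [← inner_intOp_left, inner_conj_symm]

variable (ℓ) in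
/-- The bounded operator on the form space that represents the form of `h_ℓ + lam`. -/
def formOp (α lam : ℝ) : FormSpace ℓ →L[ℂ] FormSpace ℓ :=
  1 + ((lam - 1 : ℝ) : ℂ) • ((embed ℓ).adjoint ∘L embed ℓ)
    + (√α : ℂ) • ((intOp ℓ).adjoint + intOp ℓ)

theorem inner_formOp (α lam : ℝ) (p q : FormSpace ℓ) : ⟪p, formOp ℓ α lam q⟫_ℂ
    = ⟪p, q⟫_ℂ + ((lam - 1 : ℝ) : ℂ) * ⟪embed ℓ p, embed ℓ q⟫_ℂ
      + (√α : ℂ) * (intForm p q + starRingEnd ℂ (intForm q p)) := by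
  simp only [formOp, add_apply, smul_apply,
    one_apply_eq_self, ContinuousLinearMap.comp_apply, inner_add_right, inner_smul_right,
    ContinuousLinearMap.adjoint_inner_right, inner_intOp_left, inner_intOp_right]

theorem formOp_symm (α lam : ℝ) (p q : FormSpace ℓ) :
    ⟪formOp ℓ α lam p, q⟫_ℂ = ⟪p, formOp ℓ α lam q⟫_ℂ := by
  rw [← inner_conj_symm, inner_formOp, inner_formOp]
  simp only [map_add, map_mul, Complex.conj_ofReal, inner_conj_symm, Complex.conj_conj]
  ring

theorem integral_annihilate_right (p q : FormSpace ℓ) (n : ℕ) :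
    ∫ z, starRingEnd ℂ (comp (embed ℓ p) n z) * annihilate (embed ℓ q) n z
      = sectPair (p n) (q (n + 1)) := by
  have h := integral_prod (μ := (volume : Measure (Conf ℓ n))) (ν := (volume : Measure R3)) _
    (integrable_pairKernel (fn (p n)) (q (n + 1)))
  rw [sectPair, pair]
  refine Eq.trans ?_ (congrArg _ h.symm)
  rw [← integral_const_mul]
  refine integral_congr_ae (Eventually.of_forall fun z => ?_)
  simp only [annihilate, pairKernel, comp_embed]
  rw [integral_const_mul]
  simp only [snocMap]
  ring

theorem integral_annihilate_left (p q : FormSpace ℓ) (n : ℕ) :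
    ∫ z, starRingEnd ℂ (annihilate (embed ℓ p) n z) * comp (embed ℓ q) n z
      = starRingEnd ℂ (sectPair (q n) (p (n + 1))) := by
  rw [← integral_annihilate_right, ← integral_conj]
  refine integral_congr_ae (Eventually.of_forall fun z => ?_)
  simp only [map_mul, Complex.conj_conj]
  ring

/-- The inner product of the form space already contains the one of `Hilb ℓ` once; hence `lam - 1`
in `formOp`. -/
theorem form_embed (α lam : ℝ) (p q : FormSpace ℓ) :
    form α (embed ℓ p) (embed ℓ q) + (lam : ℂ) * ⟪embed ℓ p, embed ℓ q⟫_ℂ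
      = ⟪p, formOp ℓ α lam q⟫_ℂ := by
  have h1 := lp.hasSum_inner (𝕜 := ℂ) p q
  have h2 := Hilb_hasSum_inner (embed ℓ p) (embed ℓ q)
  have h3 := (summable_sectPair p q).hasSum
  have h4 := ((summable_sectPair q p).hasSum.map (starRingEnd ℂ : ℂ →+* ℂ)
    Complex.continuous_conj)
  have h5 := (h1.sub h2).add ((h3.add h4).mul_left (√α : ℂ))
  have h6 : form α (embed ℓ p) (embed ℓ q) = ⟪p, q⟫_ℂ - ⟪embed ℓ p, embed ℓ q⟫_ℂ
      + (√α : ℂ) * (intForm p q + starRingEnd ℂ (intForm q p)) := by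
    rw [form]
    refine Eq.trans (tsum_congr fun n => ?_) h5.tsum_eq
    rw [integral_annihilate_right, integral_annihilate_left, inner_sect]
    simp only [comp_embed, gr_eq_grad, Function.comp_apply]
    ring
  rw [h6, inner_formOp]
  push_cast
  ring

theorem re_inner_formOp_self (α lam : ℝ) (p : FormSpace ℓ) : (⟪p, formOp ℓ α lam p⟫_ℂ).re
    = ‖p‖ ^ 2 + (lam - 1) * ‖embed ℓ p‖ ^ 2 + √α * (2 * (intForm p p).re) := by
  have e1 : ⟪p, p⟫_ℂ = ((‖p‖ ^ 2 : ℝ) : ℂ) := by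
    rw [inner_self_eq_norm_sq_to_K]
    simp
  have e2 : ⟪embed ℓ p, embed ℓ p⟫_ℂ = ((‖embed ℓ p‖ ^ 2 : ℝ) : ℂ) := by
    rw [inner_self_eq_norm_sq_to_K]
    simp
  rw [inner_formOp, e1, e2, Complex.add_conj, ← Complex.ofReal_mul, ← Complex.ofReal_mul,
    ← Complex.ofReal_add, ← Complex.ofReal_add, Complex.ofReal_re]

/-- The form of `h_ℓ + lam` is coercive for large `lam`. -/
theorem exists_coercive (α : ℝ) : ∃ lam₀ : ℝ, 0 < lam₀ ∧
    ∀ (ℓ : ℝ) [Fact (0 < ℓ)] (lam : ℝ), lam₀ ≤ lam → ∀ p : FormSpace ℓ,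
      1 / 2 * ‖p‖ ^ 2 ≤ (⟪p, formOp ℓ α lam p⟫_ℂ).re := by
  set s := √α
  have hs : 0 ≤ s := Real.sqrt_nonneg _
  -- With this `δ` the interaction, counted twice, costs at most `‖p‖²/4 + 2sb‖Jp‖‖p‖`, where `J` is
  -- `embed`. The last product is at most `‖p‖²/4 + 4(sb)²‖Jp‖²`, whose second term fixes `lam₀`.
  obtain ⟨b, hb0, hb⟩ := intForm_bound (δ := 1 / (8 * (s + 1))) (by positivity)
  refine ⟨1 + 4 * (s * b) ^ 2, by positivity, fun ℓ _ lam hlam p => ?_⟩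
  have h1 := (hb ℓ p p).2
  have h2 := Complex.abs_re_le_norm (intForm p p)
  rw [re_inner_formOp_self]
  have h4 : s * (1 / (8 * (s + 1))) ≤ 1 / 8 := by
    rw [mul_one_div, div_le_div_iff₀ (by positivity) (by norm_num)]
    linarith
  have h5 : s * |(intForm p p).re| ≤ 1 / 8 * ‖p‖ ^ 2 + s * b * (‖embed ℓ p‖ * ‖p‖) := by
    have := mul_le_mul_of_nonneg_left (h2.trans h1) hs
    nlinarith [sq_nonneg ‖p‖, mul_le_mul_of_nonneg_right h4 (sq_nonneg ‖p‖)]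
  have h6 : s * (2 * (intForm p p).re) ≥ - (2 * (s * |(intForm p p).re|)) := by
    nlinarith [neg_abs_le (intForm p p).re, mul_le_mul_of_nonneg_left
      (neg_abs_le (intForm p p).re) hs]
  have h7 : (4 * (s * b) ^ 2) * ‖embed ℓ p‖ ^ 2 ≤ (lam - 1) * ‖embed ℓ p‖ ^ 2 :=
    mul_le_mul_of_nonneg_right (by linarith) (sq_nonneg _)
  nlinarith [sq_nonneg (2 * (s * b) * ‖embed ℓ p‖ - 1 / 2 * ‖p‖)]

end Interaction

end Polaron

end

noncomputable section

/-! ### The operator associated with a coercive form -/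

section CoerciveForm

variable {V H : Type*} [NormedAddCommGroup V] [InnerProductSpace ℂ V] [CompleteSpace V]
  [NormedAddCommGroup H] [InnerProductSpace ℂ H] [CompleteSpace H]

/-- The solution operator of a symmetric coercive form is bounded and positive. -/
theorem exists_solution_operator (J : V →L[ℂ] H) (S : V →L[ℂ] V)
    (hS : ∀ p q, ⟪S p, q⟫_ℂ = ⟪p, S q⟫_ℂ) {c : ℝ} (hc : 0 < c)
    (hco : ∀ p, c * ‖p‖ ^ 2 ≤ (⟪p, S p⟫_ℂ).re) :
    ∃ R : H →L[ℂ] H, R.IsPositive ∧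
      ∀ f, ∃ p, R f = J p ∧ ∀ q, ⟪q, S p⟫_ℂ = ⟪J q, f⟫_ℂ := by
  -- Lax–Milgram: coercivity makes `S` invertible, and the solution operator is `J S⁻¹ J*`.
  have hu : IsUnit S := by
    refine ContinuousLinearMap.isUnit_of_forall_le_norm_inner_map S (c := ⟨c, hc.le⟩) hc
      fun p => ?_
    rw [hS]
    have h1 := Complex.abs_re_le_norm ⟪p, S p⟫_ℂ
    have h2 := le_abs_self (⟪p, S p⟫_ℂ).re
    have h3 := hco p
    change ‖p‖ ^ 2 * c ≤ _
    linarith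
  obtain ⟨u, rfl⟩ := hu
  set T : V →L[ℂ] V := ((u⁻¹ : (V →L[ℂ] V)ˣ) : V →L[ℂ] V)
  have hST : ∀ p, (u : V →L[ℂ] V) (T p) = p := fun p =>
    congrArg (fun A : V →L[ℂ] V => A p) u.mul_inv
  have hsol : ∀ f, ∀ q, ⟪q, (u : V →L[ℂ] V) (T (J.adjoint f))⟫_ℂ = ⟪J q, f⟫_ℂ := fun f q => by
    rw [hST, ContinuousLinearMap.adjoint_inner_right]
  refine ⟨J ∘L T ∘L J.adjoint, ?_, fun f => ⟨T (J.adjoint f), rfl, hsol f⟩⟩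
  have hpos : ∀ f, ⟪J (T (J.adjoint f)), f⟫_ℂ
      = ((⟪T (J.adjoint f), (u : V →L[ℂ] V) (T (J.adjoint f))⟫_ℂ).re : ℂ) := by
    intro f
    rw [← hsol f]
    refine Complex.ext rfl ?_
    have h := hS (T (J.adjoint f)) (T (J.adjoint f))
    rw [← inner_conj_symm] at h
    have h1 := congrArg Complex.im h
    rw [Complex.conj_im] at h1
    rw [Complex.ofReal_im]
    linarith
  rw [ContinuousLinearMap.isPositive_iff_complex]
  intro f
  change (((⟪J (T (J.adjoint f)), f⟫_ℂ).re : ℂ) = ⟪J (T (J.adjoint f)), f⟫_ℂ) ∧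
    0 ≤ (⟪J (T (J.adjoint f)), f⟫_ℂ).re
  rw [hpos f, Complex.ofReal_re]
  exact ⟨rfl, le_trans (by positivity) (hco _)⟩

/-- The solution of a coercive symmetric problem is the only minimizer of its energy. -/
theorem eq_solution_of_energy_le {J : V →L[ℂ] H} {S : V →L[ℂ] V}
    (hS : ∀ p q, ⟪S p, q⟫_ℂ = ⟪p, S q⟫_ℂ) {c : ℝ} (hc : 0 < c)
    (hco : ∀ p, c * ‖p‖ ^ 2 ≤ (⟪p, S p⟫_ℂ).re) {f : H} {p q : V}
    (hp : ∀ q, ⟪q, S p⟫_ℂ = ⟪J q, f⟫_ℂ) (h1 : (⟪q, S q⟫_ℂ).re ≤ (⟪p, S p⟫_ℂ).re)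
    (h2 : (⟪J p, f⟫_ℂ).re ≤ (⟪J q, f⟫_ℂ).re) : q = p := by
  have h3 := hco (q - p)
  have h4 : (⟪q - p, S (q - p)⟫_ℂ).re = (⟪q, S q⟫_ℂ).re
      - 2 * (⟪J q, f⟫_ℂ).re + (⟪J p, f⟫_ℂ).re := by
    have h5 : ⟪p, S q⟫_ℂ = starRingEnd ℂ ⟪J q, f⟫_ℂ := by
      rw [← hp, ← hS, inner_conj_symm]
    rw [map_sub, inner_sub_left, inner_sub_right, inner_sub_right, hp, hp, h5]
    simp only [Complex.sub_re, Complex.conj_re]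
    ring
  rw [hp] at h1
  have h6 : c * ‖q - p‖ ^ 2 ≤ 0 := by linarith
  have h7 : ‖q - p‖ ^ 2 = 0 := le_antisymm (nonpos_of_mul_nonpos_right h6 hc) (sq_nonneg _)
  exact sub_eq_zero.1 (norm_eq_zero.1 (pow_eq_zero_iff two_ne_zero |>.1 h7))

end CoerciveForm

namespace Polaron

open Filter Topology

/-! ### Inner products and interaction on the cone. -/

section Cone

variable {ℓ : ℝ} [Fact (0 < ℓ)] {n : ℕ}

theorem smul_neg_one_pow_mem_iff (f : L2 ℓ n) :
    (∀ᵐ z, (0 : ℂ) ≤ (-1) ^ n * f z) ↔ f = ((-1 : ℂ) ^ n) • absL2 f := by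
  have hsq : ((-1 : ℂ) ^ n) * (-1) ^ n = 1 := by
    rw [← mul_pow]
    simp
  constructor
  · intro h
    refine Lp.ext ?_
    filter_upwards [h, coeFn_absL2 f, Lp.coeFn_smul ((-1 : ℂ) ^ n) (absL2 f)] with z h1 h2 h3
    rw [h3, Pi.smul_apply, h2, smul_eq_mul]
    have h4 := Complex.eq_coe_norm_of_nonneg h1
    rw [norm_mul, norm_pow, norm_neg, norm_one, one_pow, one_mul] at h4
    rw [← h4, ← mul_assoc, hsq, one_mul]
  · intro h
    have h3 := Lp.coeFn_smul ((-1 : ℂ) ^ n) (absL2 f)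
    rw [← h] at h3
    filter_upwards [h3, coeFn_absL2 f] with z h3 h2
    rw [h3, Pi.smul_apply, h2, smul_eq_mul, ← mul_assoc, hsq, one_mul]
    exact_mod_cast norm_nonneg _

theorem cone_ae {Ψ : Hilb ℓ} (h : Ψ ∈ cone ℓ) (n : ℕ) :
    ∀ᵐ z, comp Ψ n z = (-1) ^ n * ((‖comp Ψ n z‖ : ℝ) : ℂ) := by
  have h1 := (smul_neg_one_pow_mem_iff (comp Ψ n)).1 (h n)
  have h2 := Lp.coeFn_smul ((-1 : ℂ) ^ n) (absL2 (comp Ψ n))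
  rw [← h1] at h2
  filter_upwards [h2, coeFn_absL2 (comp Ψ n)] with z h2 h3
  rw [h2, Pi.smul_apply, h3, smul_eq_mul] 
  simp

theorem neg_one_pow_mul_self (n : ℕ) : ((-1 : ℂ) ^ n) * (-1) ^ n = 1 := by
  rw [← mul_pow]
  simp

theorem inner_comp_cone {Φ Ψ : Hilb ℓ} (hΦ : Φ ∈ cone ℓ) (hΨ : Ψ ∈ cone ℓ) (n : ℕ) :
    ⟪comp Φ n, comp Ψ n⟫_ℂ = ((∫ z, ‖comp Φ n z‖ * ‖comp Ψ n z‖ : ℝ) : ℂ) := by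
  rw [L2.inner_def, ← integral_complex_ofReal]
  refine integral_congr_ae ?_
  filter_upwards [cone_ae hΦ n, cone_ae hΨ n] with z h1 h2
  rw [RCLike.inner_apply]
  conv_lhs => rw [h1, h2]
  rw [map_mul, map_pow, map_neg, map_one, Complex.conj_ofReal, mul_mul_mul_comm,
    neg_one_pow_mul_self]
  push_cast
  ring

theorem inner_cone {Φ Ψ : Hilb ℓ} (hΦ : Φ ∈ cone ℓ) (hΨ : Ψ ∈ cone ℓ) :
    ∃ s : ℝ, 0 ≤ s ∧ ⟪Φ, Ψ⟫_ℂ = s ∧ HasSum (fun n => ∫ z, ‖comp Φ n z‖ * ‖comp Ψ n z‖) s := by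
  have h := Hilb_hasSum_inner Φ Ψ
  simp only [inner_comp_cone hΦ hΨ] at h
  have h1 := Complex.reCLM.hasSum h
  simp only [Complex.reCLM_apply, Complex.ofReal_re] at h1
  refine ⟨_, h1.nonneg fun n => integral_nonneg fun z => by positivity, ?_, h1⟩
  exact h.unique (Complex.hasSum_ofReal.2 h1)

/-- An orthogonal pair in the cone has disjoint supports in every sector. -/
theorem ae_eq_zero_of_inner_cone {Φ Ψ : Hilb ℓ} (hΦ : Φ ∈ cone ℓ) (hΨ : Ψ ∈ cone ℓ)
    (h : ⟪Φ, Ψ⟫_ℂ = 0) (n : ℕ) : ∀ᵐ z, ‖comp Φ n z‖ * ‖comp Ψ n z‖ = 0 := by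
  obtain ⟨s, -, hs, hsum⟩ := inner_cone hΦ hΨ
  rw [h] at hs
  have hs0 : s = 0 := by exact_mod_cast hs.symm
  rw [hs0] at hsum
  have hnn : ∀ n, 0 ≤ ∫ z, ‖comp Φ n z‖ * ‖comp Ψ n z‖ :=
    fun n => integral_nonneg fun z => by positivity
  have h1 := (hasSum_zero_iff_of_nonneg hnn).1 hsum
  have h2 : ∫ z, ‖comp Φ n z‖ * ‖comp Ψ n z‖ = 0 := congrFun h1 n
  have hint : Integrable (fun z => ‖comp Φ n z‖ * ‖comp Ψ n z‖) volume :=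
    (Lp.memLp (comp Φ n)).norm.integrable_mul (Lp.memLp (comp Ψ n)).norm
  exact (integral_eq_zero_iff_of_nonneg (fun z => by positivity) hint).1 h2

/-- The signs `(-1)ⁿ` and `(-1)ⁿ⁺¹` multiply to `-1` and `v ≥ 0`. This is the reason for the
alternating signs in the cone: the interaction becomes nonpositive on it. -/
theorem pairKernel_cone {p q : FormSpace ℓ} (hp : embed ℓ p ∈ cone ℓ) (hq : embed ℓ q ∈ cone ℓ)
    (n : ℕ) : ∀ᵐ x, pairKernel (fn (p n)) (fn (q (n + 1))) x
      = -((‖pairKernel (fn (p n)) (fn (q (n + 1))) x‖ : ℝ) : ℂ) := by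
  filter_upwards [ae_comp_fst (cone_ae hp n), ae_comp_snocMap (cone_ae hq (n + 1))] with x h1 h2
  simp only [comp_embed] at h1 h2
  simp only [pairKernel, norm_mul, RCLike.norm_conj, Complex.norm_real, Real.norm_eq_abs,
    abs_of_nonneg (v_nonneg _)]
  conv_lhs => rw [h1, h2]
  rw [map_mul, map_pow, map_neg, map_one, Complex.conj_ofReal, pow_succ]
  push_cast
  linear_combination -(((‖fn (p n) x.1‖ : ℝ) : ℂ) * (v x.2 : ℂ) *
    ((‖fn (q (n + 1)) (snocMap x)‖ : ℝ) : ℂ)) * neg_one_pow_mul_self n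

theorem sectPair_cone {p q : FormSpace ℓ} (hp : embed ℓ p ∈ cone ℓ) (hq : embed ℓ q ∈ cone ℓ)
    (n : ℕ) : sectPair (p n) (q (n + 1))
      = ((-(√((n : ℝ) + 1) * ∫ x, ‖pairKernel (fn (p n)) (fn (q (n + 1))) x‖) : ℝ) : ℂ) := by
  rw [sectPair, pair, integral_congr_ae (pairKernel_cone hp hq n), integral_neg,
    integral_complex_ofReal]
  push_cast
  ring

theorem intForm_cone {p q : FormSpace ℓ} (hp : embed ℓ p ∈ cone ℓ) (hq : embed ℓ q ∈ cone ℓ) :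
    ∃ s : ℝ, 0 ≤ s ∧ intForm p q = ((-s : ℝ) : ℂ) ∧ HasSum (fun n : ℕ =>
      √((n : ℝ) + 1) * ∫ x, ‖pairKernel (fn (p n)) (fn (q (n + 1))) x‖) s := by
  have h := (summable_sectPair p q).hasSum
  simp only [sectPair_cone hp hq] at h
  have h1 := (Complex.reCLM.hasSum h).neg
  simp only [Complex.reCLM_apply, Complex.ofReal_re, neg_neg] at h1
  refine ⟨_, h1.nonneg fun n => mul_nonneg (Real.sqrt_nonneg _)
    (integral_nonneg fun x => norm_nonneg _), ?_, h1⟩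
  have h2 := Complex.hasSum_ofReal.2 h1.neg
  rw [intForm]
  simp only [sectPair_cone hp hq]
  exact h2.tsum_eq

end Cone

/-! ### Signed moduli lower the energy, so solutions stay in the cone. -/

section Preserving

variable {ℓ : ℝ} [Fact (0 < ℓ)] {n : ℕ}

theorem norm_neg_one_pow_smul (f : L2 ℓ n) : ‖((-1 : ℂ) ^ n) • f‖ = ‖f‖ := by
  rw [norm_smul]
  simp

theorem exists_signed_abs_sect (p : Sect ℓ n) :
    ∃ q : Sect ℓ n, fn q = ((-1 : ℂ) ^ n) • absL2 (fn p) ∧ ‖q‖ ≤ ‖p‖ := by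
  choose g hg hg' using fun i => exists_hasDerivAt_shift_absL2 (hasDerivAt_fn p i)
  let q := mkSect (((-1 : ℂ) ^ n) • absL2 (fn p))
    (Submodule.smul_mem _ _ (absL2_mem_nPhonon (fn_mem p))) (fun i => ((-1 : ℂ) ^ n) • g i)
    (fun i => hasDerivAt_shift_smul _ (hg i))
  refine ⟨q, rfl, le_of_sq_le_sq ?_ (norm_nonneg _)⟩
  have h1 : ‖fn q‖ = ‖fn p‖ := (norm_neg_one_pow_smul _).trans (norm_absL2 _)
  have h2 : ∀ i, ‖gr q i‖ ≤ ‖gr p i‖ := fun i => by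
    have : gr q i = ((-1 : ℂ) ^ n) • g i := gr_mkSect _ _ _ _ i
    rw [this, norm_neg_one_pow_smul]
    exact hg' i
  rw [norm_sq_sect, norm_sq_sect, h1]
  gcongr with i _
  exact h2 i

theorem exists_lp_two_of_norm_le {G : ℕ → Type*} [∀ n, NormedAddCommGroup (G n)] (p : lp G 2)
    (q : ∀ n, G n) (h : ∀ n, ‖q n‖ ≤ ‖p n‖) : ∃ r : lp G 2, (∀ n, r n = q n) ∧ ‖r‖ ≤ ‖p‖ := by
  have hp := lp_two_hasSum_norm_sq p
  have hle : ∀ n, ‖q n‖ ^ 2 ≤ ‖p n‖ ^ 2 := fun n => pow_le_pow_left₀ (norm_nonneg _) (h n) 2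
  have hmem : Memℓp q 2 := memℓp_two_of_summable
    (Summable.of_nonneg_of_le (fun n => by positivity) hle hp.summable)
  obtain ⟨r, hr⟩ : ∃ r : lp G 2, ∀ n, r n = q n := ⟨⟨q, hmem⟩, fun n => rfl⟩
  refine ⟨r, hr, le_of_sq_le_sq ?_ (norm_nonneg _)⟩
  refine hasSum_le (fun n => ?_) (lp_two_hasSum_norm_sq r) hp
  rw [hr]
  exact hle n

/-- The modulus of an element of the form space with respect to the cone. -/
theorem exists_signed_abs (p : FormSpace ℓ) : ∃ q : FormSpace ℓ,
    (∀ n, fn (q n) = ((-1 : ℂ) ^ n) • absL2 (fn (p n))) ∧ ‖q‖ ≤ ‖p‖ := by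
  choose q hq hq' using fun n => exists_signed_abs_sect (p n)
  obtain ⟨r, hr, hr'⟩ := exists_lp_two_of_norm_le p q hq'
  exact ⟨r, fun n => (congrArg fn (hr n)).trans (hq n), hr'⟩

theorem coeFn_signed_abs (f : L2 ℓ n) :
    ∀ᵐ z, (((-1 : ℂ) ^ n) • absL2 f) z = (-1) ^ n * ((‖f z‖ : ℝ) : ℂ) := by
  filter_upwards [Lp.coeFn_smul ((-1 : ℂ) ^ n) (absL2 f), coeFn_absL2 f] with z h1 h2
  rw [h1, Pi.smul_apply, h2, smul_eq_mul]

theorem signed_abs_mem_cone {p q : FormSpace ℓ}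
    (h : ∀ n, fn (q n) = ((-1 : ℂ) ^ n) • absL2 (fn (p n))) : embed ℓ q ∈ cone ℓ := by
  intro n
  rw [comp_embed, h n]
  filter_upwards [coeFn_signed_abs (fn (p n))] with z hz
  rw [hz, ← mul_assoc, neg_one_pow_mul_self, one_mul]
  exact_mod_cast norm_nonneg _

/-- The kernels of `p` and `q` have the same modulus, and on the cone the pairing equals minus the
integral of that modulus, its least possible real part. -/
theorem re_intForm_signed_abs_le {p q : FormSpace ℓ}
    (h : ∀ n, fn (q n) = ((-1 : ℂ) ^ n) • absL2 (fn (p n))) :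
    (intForm q q).re ≤ (intForm p p).re := by
  have h1 := Complex.reCLM.hasSum (summable_sectPair q q).hasSum
  have h2 := Complex.reCLM.hasSum (summable_sectPair p p).hasSum
  refine hasSum_le (fun n => ?_) h1 h2
  have hq := signed_abs_mem_cone h
  simp only [Complex.reCLM_apply]
  rw [sectPair_cone hq hq, Complex.ofReal_re, sectPair, Complex.re_ofReal_mul, ← mul_neg]
  refine mul_le_mul_of_nonneg_left ?_ (Real.sqrt_nonneg _)
  have h3 : ∫ x, ‖pairKernel (fn (q n)) (fn (q (n + 1))) x‖
      = ∫ x, ‖pairKernel (fn (p n)) (fn (p (n + 1))) x‖ := by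
    refine integral_congr_ae ?_
    filter_upwards [ae_comp_fst (coeFn_signed_abs (fn (p n))),
      ae_comp_snocMap (coeFn_signed_abs (fn (p (n + 1))))] with x hx1 hx2
    rw [← h n] at hx1
    rw [← h (n + 1)] at hx2
    simp [pairKernel, hx1, hx2]
  rw [h3]
  have h4 := norm_integral_le_integral_norm (μ := volume) (pairKernel (fn (p n)) (fn (p (n + 1))))
  have h5 := Complex.abs_re_le_norm (pair (fn (p n)) (fn (p (n + 1))))
  have h6 := neg_abs_le (pair (fn (p n)) (fn (p (n + 1)))).re
  have h7 : ‖pair (fn (p n)) (fn (p (n + 1)))‖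
      ≤ ∫ x, ‖pairKernel (fn (p n)) (fn (p (n + 1))) x‖ := h4
  linarith

theorem re_inner_le_signed_abs {p q : FormSpace ℓ}
    (h : ∀ n, fn (q n) = ((-1 : ℂ) ^ n) • absL2 (fn (p n))) {f : Hilb ℓ} (hf : f ∈ cone ℓ) :
    (⟪embed ℓ p, f⟫_ℂ).re ≤ (⟪embed ℓ q, f⟫_ℂ).re := by
  have h1 := Complex.reCLM.hasSum (Hilb_hasSum_inner (embed ℓ p) f)
  have h2 := Complex.reCLM.hasSum (Hilb_hasSum_inner (embed ℓ q) f)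
  refine hasSum_le (fun n => ?_) h1 h2
  simp only [Complex.reCLM_apply]
  rw [inner_comp_cone (signed_abs_mem_cone h) hf, Complex.ofReal_re]
  have h3 : ∫ z, ‖comp (embed ℓ q) n z‖ * ‖comp f n z‖
      = ∫ z, ‖comp (embed ℓ p) n z‖ * ‖comp f n z‖ := by
    refine integral_congr_ae ?_
    filter_upwards [coeFn_signed_abs (fn (p n))] with z hz
    rw [← h n] at hz
    simp [comp_embed, hz]
  rw [h3, L2.inner_def]
  refine (Complex.re_le_norm _).trans ((norm_integral_le_integral_norm _).trans_eq ?_)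
  refine integral_congr_ae (Eventually.of_forall fun z => ?_)
  simp [mul_comm]

/-- The weak solution of `(h_ℓ + lam) p = f` lies in the cone when `f` does. -/
theorem solution_mem_cone {α lam : ℝ}
    (hco : ∀ p : FormSpace ℓ, 1 / 2 * ‖p‖ ^ 2 ≤ (⟪p, formOp ℓ α lam p⟫_ℂ).re)
    {f : Hilb ℓ} (hf : f ∈ cone ℓ) {p : FormSpace ℓ}
    (hp : ∀ q, ⟪q, formOp ℓ α lam p⟫_ℂ = ⟪embed ℓ q, f⟫_ℂ) : embed ℓ p ∈ cone ℓ := by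
  obtain ⟨q, hq, hqn⟩ := exists_signed_abs p
  have hJ : ‖embed ℓ q‖ ^ 2 = ‖embed ℓ p‖ ^ 2 := by
    have h : ∀ n, ‖comp (embed ℓ q) n‖ ^ 2 = ‖comp (embed ℓ p) n‖ ^ 2 := fun n => by
      rw [comp_embed, comp_embed, hq n, norm_neg_one_pow_smul, norm_absL2]
    have h1 := Hilb_hasSum_norm_sq (embed ℓ q)
    rw [funext h] at h1
    exact h1.unique (Hilb_hasSum_norm_sq (embed ℓ p))
  have h1 : (⟪q, formOp ℓ α lam q⟫_ℂ).re ≤ (⟪p, formOp ℓ α lam p⟫_ℂ).re := by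
    rw [re_inner_formOp_self, re_inner_formOp_self, hJ]
    have := re_intForm_signed_abs_le hq
    gcongr
  have h2 := eq_solution_of_energy_le (formOp_symm α lam) (by norm_num) hco hp h1
    (re_inner_le_signed_abs hq hf)
  rw [← h2]
  exact signed_abs_mem_cone hq

end Preserving

end Polaron

end

/-! ### Weak solutions and the resolvent far below the spectrum. -/

noncomputable section

namespace Polaron

open Filter Topology

section Resolvent

variable {ℓ : ℝ} [Fact (0 < ℓ)]

/-- `p` is the weak solution of `(h_ℓ + lam) p = f`. -/
def IsSolution (α lam : ℝ) (p : FormSpace ℓ) (f : Hilb ℓ) : Prop :=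
  ∀ q, ⟪q, formOp ℓ α lam p⟫_ℂ = ⟪embed ℓ q, f⟫_ℂ

theorem IsSolution.form_eq {α lam : ℝ} {p : FormSpace ℓ} {f : Hilb ℓ} :
    IsSolution α lam p f ↔
      ∀ q, form α (embed ℓ q) (embed ℓ p) = ⟪embed ℓ q, -(lam : ℂ) • embed ℓ p + f⟫_ℂ := by
  refine forall_congr' fun q => ?_
  rw [← form_embed, inner_add_right, inner_smul_right]
  constructor
  · intro h
    linear_combination h
  · intro h
    linear_combination h

theorem IsSolution.unique {α lam : ℝ}
    (hco : ∀ p : FormSpace ℓ, 1 / 2 * ‖p‖ ^ 2 ≤ (⟪p, formOp ℓ α lam p⟫_ℂ).re)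
    {p q : FormSpace ℓ} {f : Hilb ℓ} (hp : IsSolution α lam p f) (hq : IsSolution α lam q f) :
    p = q := by
  have h1 := hco (p - q)
  have h2 : ⟪p - q, formOp ℓ α lam (p - q)⟫_ℂ = 0 := by
    rw [map_sub, inner_sub_right, hp, hq, sub_self]
  rw [h2, Complex.zero_re] at h1
  have h3 : ‖p - q‖ ^ 2 = 0 := le_antisymm (by linarith) (sq_nonneg _)
  exact sub_eq_zero.1 (norm_eq_zero.1 (pow_eq_zero_iff two_ne_zero |>.1 h3))

/-- The resolvent at `-lam` for large `lam` exists, is positive and preserves the cone. -/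
theorem exists_resolvent (α : ℝ) : ∃ lam₀ : ℝ, 0 < lam₀ ∧
    ∀ (ℓ : ℝ) [Fact (0 < ℓ)] (lam : ℝ), lam₀ ≤ lam → ∃ R : Hilb ℓ →L[ℂ] Hilb ℓ,
      R.IsPositive ∧ IsResolvent (hGraph α ℓ) (-(lam : ℂ)) R ∧
      (∀ f, ∃ p, R f = embed ℓ p ∧ IsSolution α lam p f) ∧
      (∀ p f, IsSolution α lam p f → R f = embed ℓ p) ∧ ∀ f ∈ cone ℓ, R f ∈ cone ℓ := by
  obtain ⟨lam₀, hpos, hco⟩ := exists_coercive α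
  refine ⟨lam₀, hpos, fun ℓ _ lam hlam => ?_⟩
  have hco := hco ℓ lam hlam
  obtain ⟨R, hR, hsol⟩ := exists_solution_operator (embed ℓ) (formOp ℓ α lam)
    (formOp_symm α lam) (by norm_num) hco
  have huniq : ∀ p f, IsSolution α lam p f → R f = embed ℓ p := fun p f hp => by
    obtain ⟨q, hq, hq'⟩ := hsol f
    rw [hq, IsSolution.unique hco hp hq']
  refine ⟨R, hR, fun f Ψ => ⟨?_, ?_⟩, hsol, huniq, fun f hf => ?_⟩
  · rintro rfl
    obtain ⟨p, hp, hp'⟩ := hsol f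
    refine ⟨(mem_FormDomain_iff _).2 ⟨p, hp.symm⟩, fun Φ hΦ => ?_⟩
    obtain ⟨q, rfl⟩ := (mem_FormDomain_iff _).1 hΦ
    rw [hp]
    exact IsSolution.form_eq.1 hp' q
  · rintro ⟨h1, h2⟩
    obtain ⟨p, rfl⟩ := (mem_FormDomain_iff _).1 h1
    exact huniq p f (IsSolution.form_eq.2 fun q =>
      h2 (embed ℓ q) ((mem_FormDomain_iff _).2 ⟨q, rfl⟩))
  · obtain ⟨p, hp, hp'⟩ := hsol f
    rw [hp]
    exact solution_mem_cone hco hf hp'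

end Resolvent

/-! ### Strictly positive test functions in every sector. -/

section TestFunction

variable {ℓ : ℝ} [Fact (0 < ℓ)] {n : ℕ}

/-- A strictly positive symmetric function of the phonon positions. -/
def weight (z : Conf ℓ n) : ℝ := Real.exp (-∑ j, ‖z.2 j‖)

theorem weight_pos (z : Conf ℓ n) : 0 < weight z := Real.exp_pos _

theorem continuous_weight : Continuous (weight (ℓ := ℓ) (n := n)) := by
  unfold weight
  fun_prop

theorem weight_permMap (σ : Equiv.Perm (Fin n)) (z : Conf ℓ n) :
    weight (permMap ℓ n σ z) = weight z := by
  simp only [weight, permMap]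
  rw [Equiv.sum_comp σ fun j => ‖z.2 j‖]

theorem integrable_exp_neg_two_norm :
    Integrable (fun y : R3 => Real.exp (-‖y‖) ^ 2) volume := by
  have h : Integrable (fun y : R3 => 24 * Real.exp 1 * (1 + ‖y‖) ^ (-(4 : ℝ))) volume :=
    (integrable_one_add_norm (by simp; norm_num)).const_mul _
  refine h.mono' (by fun_prop) (Eventually.of_forall fun y => ?_)
  have h0 : 0 ≤ ‖y‖ := norm_nonneg y
  have h1 := Real.pow_div_factorial_le_exp (1 + ‖y‖) (by positivity) 4
  have h2 : ((Nat.factorial 4 : ℕ) : ℝ) = 24 := by norm_num [Nat.factorial]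
  rw [h2] at h1
  rw [Real.norm_of_nonneg (by positivity), Real.rpow_neg (by positivity)]
  have h3 : (1 + ‖y‖) ^ (4 : ℝ) = (1 + ‖y‖) ^ (4 : ℕ) := by
    rw [← Real.rpow_natCast]
    norm_num
  rw [h3, ← div_eq_mul_inv, le_div_iff₀ (by positivity)]
  have h4 : Real.exp (-‖y‖) ^ 2 ≤ Real.exp (-‖y‖) := by
    have h5 : Real.exp (-‖y‖) ≤ 1 := Real.exp_le_one_iff.2 (by linarith)
    nlinarith [Real.exp_pos (-‖y‖)]
  calc Real.exp (-‖y‖) ^ 2 * (1 + ‖y‖) ^ 4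
      ≤ Real.exp (-‖y‖) * (24 * Real.exp (1 + ‖y‖)) := by
        refine mul_le_mul h4 (by linarith) (by positivity) (Real.exp_pos _).le
    _ = 24 * Real.exp 1 := by
        rw [mul_left_comm, ← Real.exp_add]
        congr 2
        ring

theorem memLp_weight : MemLp (fun z : Conf ℓ n => (weight z : ℂ)) 2 volume := by
  have hm : AEStronglyMeasurable (fun z : Conf ℓ n => (weight z : ℂ)) volume :=
    (Complex.continuous_ofReal.comp continuous_weight).aestronglyMeasurable
  rw [memLp_two_iff_integrable_sq_norm hm]
  have h1 : Integrable (fun y : Fin n → R3 => ∏ j, Real.exp (-‖y j‖) ^ 2) volume :=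
    Integrable.fintype_prod (f := fun _ (y : R3) => Real.exp (-‖y‖) ^ 2)
      fun _ => integrable_exp_neg_two_norm
  have h2 : Integrable (fun _ : Torus ℓ => (1 : ℝ)) volume := integrable_const _
  refine (h2.mul_prod h1).congr (Eventually.of_forall fun z => ?_)
  simp only [one_mul, Complex.norm_real, Real.norm_of_nonneg (Real.exp_pos _).le, weight,
    Finset.prod_pow, ← Real.exp_sum, Finset.sum_neg_distrib]

variable (ℓ n) in
/-- The class of `weight`. -/
def weightL2 : L2 ℓ n := memLp_weight.toLp _

theorem coeFn_weightL2 : weightL2 ℓ n =ᵐ[volume] fun z => (weight z : ℂ) :=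
  memLp_weight.coeFn_toLp

theorem weightL2_mem : weightL2 ℓ n ∈ nPhonon ℓ n := by
  rw [mem_nPhonon_iff_ae]
  intro σ
  filter_upwards [coeFn_weightL2 (ℓ := ℓ) (n := n),
    (permMap_preserving ℓ n σ).quasiMeasurePreserving.ae (coeFn_weightL2 (ℓ := ℓ) (n := n))]
    with z h1 h2
  rw [h1, h2, weight_permMap]

/-- Each of the `n` phonons moves by `t`, so the exponent changes by at most `nt ≤ 1`, and `|eˢ - 1|
≤ 2|s|` for `|s| ≤ 1`. -/
theorem abs_weight_shift_sub_le (i : Fin 3) {t : ℝ} (ht : 0 < t) (hnt : n * t ≤ 1)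
    (z : Conf ℓ n) : |weight (shiftMap ℓ n i t z) - weight z| ≤ 2 * (n * t) * weight z := by
  set a := ∑ j, ‖z.2 j‖
  set b := ∑ j, ‖(shiftMap ℓ n i t z).2 j‖
  have hab : |a - b| ≤ n * t := by
    rw [← Finset.sum_sub_distrib]
    refine (Finset.abs_sum_le_sum_abs _ _).trans ?_
    have h : ∀ j ∈ Finset.univ, |‖z.2 j‖ - ‖(shiftMap ℓ n i t z).2 j‖| ≤ t := fun j _ => by
      refine (abs_norm_sub_norm_le _ _).trans ?_
      simp [shiftMap, displacement, abs_of_pos ht]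
    refine (Finset.sum_le_sum h).trans_eq ?_
    simp
  have h1 : weight (shiftMap ℓ n i t z) - weight z = weight z * (Real.exp (a - b) - 1) := by
    change Real.exp (-b) - Real.exp (-a) = Real.exp (-a) * (Real.exp (a - b) - 1)
    rw [mul_sub, ← Real.exp_add, mul_one]
    congr 2
    ring
  have h2 := Real.abs_exp_sub_one_le (hab.trans hnt)
  rw [h1, abs_mul, abs_of_pos (weight_pos z), mul_comm]
  refine mul_le_mul_of_nonneg_right ?_ (weight_pos z).le
  linarith

/-- The factor `n` in the bound is kept because it forces the gradient to vanish in the vacuum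
sector. -/
theorem exists_hasDerivAt_weightL2 (i : Fin 3) :
    ∃ g, HasDerivAt (shift i (weightL2 ℓ n)) g 0 ∧ ‖g‖ ≤ 2 * n * ‖weightL2 ℓ n‖ := by
  refine exists_hasDerivAt_shift ?_
  have hsmall : ∀ᶠ t in 𝓝[>] (0 : ℝ), (n : ℝ) * t ≤ 1 := by
    have h : Tendsto (fun t : ℝ => (n : ℝ) * t) (𝓝 0) (𝓝 ((n : ℝ) * 0)) :=
      tendsto_const_nhds.mul tendsto_id
    rw [mul_zero] at h
    exact nhdsWithin_le_nhds (h.eventually_le_const one_pos)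
  filter_upwards [hsmall, self_mem_nhdsWithin] with t hnt ht
  have h : ‖shift i (weightL2 ℓ n) t - weightL2 ℓ n‖ ≤ (2 * (n * t)) * ‖weightL2 ℓ n‖ := by
    refine Lp.norm_le_mul_norm_of_ae_le_mul ?_
    filter_upwards [Lp.coeFn_sub (shift i (weightL2 ℓ n) t) (weightL2 ℓ n),
      Lp.coeFn_compMeasurePreserving (weightL2 ℓ n) (shiftMap_preserving ℓ n i t),
      (shiftMap_preserving ℓ n i t).quasiMeasurePreserving.ae
        (coeFn_weightL2 (ℓ := ℓ) (n := n)),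
      coeFn_weightL2 (ℓ := ℓ) (n := n)] with z h1 h2 h3 h4
    have h2' : shift i (weightL2 ℓ n) t z = weightL2 ℓ n (shiftMap ℓ n i t z) := h2
    rw [h1, Pi.sub_apply, h2', h3, h4, ← Complex.ofReal_sub, Complex.norm_real, Complex.norm_real,
      Real.norm_eq_abs, Real.norm_of_nonneg (weight_pos z).le]
    exact abs_weight_shift_sub_le i ht hnt z
  linarith

/-- Every sector contains a strictly positive element of the form domain; in the vacuum sector its
gradient vanishes. -/
theorem exists_test_sect (ℓ : ℝ) [Fact (0 < ℓ)] (n : ℕ) : ∃ s : Sect ℓ n,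
    (∀ᵐ z, fn s z = (-1) ^ n * (weight z : ℂ)) ∧ (n = 0 → ∀ i, gr s i = 0) := by
  choose g hg hg' using fun i => exists_hasDerivAt_weightL2 (ℓ := ℓ) (n := n) i
  refine ⟨mkSect (((-1 : ℂ) ^ n) • weightL2 ℓ n) (Submodule.smul_mem _ _ weightL2_mem)
    (fun i => ((-1 : ℂ) ^ n) • g i) (fun i => hasDerivAt_shift_smul _ (hg i)), ?_, ?_⟩
  · filter_upwards [Lp.coeFn_smul ((-1 : ℂ) ^ n) (weightL2 ℓ n),
      coeFn_weightL2 (ℓ := ℓ) (n := n)] with z h1 h2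
    rw [fn_mkSect, h1, Pi.smul_apply, h2, smul_eq_mul]
  · rintro rfl i
    rw [gr_mkSect]
    have h : ‖g i‖ ≤ 0 := by simpa using hg' i
    rw [norm_le_zero_iff.1 h, smul_zero]

end TestFunction

end Polaron

end

/-! ### Propagation of zeros between sectors; constancy on the torus. -/

noncomputable section

namespace Polaron

open Filter Topology

section Improving

variable {ℓ : ℝ} [Fact (0 < ℓ)] {n : ℕ}

theorem ae_of_ae_comp_snocMap {P : Conf ℓ (n + 1) → Prop}
    (h : ∀ᵐ x : Conf ℓ n × R3, P (snocMap x)) : ∀ᵐ z, P z := by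
  rw [← snocMap_preserving.map_eq]
  exact (measurableEmbedding_snocMap.ae_map_iff).2 h

/-- Strict positivity of `v` off the origin enters here: the interaction links almost every
configuration to the same one with a phonon added at almost any place. -/
theorem eq_zero_of_pairKernel_eq_zero {φ : L2 ℓ n} {ψ : L2 ℓ (n + 1)} (hφ : ∀ᵐ z, φ z ≠ 0)
    (h : ∀ᵐ x, pairKernel φ ψ x = 0) : ψ = 0 := by
  rw [Lp.eq_zero_iff_ae_eq_zero]
  refine ae_of_ae_comp_snocMap ?_
  filter_upwards [h, ae_comp_fst hφ, ae_ne_zero_snd] with x h1 h2 h3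
  simp only [pairKernel, mul_eq_zero, map_eq_zero, h2, false_or, Complex.ofReal_eq_zero,
    (v_pos h3).ne'] at h1
  exact h1

/-- A strictly positive test function supported in one sector. -/
def testElem (ℓ : ℝ) [Fact (0 < ℓ)] (n : ℕ) : FormSpace ℓ :=
  lp.single 2 n (exists_test_sect ℓ n).choose

theorem testElem_self (n : ℕ) : testElem ℓ n n = (exists_test_sect ℓ n).choose :=
  lp.single_apply_self 2 n _

theorem testElem_ne {m n : ℕ} (h : m ≠ n) : testElem ℓ n m = 0 :=
  lp.single_apply_ne 2 n _ h

theorem fn_testElem (n : ℕ) : ∀ᵐ z, fn (testElem ℓ n n) z = (-1) ^ n * (weight z : ℂ) := by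
  rw [testElem_self]
  exact (exists_test_sect ℓ n).choose_spec.1

theorem fn_testElem_ne_zero (n : ℕ) : ∀ᵐ z, fn (testElem ℓ n n) z ≠ 0 := by
  filter_upwards [fn_testElem (ℓ := ℓ) n] with z hz
  rw [hz]
  simp [(weight_pos z).ne']

theorem gr_testElem_zero (i : Fin 3) : gr (testElem ℓ 0 0) i = 0 := by
  rw [testElem_self]
  exact (exists_test_sect ℓ 0).choose_spec.2 rfl i

theorem fn_testElem_of_ne {m n : ℕ} (h : m ≠ n) : fn (testElem ℓ n m) = 0 := by
  rw [testElem_ne h, fn_zero]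

theorem testElem_mem_cone (n : ℕ) : embed ℓ (testElem ℓ n) ∈ cone ℓ := by
  intro m
  rw [comp_embed]
  rcases eq_or_ne m n with rfl | h
  · filter_upwards [fn_testElem (ℓ := ℓ) m] with z hz
    rw [hz, ← mul_assoc, neg_one_pow_mul_self, one_mul]
    exact_mod_cast (weight_pos z).le
  · rw [fn_testElem_of_ne h]
    filter_upwards [Lp.coeFn_zero ℂ 2 (volume : Measure (Conf ℓ m))] with z hz
    rw [hz]
    simp

theorem comp_eq_zero_of_inner_testElem {u : Hilb ℓ} (hu : u ∈ cone ℓ) {n : ℕ}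
    (h : ⟪embed ℓ (testElem ℓ n), u⟫_ℂ = 0) : comp u n = 0 := by
  rw [Lp.eq_zero_iff_ae_eq_zero]
  filter_upwards [ae_eq_zero_of_inner_cone (testElem_mem_cone n) hu h n,
    fn_testElem_ne_zero (ℓ := ℓ) n] with z h1 h2
  rw [comp_embed, mul_eq_zero, norm_eq_zero, norm_eq_zero] at h1
  exact h1.resolve_left h2

/-- At coupling zero the form is diagonal in the phonon number. -/
theorem inner_testElem_formOp_zero {lam : ℝ} {p : FormSpace ℓ} {n : ℕ} (h : fn (p n) = 0) :
    ⟪testElem ℓ n, formOp ℓ 0 lam p⟫_ℂ = 0 := by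
  have hp : p n = 0 := fn_injective (by rw [h, fn_zero])
  have h1 : ⟪testElem ℓ n, p⟫_ℂ = 0 := by
    rw [testElem, lp.inner_single_left, hp, inner_zero_right]
  have h2 : ⟪embed ℓ (testElem ℓ n), embed ℓ p⟫_ℂ = 0 := by
    refine (Hilb_hasSum_inner _ _).unique ?_
    have : ∀ m, ⟪comp (embed ℓ (testElem ℓ n)) m, comp (embed ℓ p) m⟫_ℂ = 0 := fun m => by
      rw [comp_embed, comp_embed]
      rcases eq_or_ne m n with rfl | hm
      · rw [h, inner_zero_right]
      · rw [fn_testElem_of_ne hm, inner_zero_left]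
    rw [funext this]
    exact hasSum_zero
  rw [inner_formOp, h1, h2, Real.sqrt_zero]
  simp

/-- The basic comparison between the free form and the form of `h_ℓ` on the cone. -/
theorem vanishing_of_inner_formOp_zero {α lam lam' : ℝ} (hα : 0 < α) (hlam : lam ≤ lam')
    {p q : FormSpace ℓ} {u : Hilb ℓ} (hp : embed ℓ p ∈ cone ℓ) (hq : embed ℓ q ∈ cone ℓ)
    (hu : u ∈ cone ℓ) (hsol : IsSolution α lam p u)
    (h : ⟪q, formOp ℓ 0 lam' p⟫_ℂ = 0) :
    ⟪embed ℓ q, u⟫_ℂ = 0 ∧ (lam < lam' → ⟪embed ℓ q, embed ℓ p⟫_ℂ = 0) ∧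
      (∀ n, ∀ᵐ x, pairKernel (fn (q n)) (fn (p (n + 1))) x = 0) ∧
      (∀ n, ∀ᵐ x, pairKernel (fn (p n)) (fn (q (n + 1))) x = 0) := by
  obtain ⟨a, ha, hau, -⟩ := inner_cone hq hu
  obtain ⟨b, hb, hbp, -⟩ := inner_cone hq hp
  obtain ⟨c, hc, hcq, hcs⟩ := intForm_cone hq hp
  obtain ⟨d, hd, hdq, hds⟩ := intForm_cone hp hq
  have h1 := hsol q
  rw [inner_formOp, hau, hbp, hcq, hdq, Complex.conj_ofReal] at h1
  rw [inner_formOp, hbp, Real.sqrt_zero] at h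
  -- Difference of the vanishing free form and the weak equation tested with `q`. The interaction
  -- equals `-(c + d)`, so every term here is nonnegative.
  have h2 : ((a + (lam' - lam) * b + √α * (c + d) : ℝ) : ℂ) = 0 := by
    push_cast at h h1 ⊢
    linear_combination h - h1
  have h3 : a + (lam' - lam) * b + √α * (c + d) = 0 := by exact_mod_cast h2
  have hs : 0 < √α := Real.sqrt_pos.2 hα
  have h4 : 0 ≤ (lam' - lam) * b := mul_nonneg (by linarith) hb
  have h5 : 0 ≤ √α * (c + d) := by positivity
  have h6 : √α * (c + d) = 0 := by linarith
  have h7 : c + d = 0 := (mul_eq_zero.1 h6).resolve_left hs.ne'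
  have hc0 : c = 0 := by linarith
  have hd0 : d = 0 := by linarith
  have key : ∀ {r s : FormSpace ℓ}, HasSum (fun n : ℕ =>
      √((n : ℝ) + 1) * ∫ x, ‖pairKernel (fn (r n)) (fn (s (n + 1))) x‖) 0 →
      ∀ n, ∀ᵐ x, pairKernel (fn (r n)) (fn (s (n + 1))) x = 0 := by
    intro r s hrs n
    have hz := (hasSum_zero_iff_of_nonneg fun n : ℕ => mul_nonneg (Real.sqrt_nonneg _)
      (integral_nonneg fun x => norm_nonneg _)).1 hrs
    have hn : √((n : ℝ) + 1) * ∫ x, ‖pairKernel (fn (r n)) (fn (s (n + 1))) x‖ = 0 := congrFun hz n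
    have hn' := (mul_eq_zero.1 hn).resolve_left (by positivity)
    have hae := (integral_eq_zero_iff_of_nonneg (fun x => norm_nonneg _)
      (integrable_pairKernel (fn (r n)) (s (n + 1))).norm).1 hn'
    filter_upwards [hae] with x hx
    exact norm_eq_zero.1 hx
  rw [hc0] at hcs
  rw [hd0] at hds
  refine ⟨?_, fun hlt => ?_, key hcs, key hds⟩
  · rw [hau]
    exact_mod_cast (by linarith : a = 0)
  · rw [hbp]
    have h8 : (lam' - lam) * b = 0 := by linarith
    exact_mod_cast (mul_eq_zero.1 h8).resolve_left (by linarith)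

/-- The vacuum component of the solution does not vanish. -/
theorem fn_zero_ne_zero {α lam : ℝ} (hα : 0 < α) {p : FormSpace ℓ} {u : Hilb ℓ}
    (hp : embed ℓ p ∈ cone ℓ) (hu : u ∈ cone ℓ) (hsol : IsSolution α lam p u) (hu0 : u ≠ 0) :
    fn (p 0) ≠ 0 := by
  intro h0
  have hall : ∀ n, fn (p n) = 0 := by
    intro n
    -- A missing `n`-phonon component makes the free form vanish against the test function of that
    -- sector; the comparison then removes the component with one more phonon.
    induction n with
    | zero => exact h0
    | succ n ih =>
      obtain ⟨-, -, h3, -⟩ := vanishing_of_inner_formOp_zero hα le_rfl hp (testElem_mem_cone n) hu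
        hsol (inner_testElem_formOp_zero ih)
      exact eq_zero_of_pairKernel_eq_zero (fn_testElem_ne_zero n) (h3 n)
  refine hu0 (Hilb_ext fun n => ?_)
  obtain ⟨h1, -⟩ := vanishing_of_inner_formOp_zero hα le_rfl hp (testElem_mem_cone n) hu
    hsol (inner_testElem_formOp_zero (hall n))
  exact comp_eq_zero_of_inner_testElem hu h1

/-- A cone element that is only orthogonal to cone elements without `n`-phonon component is
strictly positive in the `n`-phonon sector. -/
theorem ae_ne_zero_of_forall {Ψ : Hilb ℓ} (n : ℕ)
    (h : ∀ g ∈ cone ℓ, ⟪g, Ψ⟫_ℂ = 0 → comp g n = 0) : ∀ᵐ z, comp Ψ n z ≠ 0 := by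
  classical
  -- The witness lives exactly on the zero set of the component, so it is orthogonal to `Ψ`; the
  -- hypothesis makes it zero, and the zero set is null.
  let F : Conf ℓ n → ℂ := fun z => if comp Ψ n z = 0 then (-1) ^ n * (weight z : ℂ) else 0
  have hset : MeasurableSet {z | comp Ψ n z = 0} :=
    (Lp.stronglyMeasurable (comp Ψ n)).measurable (measurableSet_singleton 0)
  have hFm : AEStronglyMeasurable F volume :=
    (Measurable.ite hset (measurable_const.mul
      (Complex.continuous_ofReal.comp continuous_weight).measurable)
      measurable_const).aestronglyMeasurable
  have hF : MemLp F 2 volume := by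
    refine (memLp_weight (ℓ := ℓ) (n := n)).mono hFm (Eventually.of_forall fun z => ?_)
    simp only [F]
    split_ifs <;> simp
  have hFc := hF.coeFn_toLp
  have hmem : hF.toLp F ∈ nPhonon ℓ n := by
    rw [mem_nPhonon_iff_ae]
    intro σ
    filter_upwards [hFc, (permMap_preserving ℓ n σ).quasiMeasurePreserving.ae hFc,
      (mem_nPhonon_iff_ae.1 (Ψ n).2) σ] with z h1 h2 h3
    have h3' : comp Ψ n (permMap ℓ n σ z) = comp Ψ n z := h3
    rw [h1, h2]
    simp only [F, h3', weight_permMap]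
  let g : Hilb ℓ := lp.single 2 n ⟨hF.toLp F, hmem⟩
  have hgn : comp g n = hF.toLp F := congrArg Subtype.val
    (lp.single_apply_self (E := fun n => nPhonon ℓ n) 2 n ⟨hF.toLp F, hmem⟩)
  have hgm : ∀ m, m ≠ n → comp g m = 0 := fun m hm => congrArg Subtype.val
    (lp.single_apply_ne (E := fun n => nPhonon ℓ n) 2 n ⟨hF.toLp F, hmem⟩ hm)
  have hgc : g ∈ cone ℓ := by
    intro m
    rcases eq_or_ne m n with rfl | hm
    · rw [hgn]
      filter_upwards [hFc] with z hz
      rw [hz]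
      simp only [F]
      split_ifs
      · rw [← mul_assoc, neg_one_pow_mul_self, one_mul]
        exact_mod_cast (weight_pos z).le
      · simp
    · rw [hgm m hm]
      filter_upwards [Lp.coeFn_zero ℂ 2 (volume : Measure (Conf ℓ m))] with z hz
      rw [hz]
      simp
  have hinner : ⟪g, Ψ⟫_ℂ = 0 := by
    refine (Hilb_hasSum_inner g Ψ).unique ?_
    have : ∀ m, ⟪comp g m, comp Ψ m⟫_ℂ = 0 := fun m => by
      rcases eq_or_ne m n with rfl | hm
      · rw [hgn, L2.inner_def]
        refine integral_eq_zero_of_ae ?_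
        filter_upwards [hFc] with z hz
        rw [hz]
        simp only [F]
        split_ifs with h0 <;> simp [h0]
      · rw [hgm m hm, inner_zero_left]
    rw [funext this]
    exact hasSum_zero
  have h0 := h g hgc hinner
  rw [hgn] at h0
  rw [h0] at hFc
  filter_upwards [hFc, Lp.coeFn_zero ℂ 2 (volume : Measure (Conf ℓ n))] with z h1 h2 h3
  rw [h2] at h1
  simp only [F, h3, if_true, Pi.zero_apply] at h1
  simp [(weight_pos z).ne'] at h1

/-- Without phonons the three translation groups act transitively. This is the only sector where
invariance under them forces constancy. -/
theorem exists_displacement_add (a : Conf ℓ 0) : ∃ t : Fin 3 → ℝ,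
    a = displacement ℓ 0 0 (t 0) + (displacement ℓ 0 1 (t 1) + displacement ℓ 0 2 (t 2)) := by
  choose t ht using fun k => QuotientAddGroup.mk_surjective (a.1 k)
  refine ⟨t, Prod.ext ?_ (Subsingleton.elim _ _)⟩
  funext k
  have hk : ((t k : ℝ) : AddCircle ℓ) = a.1 k := ht k
  rw [← hk]
  fin_cases k <;> simp [displacement]

/-- A function on the torus with vanishing gradient is constant. -/
theorem exists_const_of_grad_eq_zero {f : L2 ℓ 0} (h : ∀ i, HasDerivAt (shift i f) 0 0) :
    ∃ c : ℂ, ∀ᵐ z, f z = c := by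
  have hshift : ∀ i t, ∀ᵐ z, f (z + displacement ℓ 0 i t) = f z := by
    intro i t
    have h1 := norm_shift_sub_le (h i) t
    rw [norm_zero, zero_mul] at h1
    have h2 : shift i f t = f := sub_eq_zero.1 (norm_le_zero_iff.1 h1)
    have h3 := Lp.coeFn_compMeasurePreserving f (shiftMap_preserving ℓ 0 i t)
    have h4 : shift i f t =ᵐ[volume] f ∘ shiftMap ℓ 0 i t := h3
    rw [h2] at h4
    filter_upwards [h4] with z hz using hz.symm
  have hall : ∀ a : Conf ℓ 0, ∀ᵐ z, f (z + a) = f z := by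
    intro a
    obtain ⟨t, rfl⟩ := exists_displacement_add a
    filter_upwards [hshift 0 (t 0),
      (shiftMap_preserving ℓ 0 0 (t 0)).quasiMeasurePreserving.ae (hshift 1 (t 1)),
      (shiftMap_preserving ℓ 0 0 (t 0)).quasiMeasurePreserving.ae
        ((shiftMap_preserving ℓ 0 1 (t 1)).quasiMeasurePreserving.ae (hshift 2 (t 2)))]
      with z h0 h1 h2
    simp only [shiftMap] at h1 h2
    rw [← add_assoc, ← add_assoc, h2, h1, h0]
  have hf : Measurable f := (Lp.stronglyMeasurable f).measurable
  -- Fubini exchanges the quantifiers, so a single good base point `z` determines `f` almost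
  -- everywhere.
  have hcomm : ∀ᵐ z : Conf ℓ 0, ∀ᵐ a : Conf ℓ 0, f (z + a) = f z := by
    refine (Measure.ae_ae_comm (p := fun (a z : Conf ℓ 0) => f (z + a) = f z) ?_).1
      (Eventually.of_forall hall)
    exact measurableSet_eq_fun (hf.comp (measurable_snd.add measurable_fst))
      (hf.comp measurable_snd)
  rcases eq_or_neBot (ae (volume : Measure (Conf ℓ 0))) with hbot | _
  · exact ⟨0, by rw [hbot]; exact mem_bot⟩
  obtain ⟨z, hz⟩ := hcomm.exists
  refine ⟨f z, ?_⟩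
  have hmp : MeasurePreserving (fun a : Conf ℓ 0 => -z + a) volume volume :=
    (volume_preserving_pi fun k =>
      measurePreserving_add_left (volume : Measure (AddCircle ℓ)) ((-z).1 k)).prod
    (volume_preserving_pi fun j =>
      measurePreserving_add_left (volume : Measure R3) ((-z).2 j))
  have h1 := hmp.quasiMeasurePreserving.ae hz
  filter_upwards [h1] with a ha
  simpa using ha

end Improving

end Polaron

end

/-! ### Abstract tools: mean ergodic theorem, resolvents of graphs, Neumann series. -/

noncomputable section

namespace Polaron

section Abstract

open Filter Topology

variable {H : Type*} [NormedAddCommGroup H] [InnerProductSpace ℂ H] [CompleteSpace H]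

/-- If the orbit of `g` under a contraction is orthogonal to `Ψ`, then so is the projection of `g`
onto the fixed vectors. -/
theorem exists_fixed_of_orbit_orthogonal {A : H →L[ℂ] H} (hA : ‖A‖ ≤ 1) {g Ψ : H}
    (h : ∀ k : ℕ, ⟪A^[k] g, Ψ⟫_ℂ = 0) :
    ∃ P : H, A P = P ∧ ⟪P, Ψ⟫_ℂ = 0 ∧ ∀ ω, A ω = ω → ⟪ω, P⟫_ℂ = ⟪ω, g⟫_ℂ := by
  -- Mean ergodic theorem: the orbit averages, all orthogonal to `Ψ`, converge to the projection.
  have hlim := A.tendsto_birkhoffAverage_orthogonalProjection hA g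
  set P := (A.eqLocus (1 : H →L[ℂ] H)).orthogonalProjectionOnto g
  refine ⟨P, P.2, ?_, fun ω hω => ?_⟩
  · refine tendsto_nhds_unique (hlim.inner tendsto_const_nhds) ?_
    have h0 : ∀ N : ℕ, ⟪birkhoffAverage ℂ A _root_.id N g, Ψ⟫_ℂ = 0 := fun N => by
      simp only [birkhoffAverage, birkhoffSum, inner_smul_left, sum_inner, id_eq, h,
        Finset.sum_const_zero, mul_zero]
    simp only [h0]
    exact tendsto_const_nhds
  · exact (A.eqLocus (1 : H →L[ℂ] H)).inner_orthogonalProjectionOnto_eq_of_mem_left ⟨ω, hω⟩ g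

theorem IsResolvent.graph_iff {G : Set (H × H)} {w : ℂ} {R : H →L[ℂ] H} (hR : IsResolvent G w R)
    (μ : ℂ) (f Ψ : H) : (Ψ, (w + μ) • Ψ + f) ∈ G ↔ R (μ • Ψ + f) = Ψ := by
  rw [hR, add_smul, add_assoc]

/-- The resolvent at a nearby point, by the Neumann series. -/
theorem IsResolvent.neumann {G : Set (H × H)} {w : ℂ} {R : H →L[ℂ] H} (hR : IsResolvent G w R)
    {μ : ℂ} (hμ : ‖μ • R‖ < 1) :
    IsResolvent G (w + μ) (R * Units.val (Units.oneSub (μ • R) hμ)⁻¹) := by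
  set X : H →L[ℂ] H := Units.val (Units.oneSub (μ • R) hμ)⁻¹
  have h1 : (1 - μ • R) * X = 1 := (Units.oneSub (μ • R) hμ).mul_inv
  have h2 : X * (1 - μ • R) = 1 := (Units.oneSub (μ • R) hμ).inv_mul
  have h3 : R * X = X * R := by
    have : Commute R (1 - μ • R) := (Commute.one_right R).sub_right ((Commute.refl R).smul_right μ)
    calc R * X = X * ((1 - μ • R) * R) * X := by rw [← mul_assoc, h2, one_mul]
      _ = X * (R * (1 - μ • R)) * X := by rw [this.eq]
      _ = X * R := by rw [mul_assoc, mul_assoc, h1, mul_one]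
  intro f Ψ
  rw [hR.graph_iff, h3]
  have key : X (R f) = Ψ ↔ R f = (1 - μ • R) Ψ := by
    constructor
    · rintro rfl
      exact (congrArg (fun T : H →L[ℂ] H => T (R f)) h1).symm
    · intro h
      rw [h]
      exact congrArg (fun T : H →L[ℂ] H => T Ψ) h2
  refine key.trans ?_
  change R f = Ψ - μ • R Ψ ↔ _
  rw [map_add, map_smul, eq_sub_iff_add_eq, add_comm]

/-- By the resolvent identity the inverse is `1 + μR'`. It is first a right inverse; injectivity of
`1 - μR`, read off from the graph, makes it two-sided. -/
theorem IsResolvent.isUnit_one_sub {G : Set (H × H)} {w : ℂ} {R R' : H →L[ℂ] H}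
    (hR : IsResolvent G w R) {μ : ℂ} (hR' : IsResolvent G (w + μ) R') :
    IsUnit (1 - μ • R) := by
  have h1 : ∀ f, R (μ • R' f + f) = R' f := fun f =>
    (hR.graph_iff μ f (R' f)).1 ((hR' f (R' f)).1 rfl)
  have hright : (1 - μ • R) * (1 + μ • R') = 1 := by
    ext f
    change (f + μ • R' f) - μ • R (f + μ • R' f) = f
    rw [add_comm f, h1]
    simp
  have hinj : ∀ Ψ, (1 - μ • R) Ψ = 0 → Ψ = 0 := fun Ψ hΨ => by
    have h3 : Ψ - μ • R Ψ = 0 := hΨ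
    have h4 : R (μ • Ψ + 0) = Ψ := by
      rw [add_zero, map_smul]
      exact (sub_eq_zero.1 h3).symm
    have h5 := (hR' 0 Ψ).2 ((hR.graph_iff μ 0 Ψ).2 h4)
    rw [← h5, map_zero]
  have hleft : (1 + μ • R') * (1 - μ • R) = 1 := by
    ext f
    refine sub_eq_zero.1 (hinj _ ?_)
    rw [map_sub, sub_eq_zero]
    have h6 : (1 - μ • R) * ((1 + μ • R') * (1 - μ • R)) = (1 - μ • R) * 1 := by
      rw [← mul_assoc, hright, one_mul, mul_one]
    exact congrArg (fun T : H →L[ℂ] H => T f) h6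
  exact ⟨⟨_, _, hright, hleft⟩, rfl⟩

/-- The bottom of the spectrum of a semibounded operator in terms of one resolvent. -/
theorem IsResolvent.bottom_mem_spec {G : Set (H × H)} {lam : ℝ} {R : H →L[ℂ] H}
    (hR : IsResolvent G (-(lam : ℂ)) R) (hpos : R.IsPositive) (hR0 : R ≠ 0) :
    ((‖R‖⁻¹ - lam : ℝ) : ℂ) ∈ spec G := by
  rintro ⟨R', hR'⟩
  have hn : ‖R‖ ≠ 0 := norm_ne_zero_iff.2 hR0
  have : Nontrivial (H →L[ℂ] H) := ⟨⟨R, 0, hR0⟩⟩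
  have h1 : IsUnit (1 - ((‖R‖⁻¹ : ℝ) : ℂ) • R) := by
    refine hR.isUnit_one_sub (R' := R') ?_
    convert hR' using 1
    push_cast
    ring
  -- The norm of a positive operator is a spectral value, so `‖R‖ - R` is not invertible, whereas a
  -- resolvent at `‖R‖⁻¹ - lam` would invert it.
  have h2 : ‖R‖ ∈ spectrum ℝ R :=
    CStarAlgebra.norm_mem_spectrum_of_nonneg ((ContinuousLinearMap.nonneg_iff_isPositive R).2 hpos)
  rw [spectrum.mem_iff] at h2
  apply h2
  have h3 : algebraMap ℝ (H →L[ℂ] H) ‖R‖ - R = (‖R‖ : ℂ) • (1 - ((‖R‖⁻¹ : ℝ) : ℂ) • R) := by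
    rw [smul_sub, smul_smul, ← Complex.ofReal_mul, mul_inv_cancel₀ hn, Complex.ofReal_one, one_smul,
      Algebra.algebraMap_eq_smul_one]
    rfl
  rw [h3]
  exact (h1.smul (Units.mk0 (‖R‖ : ℂ) (by exact_mod_cast hn)))

theorem norm_smul_lt_one {R : H →L[ℂ] H} (hR0 : R ≠ 0) {μ : ℝ} (h0 : 0 ≤ μ) (h1 : μ < ‖R‖⁻¹) :
    ‖(μ : ℂ) • R‖ < 1 := by
  have hn : 0 < ‖R‖ := norm_pos_iff.2 hR0
  rw [norm_smul, Complex.norm_real, Real.norm_of_nonneg h0]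
  calc μ * ‖R‖ < ‖R‖⁻¹ * ‖R‖ := mul_lt_mul_of_pos_right h1 hn
    _ = 1 := inv_mul_cancel₀ hn.ne'

theorem hasSum_pos_of_nonneg {t : ℕ → ℂ} {s : ℂ} (hs : HasSum t s) (h : ∀ k, 0 ≤ t k)
    (h0 : 0 < t 0) : 0 < s := by
  have hre := Complex.reCLM.hasSum hs
  have him := Complex.imCLM.hasSum hs
  rw [Complex.lt_def] at h0 ⊢
  constructor
  · refine h0.1.trans_le (le_hasSum hre 0 fun k _ => ?_)
    exact (Complex.le_def.1 (h k)).1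
  · refine HasSum.unique ?_ him
    have : ∀ k, Complex.imCLM (t k) = 0 := fun k => (Complex.le_def.1 (h k)).2.symm
    simp only [this]
    exact hasSum_zero

/-- The Neumann series of a positivity improving operator is positivity improving. -/
theorem positivityImproving_neumann {C : Set H} {R : H →L[ℂ] H}
    (hR : PositivityImproving C R) (hC : ∀ u ∈ C, ∀ c : ℝ, 0 ≤ c → (c : ℂ) • R u ∈ C) {μ : ℝ}
    (hμ0 : 0 ≤ μ) (hμ : ‖(μ : ℂ) • R‖ < 1) :
    PositivityImproving C (R * Units.val (Units.oneSub ((μ : ℂ) • R) hμ)⁻¹) := by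
  intro u hu w hw hu0 hw0
  set B := (μ : ℂ) • R
  have hmem : ∀ k : ℕ, (B ^ k) u ∈ C := by
    intro k
    induction k with
    | zero => simpa using hu
    | succ k ih =>
      rw [pow_succ']
      exact hC _ ih μ hμ0
  have hsum : HasSum (fun k => B ^ k) (Units.val (Units.oneSub B hμ)⁻¹) :=
    (summable_geometric_of_norm_lt_one hμ).hasSum
  have hsum' := (ContinuousLinearMap.apply ℂ H u).hasSum hsum
  have hsum'' := R.hasSum hsum'
  have hs := ((innerSL ℂ w).hasSum hsum'')
  have hs2 := hs.map (starRingEnd ℂ : ℂ →+* ℂ) Complex.continuous_conj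
  simp only [Function.comp_def, innerSL_apply_apply, inner_conj_symm,
    ContinuousLinearMap.apply_apply] at hs2
  -- All terms are nonnegative, and the term `k = 0`, which is `⟨R u, w⟩`, is already strictly
  -- positive.
  refine hasSum_pos_of_nonneg hs2 (fun k => ?_) ?_
  · rcases eq_or_ne ((B ^ k) u) 0 with h | h
    · simp [h]
    · exact (hR _ (hmem k) w hw h hw0).le
  · simpa using hR u hu w hw hu0 hw0

end Abstract

end Polaron

end

/-! ### Strict positivity of solutions. -/

noncomputable section

namespace Polaron

open Filter Topology

section Improving

variable {ℓ : ℝ} [Fact (0 < ℓ)]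

theorem comp_smul (c : ℂ) (Ψ : Hilb ℓ) (n : ℕ) : comp (c • Ψ) n = c • comp Ψ n := rfl

theorem smul_mem_cone {Ψ : Hilb ℓ} (h : Ψ ∈ cone ℓ) {c : ℝ} (hc : 0 ≤ c) :
    (c : ℂ) • Ψ ∈ cone ℓ := by
  intro n
  rw [comp_smul]
  filter_upwards [h n, Lp.coeFn_smul (c : ℂ) (comp Ψ n)] with z h1 h2
  rw [h2, Pi.smul_apply, smul_eq_mul, mul_left_comm]
  exact mul_nonneg (by exact_mod_cast hc) h1

/-- The fixed vectors of the free resolvent are multiples of the vacuum. -/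
theorem eq_smul_testElem_of_fixed {lam : ℝ} {q : FormSpace ℓ}
    (h : IsSolution 0 lam q ((lam : ℂ) • embed ℓ q)) :
    ∃ c : ℂ, embed ℓ q = c • embed ℓ (testElem ℓ 0) := by
  -- Testing the equation with `q` itself leaves no kinetic or number energy, so only constants in
  -- the vacuum sector remain.
  have h1 : ‖q‖ ^ 2 = ‖embed ℓ q‖ ^ 2 := by
    have h2 := congrArg Complex.re (h q)
    rw [re_inner_formOp_self, Real.sqrt_zero, inner_smul_right, Complex.re_ofReal_mul] at h2
    have h3 : (⟪embed ℓ q, embed ℓ q⟫_ℂ).re = ‖embed ℓ q‖ ^ 2 := inner_self_eq_norm_sq (𝕜 := ℂ) _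
    rw [h3] at h2
    linarith
  have hterm : ∀ n, ‖q n‖ ^ 2 - ‖comp (embed ℓ q) n‖ ^ 2
      = (∑ i, ‖gr (q n) i‖ ^ 2) + n * ‖fn (q n)‖ ^ 2 := fun n => by
    rw [norm_sq_sect, comp_embed]
    ring
  have hsum := (lp_two_hasSum_norm_sq q).sub (Hilb_hasSum_norm_sq (embed ℓ q))
  rw [h1, sub_self] at hsum
  simp only [hterm] at hsum
  have hzero := (hasSum_zero_iff_of_nonneg (fun n => by positivity)).1 hsum
  have hz : ∀ n : ℕ, (∑ i, ‖gr (q n) i‖ ^ 2) + n * ‖fn (q n)‖ ^ 2 = 0 := fun n => congrFun hzero n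
  have hgr : ∀ i, gr (q 0) i = 0 := fun i => by
    have h2 := hz 0
    rw [Nat.cast_zero, zero_mul, add_zero] at h2
    have h3 := (Finset.sum_eq_zero_iff_of_nonneg fun k _ => by positivity).1 h2 i
      (Finset.mem_univ i)
    exact norm_eq_zero.1 (pow_eq_zero_iff two_ne_zero |>.1 h3)
  obtain ⟨c, hc⟩ := exists_const_of_grad_eq_zero (f := fn (q 0)) fun i => by
    rw [← hgr i]
    exact hasDerivAt_fn (q 0) i
  refine ⟨c, Hilb_ext fun n => ?_⟩
  rw [comp_smul, comp_embed, comp_embed]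
  rcases Nat.eq_zero_or_pos n with rfl | hn
  · refine Lp.ext ?_
    filter_upwards [hc, Lp.coeFn_smul c (fn (testElem ℓ 0 0)), fn_testElem (ℓ := ℓ) 0]
      with z h2 h3 h4
    rw [h2, h3, Pi.smul_apply, h4]
    simp [weight]
  · rw [fn_testElem_of_ne hn.ne', smul_zero]
    have h2 := hz n
    have h3 : (0 : ℝ) ≤ ∑ i, ‖gr (q n) i‖ ^ 2 := by positivity
    have h4 : (n : ℝ) * ‖fn (q n)‖ ^ 2 = 0 :=
      le_antisymm (by linarith) (by positivity)
    have h5 := (mul_eq_zero.1 h4).resolve_left (by exact_mod_cast hn.ne')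
    exact norm_eq_zero.1 (pow_eq_zero_iff two_ne_zero |>.1 h5)

/-- Without phonons the weight is the constant `1`, which the free operator annihilates. -/
theorem isSolution_vacuum (lam : ℝ) :
    IsSolution 0 lam (testElem ℓ 0) ((lam : ℂ) • embed ℓ (testElem ℓ 0)) := by
  intro q
  have h : ⟪q, testElem ℓ 0⟫_ℂ = ⟪embed ℓ q, embed ℓ (testElem ℓ 0)⟫_ℂ := by
    refine (lp.hasSum_inner q (testElem ℓ 0)).unique ?_
    have hn : ∀ n, ⟪q n, testElem ℓ 0 n⟫_ℂ
        = ⟪comp (embed ℓ q) n, comp (embed ℓ (testElem ℓ 0)) n⟫_ℂ := fun n => by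
      rw [comp_embed, comp_embed]
      rcases eq_or_ne n 0 with rfl | hn
      · rw [inner_sect]
        simp [gr_testElem_zero]
      · rw [testElem_ne hn, inner_zero_right, fn_zero, inner_zero_right]
    rw [funext hn]
    exact Hilb_hasSum_inner _ _
  rw [inner_formOp, h, Real.sqrt_zero, inner_smul_right]
  push_cast
  ring

/-- Nonnegativity of the free operator; it makes `lam` times the free resolvent a contraction, as
the mean ergodic theorem requires. -/
theorem norm_free_solution_le {lam : ℝ} {q : FormSpace ℓ} {g : Hilb ℓ} (h : IsSolution 0 lam q g) :
    lam * ‖embed ℓ q‖ ≤ ‖g‖ := by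
  have h2 := congrArg Complex.re (h q)
  rw [re_inner_formOp_self, Real.sqrt_zero] at h2
  have h3 := (Complex.re_le_norm ⟪embed ℓ q, g⟫_ℂ).trans (norm_inner_le_norm (embed ℓ q) g)
  have h4 := pow_le_pow_left₀ (norm_nonneg _) (norm_embed_le q) 2
  rcases eq_or_ne ‖embed ℓ q‖ 0 with h0 | h0
  · rw [h0, mul_zero]
    exact norm_nonneg g
  · have h5 : 0 < ‖embed ℓ q‖ := lt_of_le_of_ne (norm_nonneg _) (Ne.symm h0)
    refine le_of_mul_le_mul_left ?_ h5
    nlinarith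

/-- The weak solution with a non-zero right-hand side in the cone is strictly positive. -/
theorem solution_ae_ne_zero {α lam : ℝ} (hα : 0 < α) {p : FormSpace ℓ} {u : Hilb ℓ}
    (hp : embed ℓ p ∈ cone ℓ) (hu : u ∈ cone ℓ) (hsol : IsSolution α lam p u) (hu0 : u ≠ 0)
    (n : ℕ) : ∀ᵐ z, fn (p n) z ≠ 0 := by
  obtain ⟨lam₀, hlam₀, hres⟩ := exists_resolvent 0
  -- Large enough for the free resolvent to exist and preserve the cone, and strictly above `lam`,
  -- so that the term `(lam' - lam)⟨q, p⟩` yields orthogonality.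
  set lam' := max lam₀ (lam + 1)
  have hlam : lam < lam' := (lt_add_one lam).trans_le (le_max_right _ _)
  have hpos : 0 < lam' := hlam₀.trans_le (le_max_left _ _)
  obtain ⟨R, -, -, hR, huniq, hcone⟩ := hres ℓ lam' (le_max_left _ _)
  have hvanish : ∀ g ∈ cone ℓ, ⟪g, embed ℓ p⟫_ℂ = 0 → ∀ q, IsSolution 0 lam' q g →
      embed ℓ q ∈ cone ℓ → ⟪embed ℓ q, embed ℓ p⟫_ℂ = 0 ∧
        ∀ n, ∀ᵐ x, pairKernel (fn (p n)) (fn (q (n + 1))) x = 0 := by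
    intro g hg hgp q hq hqc
    have h1 : ⟪q, formOp ℓ 0 lam' p⟫_ℂ = 0 := by
      rw [← formOp_symm, ← inner_conj_symm, hq p, inner_conj_symm, hgp]
    obtain ⟨-, h2, -, h3⟩ := vanishing_of_inner_formOp_zero hα hlam.le hp hqc hu hsol h1
    exact ⟨h2 hlam, h3⟩
  induction n with
  | zero =>
    refine ae_ne_zero_of_forall 0 (Ψ := embed ℓ p) fun g hg hgp => ?_
    set A : Hilb ℓ →L[ℂ] Hilb ℓ := (lam' : ℂ) • R
    have hA : ‖A‖ ≤ 1 := by
      refine A.opNorm_le_bound zero_le_one fun f => ?_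
      obtain ⟨q, hq, hq'⟩ := hR f
      have h1 : A f = (lam' : ℂ) • embed ℓ q := by rw [← hq]; rfl
      rw [h1, norm_smul, Complex.norm_real, Real.norm_of_nonneg hpos.le, one_mul]
      exact norm_free_solution_le hq'
    -- Orthogonality to `p` inside the cone is inherited by the free resolvent, hence by the whole
    -- orbit.
    have horbit : ∀ k : ℕ, A^[k] g ∈ cone ℓ ∧ ⟪A^[k] g, embed ℓ p⟫_ℂ = 0 := by
      intro k
      induction k with
      | zero => exact ⟨hg, hgp⟩
      | succ k ih =>
        rw [Function.iterate_succ_apply']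
        obtain ⟨q, hq, hq'⟩ := hR (A^[k] g)
        have hqc : embed ℓ q ∈ cone ℓ := hq ▸ hcone _ ih.1
        have h1 : A (A^[k] g) = (lam' : ℂ) • embed ℓ q := by rw [← hq]; rfl
        rw [h1]
        refine ⟨smul_mem_cone hqc hpos.le, ?_⟩
        rw [inner_smul_left, (hvanish _ ih.1 ih.2 q hq' hqc).1, mul_zero]
    obtain ⟨P, hP1, hP2, hP3⟩ := exists_fixed_of_orbit_orthogonal hA fun k => (horbit k).2
    have hω : A (embed ℓ (testElem ℓ 0)) = embed ℓ (testElem ℓ 0) := by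
      have h1 := huniq _ _ (isSolution_vacuum (ℓ := ℓ) lam')
      rw [map_smul] at h1
      exact h1
    have hP4 := hP3 _ hω
    obtain ⟨q, hq, hq'⟩ := hR ((lam' : ℂ) • P)
    rw [map_smul] at hq
    have hPq : P = embed ℓ q := hP1.symm.trans hq
    rw [hPq] at hq'
    obtain ⟨c, hc⟩ := eq_smul_testElem_of_fixed hq'
    rw [hPq, hc] at hP2 hP4
    rw [inner_smul_left] at hP2
    have hne : ⟪embed ℓ (testElem ℓ 0), embed ℓ p⟫_ℂ ≠ 0 := fun h0 =>
      fn_zero_ne_zero hα hp hu hsol hu0 (comp_eq_zero_of_inner_testElem hp h0)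
    have hc0 : c = 0 := by
      have h1 := (mul_eq_zero.1 hP2).resolve_right hne
      simpa using h1
    rw [hc0, zero_smul, inner_zero_right] at hP4
    exact comp_eq_zero_of_inner_testElem hg hP4.symm
  | succ n ih =>
    refine ae_ne_zero_of_forall (n + 1) (Ψ := embed ℓ p) fun g hg hgp => ?_
    obtain ⟨q, hq, hq'⟩ := hR g
    have hqc : embed ℓ q ∈ cone ℓ := hq ▸ hcone g hg
    -- The pairing of `p⁽ⁿ⁾`, nonzero almost everywhere, with `q⁽ⁿ⁺¹⁾` vanishes; so `q⁽ⁿ⁺¹⁾ = 0`,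
    -- and the sector-diagonal free equation gives `g⁽ⁿ⁺¹⁾ = 0`.
    have h1 := eq_zero_of_pairKernel_eq_zero ih ((hvanish g hg hgp q hq' hqc).2 n)
    have h2 := hq' (testElem ℓ (n + 1))
    rw [inner_testElem_formOp_zero h1] at h2
    exact comp_eq_zero_of_inner_testElem hg h2.symm

theorem positivityImproving_of_solution {α lam : ℝ} (hα : 0 < α) {R : Hilb ℓ →L[ℂ] Hilb ℓ}
    (hR : ∀ f, ∃ p, R f = embed ℓ p ∧ IsSolution α lam p f) (hcone : ∀ f ∈ cone ℓ, R f ∈ cone ℓ) :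
    PositivityImproving (cone ℓ) R := by
  intro u hu w hw hu0 hw0
  obtain ⟨s, hs, hs', -⟩ := inner_cone (hcone u hu) hw
  rcases hs.eq_or_lt with h | h
  · exfalso
    apply hw0
    rw [← h, Complex.ofReal_zero] at hs'
    have h1 := ae_eq_zero_of_inner_cone (hcone u hu) hw hs'
    obtain ⟨p, hp, hp'⟩ := hR u
    have hpc : embed ℓ p ∈ cone ℓ := hp ▸ hcone u hu
    refine Hilb_ext fun n => ?_
    change comp w n = 0
    rw [Lp.eq_zero_iff_ae_eq_zero]
    filter_upwards [h1 n, solution_ae_ne_zero hα hpc hu hp' hu0 n] with z h2 h3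
    rw [hp, comp_embed, mul_eq_zero, norm_eq_zero, norm_eq_zero] at h2
    exact h2.resolve_left h3
  · rw [hs']
    exact_mod_cast h

/-- Makes the volume nonzero, so that almost-everywhere statements have witnesses and the cone
contains nonzero vectors. -/
instance isOpenPosMeasure_conf (n : ℕ) : (volume : Measure (Conf ℓ n)).IsOpenPosMeasure := by
  have h1 : (volume : Measure (Torus ℓ)).IsOpenPosMeasure := Measure.pi.isOpenPosMeasure _
  have h2 : (volume : Measure (Fin n → R3)).IsOpenPosMeasure := Measure.pi.isOpenPosMeasure _
  exact Measure.prod.instIsOpenPosMeasure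

theorem embed_testElem_ne_zero (n : ℕ) : embed ℓ (testElem ℓ n) ≠ 0 := by
  intro h
  have h1 : comp (embed ℓ (testElem ℓ n)) n = 0 := by
    rw [h]
    rfl
  rw [comp_embed, Lp.eq_zero_iff_ae_eq_zero] at h1
  obtain ⟨z, h2, h3⟩ := (h1.and (fn_testElem_ne_zero n)).exists
  exact h3 h2

end Improving

end Polaron

end

/-! ### The bottom of the spectrum and all resolvents below it. -/

open Polaron

theorem proposition2p4 (α : ℝ) (hα : 0 < α) (ℓ : ℝ) [Fact (0 < ℓ)] :
    ∃ E : ℝ, IsGLB {s : ℝ | (s : ℂ) ∈ Polaron.spec (Polaron.hGraph α ℓ)} E ∧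
      ∀ lam : ℝ, -E < lam →
        ∃ R : Polaron.Hilb ℓ →L[ℂ] Polaron.Hilb ℓ,
          Polaron.IsResolvent (Polaron.hGraph α ℓ) (-(lam : ℂ)) R ∧
            Polaron.PositivityImproving (Polaron.cone ℓ) R := by

  obtain ⟨lam₀, -, hres⟩ := exists_resolvent α
  obtain ⟨R, hpos, hR, hsol, -, hcone⟩ := hres ℓ lam₀ le_rfl
  have himp := positivityImproving_of_solution hα hsol hcone
  have hR0 : R ≠ 0 := by
    rintro rfl
    have h := himp _ (testElem_mem_cone (ℓ := ℓ) 0) _ (testElem_mem_cone 0)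
      (embed_testElem_ne_zero 0) (embed_testElem_ne_zero 0)
    simp at h
  have himproving : ∀ lam : ℝ, -(‖R‖⁻¹ - lam₀) < lam →
      ∃ R' : Hilb ℓ →L[ℂ] Hilb ℓ, IsResolvent (hGraph α ℓ) (-(lam : ℂ)) R' ∧
        PositivityImproving (cone ℓ) R' := by
    intro lam hlam
    -- From `lam₀` on the coercive construction applies; below it the Neumann series in `(lam₀ -
    -- lam) • R` converges, since `lam₀ - lam < ‖R‖⁻¹`.
    rcases le_or_gt lam₀ lam with h | h
    · obtain ⟨R', -, hR', hsol', -, hcone'⟩ := hres ℓ lam h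
      exact ⟨R', hR', positivityImproving_of_solution hα hsol' hcone'⟩
    · have h0 : 0 ≤ lam₀ - lam := by linarith
      have h1 := norm_smul_lt_one hR0 h0 (by linarith)
      refine ⟨_, ?_, positivityImproving_neumann himp
        (fun u hu c hc => smul_mem_cone (hcone u hu) hc) h0 h1⟩
      convert hR.neumann h1 using 1
      push_cast
      ring
  -- The infimum is attained: this point is in the spectrum, while every smaller real `s` has a
  -- resolvent, obtained with `lam = -s`.
  refine ⟨‖R‖⁻¹ - lam₀, ⟨fun s hs => ?_, fun b hb => hb (hR.bottom_mem_spec hpos hR0)⟩, himproving⟩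
  by_contra! hlt
  obtain ⟨R', hR', -⟩ := himproving (-s) (by linarith)
  refine hs ⟨R', ?_⟩
  convert hR' using 1
  push_cast
  ring
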